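/- **Setting.** Let $0<\alpha\le 1$, $a<b$, $T>0$, an integer $m\ge 2$ and $K$ be fixed. For $0<\varepsilon\le1$ and $0\le\beta\le2$ put $T_\varepsilon=T/\varepsilon^{\beta}$, and let $\psi(x,t)$ be a classical solution on $0\le t\le T_\varepsilon$ of $$i\partial_t\psi-\alpha\partial_{tt}\psi+\partial_{xx}\psi-\varepsilon^2|\psi|^2\psi=0,\qquad \psi(x,0)=\psi_0(x),\quad \partial_t\psi(x,0)=\psi_1(x),$$ with periodic boundary conditions on $\Omega=(a,b)$, i.e. $\psi$ extends $(b-a)$-periodically in $x$ and $\psi,\partial_t\psi,\partial_{tt}\psi,\partial_x\psi,\partial_{xx}\psi$ are continuous. Let $\mu_l=\frac{2\pi l}{b-a}$, $\widehat u_l=\frac1{b-a}\int_a^b u(x)e^{-i\mu_l(x-a)}dx$, and $\|u\|_{H^k}^2=\sum_{l\in\mathbb Z}(1+\mu_l^2)^k|\widehat u_l|^2$. Regularity assumptions: (A) $\ \|\psi\|_{L^\infty([0,T_\varepsilon];W^{1,\infty}\cap H^m)}+\|\partial_t\psi\|_{L^\infty([0,T_\varepsilon];H^1)}+\|\partial_{tt}\psi\|_{L^\infty([0,T_\varepsilon];H^1)}\le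 K$; (B) $\ \|\psi_0\|_{H^{m+2}}\le K$. **Scheme (EWI-FP).** For an even integer $M>0$ let $h=(b-a)/M$, $x_j=a+jh$ ($0\le j\le M$), $\mathcal T_M=\{-\frac M2,\dots,\frac M2-1\}$. For $u=(u_0,\dots,u_M)$ with $u_0=u_M$ let $\widetilde u_l=\frac1M\sum_{j=0}^{M-1}u_je^{-i\mu_l(x_j-a)}$, $I_Mu(x)=\sum_{l\in\mathcal T_M}\widetilde u_le^{i\mu_l(x-a)}$, $\|u\|_{l^\infty}=\max_{0\le j\le M-1}|u_j|$; a function is identified with its grid values. Let $\tau>0$, $t_n=n\tau$, $f(v)=|v|^2v$. Set $\psi^0_j=\psi_0(x_j)$ and $\psi^{n+1}_j=\sum_{l\in\mathcal T_M}\widetilde{(\psi^{n+1})}_le^{i\mu_l(x_j-a)}$, where $$\widetilde{(\psi^1)}_l=c^0_l\widetilde{(\psi_0)}_l+d^0_l\widetilde{(\psi_1)}_l+p_l\widetilde{(f(\psi_0))}_l+q_l\widetilde{(g(\psi^0))}_l,$$ $$\widetilde{(\psi^{n+1})}_l=c_l\widetilde{(\psi^{n-1})}_l+d_l\widetilde{(\psi^n)}_l+p_l\widetilde{(f(\psi^n))}_l+q_l\widetilde{(g(\psi^n))}_l-p_l^*\widetilde{(f(\psi^{n-1}))}_l-q_l^*\widetilde{(g(\psi^{n-1}))}_l\quad(n\ge1),$$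 with $g(\psi^0)=2|\psi_0|^2\psi_1+\psi_0^2\overline{\psi_1}$ and $g(\psi^n)=(f(\psi^n)-f(\psi^{n-1}))/\tau$ for $n\ge1$. With $\beta_l^\pm=\frac{1\pm\sqrt{1+4\alpha\mu_l^2}}{2\alpha}$, $\beta_l=\beta_l^+-\beta_l^-$, $\operatorname{sinc}s=\frac{\sin s}{s}$ ($\operatorname{sinc}0=1$), $\sigma_l^\pm=e^{i\beta_l^\pm\tau/2}\operatorname{sinc}(\beta_l^\pm\tau/2)$, the coefficients are $$c_l^0=\frac{\beta_l^+e^{i\beta_l^-\tau}-\beta_l^-e^{i\beta_l^+\tau}}{\beta_l},\quad d_l^0=\tau e^{i\tau/(2\alpha)}\operatorname{sinc}(\tau\beta_l/2),\quad c_l=-e^{i\tau/\alpha},\quad d_l=2e^{i\tau/(2\alpha)}\cos(\tau\beta_l/2),$$ $$p_l=\frac{i\varepsilon^2\tau}{\alpha\beta_l}(\sigma_l^+-\sigma_l^-),\qquad p_l^*=\frac{i\varepsilon^2\tau e^{i\tau/\alpha}}{\alpha\beta_l}\big(\overline{\sigma_l^+}-\overline{\sigma_l^-}\big),$$ $$q_l=\frac{-\varepsilon^2\tau}{\alpha\beta_l}\Big(\frac{1-\sigma_l^+}{\beta_l^+}-\frac{1-\sigma_l^-}{\beta_l^-}\Big),\qquad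 q_l^*=\frac{-\varepsilon^2\tau e^{i\tau/\alpha}}{\alpha\beta_l}\Big(\frac{1-\sigma_l^+}{\beta_l^+e^{i\beta_l^+\tau}}-\frac{1-\sigma_l^-}{\beta_l^-e^{i\beta_l^-\tau}}\Big),$$ where for $l=0$ (so $\beta_0^-=0$) each of the two quotients with denominator containing $\beta_0^-$ is replaced by its limit $-i\tau/2$. **Theorem 3.1.** There are constants $h_0,\tau_0,C>0$ depending only on $\alpha,a,b,T,m,K$ such that, for all $0<\varepsilon\le1$, all $0\le\beta\le2$, all solutions $\psi$ as above satisfying (A) and (B), all even $M>0$ with $h<h_0$, all $0<\tau<\tau_0$ and all integers $0\le n\le\frac{T/\varepsilon^\beta}{\tau}$, $$\|\psi(\cdot,t_n)-I_M\psi^n\|_{H^1}\le C\big(h^{m-1}+\varepsilon^{2-\beta}\tau^2\big),\qquad \|\psi^n\|_{l^\infty}\le1+M_1,$$ where $M_1$ is any number with $|\psi(x,t)|\le M_1$ for all $x$ and all $t\in[0,T_\varepsilon]$ (for a family of solutions indexed by $\varepsilon$, for instance $M_1=\sup_{0<\varepsilon\le1}\sup_{0\le t\le T_\varepsilon}\|\psi(\cdot,t)\|_{L^\infty}$).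 -/

import Mathlib

open scoped ENNReal

noncomputable section

namespace NLSW

/-! ### Periodic functions on `Ω = (a, b)`, Fourier coefficients and norms

Functions on the torus are represented by `(b - a)`-periodic functions `ℝ → ℂ`; functions of time
and space by `u : ℝ → ℝ → ℂ`, where `u t x` is the value at time `t` and position `x`. -/

/-- The frequency `μ_l = 2 π l / (b - a)`. -/
def freq (a b : ℝ) (l : ℤ) : ℝ := 2 * Real.pi * l / (b - a)

/-- The exponential `e^{i μ_l (x - a)}`. -/
def mode (a b : ℝ) (l : ℤ) (x : ℝ) : ℂ :=
  Complex.exp (Complex.I * (freq a b l : ℂ) * ((x : ℂ) - (a : ℂ)))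

/-- The exponential `e^{- i μ_l (x - a)}`. -/
def modeConj (a b : ℝ) (l : ℤ) (x : ℝ) : ℂ :=
  Complex.exp (-(Complex.I * (freq a b l : ℂ) * ((x : ℂ) - (a : ℂ))))

/-- The Fourier coefficient `û_l = (b - a)⁻¹ ∫_a^b u(x) e^{- i μ_l (x - a)} dx`. -/
def fourierHat (a b : ℝ) (u : ℝ → ℂ) (l : ℤ) : ℂ :=
  (1 / ((b : ℂ) - (a : ℂ))) * ∫ x in a..b, u x * modeConj a b l x

/-- The norm of the periodic Sobolev space `H^m(Ω)`,
`‖u‖_{H^m}² = ∑_{l ∈ ℤ} (1 + μ_l²)^m |û_l|²`, with the value `∞` if the series diverges.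
It is only applied to continuous functions `u`. -/
def sobolevNorm (a b : ℝ) (m : ℕ) (u : ℝ → ℂ) : ℝ≥0∞ :=
  (∑' l : ℤ, ENNReal.ofReal ((1 + freq a b l ^ 2) ^ m * ‖fourierHat a b u l‖ ^ 2)) ^ (1 / 2 : ℝ)

/-- The norm `‖u‖_{L^∞} + ‖u'‖_{L^∞}` of `W^{1,∞}(Ω)`, for a continuously differentiable
periodic function `u` (so that essential suprema are suprema). -/
def lipNorm (u : ℝ → ℂ) : ℝ≥0∞ :=
  (⨆ x : ℝ, ‖u x‖ₑ) + ⨆ x : ℝ, ‖deriv u x‖ₑ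

/-! ### The equation -/

/-- The cubic nonlinearity `f(v) = |v|² v`. -/
def cubic (v : ℂ) : ℂ := (‖v‖ : ℂ) ^ 2 * v

/-- The time derivative `∂_t u` on the time interval `[0, S]` (one-sided at the end points). -/
def timeDeriv (S : ℝ) (u : ℝ → ℝ → ℂ) : ℝ → ℝ → ℂ :=
  fun t x => derivWithin (fun s => u s x) (Set.Icc 0 S) t

/-- The space derivative `∂_x u`. -/
def spaceDeriv (u : ℝ → ℝ → ℂ) : ℝ → ℝ → ℂ :=
  fun t x => deriv (fun y => u t y) x

/-- `ψ` is a classical solution, on the time interval `[0, S]`, of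
`i ∂_t ψ - α ∂_tt ψ + ∂_xx ψ - ε² |ψ|² ψ = 0` with periodic boundary conditions on `(a, b)` and
initial data `ψ(·, 0) = ψ₀`, `∂_t ψ(·, 0) = ψ₁`. -/
structure IsSolution (α ε a b S : ℝ) (ψ₀ ψ₁ : ℝ → ℂ) (ψ : ℝ → ℝ → ℂ) : Prop where
  periodic : ∀ t ∈ Set.Icc 0 S, Function.Periodic (ψ t) (b - a)
  contDiff_time : ∀ x : ℝ, ContDiffOn ℝ 2 (fun t => ψ t x) (Set.Icc 0 S)
  contDiff_space : ∀ t ∈ Set.Icc 0 S, ContDiff ℝ 2 (ψ t)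
  continuous : ContinuousOn (fun z : ℝ × ℝ => ψ z.1 z.2) (Set.Icc 0 S ×ˢ Set.univ)
  continuous_t :
    ContinuousOn (fun z : ℝ × ℝ => timeDeriv S ψ z.1 z.2) (Set.Icc 0 S ×ˢ Set.univ)
  continuous_tt :
    ContinuousOn (fun z : ℝ × ℝ => timeDeriv S (timeDeriv S ψ) z.1 z.2)
      (Set.Icc 0 S ×ˢ Set.univ)
  continuous_x :
    ContinuousOn (fun z : ℝ × ℝ => spaceDeriv ψ z.1 z.2) (Set.Icc 0 S ×ˢ Set.univ)
  continuous_xx :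
    ContinuousOn (fun z : ℝ × ℝ => spaceDeriv (spaceDeriv ψ) z.1 z.2)
      (Set.Icc 0 S ×ˢ Set.univ)
  equation : ∀ t ∈ Set.Ioc 0 S, ∀ x : ℝ,
    Complex.I * timeDeriv S ψ t x - (α : ℂ) * timeDeriv S (timeDeriv S ψ) t x
      + spaceDeriv (spaceDeriv ψ) t x - (ε : ℂ) ^ 2 * cubic (ψ t x) = 0
  initial : ∀ x : ℝ, ψ 0 x = ψ₀ x
  initial_t : ∀ x : ℝ, timeDeriv S ψ 0 x = ψ₁ x

/-- The quantity `‖ψ‖_{L^∞([0,S]; W^{1,∞} ∩ H^m)} + ‖∂_t ψ‖_{L^∞([0,S]; H¹)}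
+ ‖∂_tt ψ‖_{L^∞([0,S]; H¹)}`. -/
def regularityNorm (a b S : ℝ) (m : ℕ) (ψ : ℝ → ℝ → ℂ) : ℝ≥0∞ :=
  (⨆ t ∈ Set.Icc 0 S, (lipNorm (ψ t) + sobolevNorm a b m (ψ t)))
    + (⨆ t ∈ Set.Icc 0 S, sobolevNorm a b 1 (timeDeriv S ψ t))
    + (⨆ t ∈ Set.Icc 0 S, sobolevNorm a b 1 (timeDeriv S (timeDeriv S ψ) t))

/-! ### Grid functions and trigonometric interpolation -/

/-- Vectors `(u_0, …, u_M)` of grid values. -/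
abbrev Grid (M : ℕ) : Type := Fin (M + 1) → ℂ

/-- The mesh size `h = (b - a) / M`. -/
def meshSize (a b : ℝ) (M : ℕ) : ℝ := (b - a) / M

/-- The grid point `x_j = a + j h`. -/
def gridPoint (a b : ℝ) (M : ℕ) (j : ℕ) : ℝ := a + j * meshSize a b M

/-- The grid values `u(x_j)` of a function. -/
def sample (a b : ℝ) (M : ℕ) (u : ℝ → ℂ) : Grid M := fun j => u (gridPoint a b M j)

/-- The index set `{-M/2, …, M/2 - 1}` (for even `M`). -/
def modes (M : ℕ) : Finset ℤ := Finset.Ico (-((M : ℤ) / 2)) ((M : ℤ) / 2)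

/-- The discrete Fourier coefficient `ũ_l = M⁻¹ ∑_{j=0}^{M-1} u_j e^{- i μ_l (x_j - a)}`. -/
def fourierTilde (a b : ℝ) {M : ℕ} (u : Grid M) (l : ℤ) : ℂ :=
  (1 / (M : ℂ)) * ∑ j : Fin M, u j.castSucc * modeConj a b l (gridPoint a b M j)

/-- The trigonometric interpolant `I_M u(x) = ∑_l ũ_l e^{i μ_l (x - a)}` of a grid function. -/
def interp (a b : ℝ) {M : ℕ} (u : Grid M) (x : ℝ) : ℂ :=
  ∑ l ∈ modes M, fourierTilde a b u l * mode a b l x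

/-- The norm `‖u‖_{l^∞} = max_{0 ≤ j ≤ M-1} |u_j|`. -/
def linftyNorm {M : ℕ} (u : Grid M) : ℝ := ‖fun j : Fin M => u j.castSucc‖

/-! ### The coefficients of the exponential wave integrator -/

/-- `√(1 + 4 α μ_l²)`. -/
def disc (α a b : ℝ) (l : ℤ) : ℝ := Real.sqrt (1 + 4 * α * freq a b l ^ 2)

/-- `β_l^+`. -/
def betaPlus (α a b : ℝ) (l : ℤ) : ℝ := (1 + disc α a b l) / (2 * α)

/-- `β_l^-`. -/
def betaMinus (α a b : ℝ) (l : ℤ) : ℝ := (1 - disc α a b l) / (2 * α)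

/-- `β_l = β_l^+ - β_l^-`. -/
def betaDiff (α a b : ℝ) (l : ℤ) : ℝ := betaPlus α a b l - betaMinus α a b l

/-- `e^{i θ}` for real `θ`. -/
def cis (θ : ℝ) : ℂ := Complex.exp (Complex.I * (θ : ℂ))

/-- `σ(s) = e^{i β s / 2} sinc(β s / 2)`, for `β = β_l^±`; it is `1` if `β = 0`. -/
def sigma (β s : ℝ) : ℂ := cis (β * s / 2) * (Real.sinc (β * s / 2) : ℂ)

/-- `c_l^0`. -/
def coefC0 (α a b τ : ℝ) (l : ℤ) : ℂ :=
  ((betaPlus α a b l : ℂ) * cis (betaMinus α a b l * τ)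
    - (betaMinus α a b l : ℂ) * cis (betaPlus α a b l * τ)) / (betaDiff α a b l : ℂ)

/-- `d_l^0`, the coefficient `i (e^{i β_l^- τ} - e^{i β_l^+ τ}) / β_l` of `∂_t ψ̂_l(0)` in the
variation-of-constants formula, in closed form. -/
def coefD0 (α a b τ : ℝ) (l : ℤ) : ℂ :=
  (τ : ℂ) * cis (τ / (2 * α)) * (Real.sinc (τ * betaDiff α a b l / 2) : ℂ)

/-- `c_l`. -/
def coefC (α τ : ℝ) : ℂ := -cis (τ / α)

/-- `d_l`. -/
def coefD (α a b τ : ℝ) (l : ℤ) : ℂ :=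
  2 * cis (τ / (2 * α)) * (Real.cos (τ * betaDiff α a b l / 2) : ℂ)

/-- `p_l`; for `l = 0` one has `β_0^- = 0`, so that the last `sigma` is `1`. -/
def coefP (α ε a b τ : ℝ) (l : ℤ) : ℂ :=
  Complex.I * (ε : ℂ) ^ 2 * (τ : ℂ) / ((α : ℂ) * (betaDiff α a b l : ℂ))
    * (sigma (betaPlus α a b l) τ - sigma (betaMinus α a b l) τ)

/-- `p_l^*`. -/
def coefPStar (α ε a b τ : ℝ) (l : ℤ) : ℂ :=
  Complex.I * (ε : ℂ) ^ 2 * (τ : ℂ) * cis (τ / α) / ((α : ℂ) * (betaDiff α a b l : ℂ))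
    * (star (sigma (betaPlus α a b l) τ) - star (sigma (betaMinus α a b l) τ))

/-- `q_l`. -/
def coefQ (α ε a b τ : ℝ) (l : ℤ) : ℂ :=
  -(ε : ℂ) ^ 2 * (τ : ℂ) / ((α : ℂ) * (betaDiff α a b l : ℂ))
    * ((1 - sigma (betaPlus α a b l) τ) / (betaPlus α a b l : ℂ)
      - if l = 0 then -(Complex.I * (τ : ℂ) / 2)
        else (1 - sigma (betaMinus α a b l) τ) / (betaMinus α a b l : ℂ))

/-- `q_l^*`. -/
def coefQStar (α ε a b τ : ℝ) (l : ℤ) : ℂ :=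
  -(ε : ℂ) ^ 2 * (τ : ℂ) * cis (τ / α) / ((α : ℂ) * (betaDiff α a b l : ℂ))
    * ((1 - sigma (betaPlus α a b l) τ)
          / ((betaPlus α a b l : ℂ) * cis (betaPlus α a b l * τ))
      - if l = 0 then -(Complex.I * (τ : ℂ) / 2)
        else (1 - sigma (betaMinus α a b l) τ)
          / ((betaMinus α a b l : ℂ) * cis (betaMinus α a b l * τ)))

/-! ### The exponential wave integrator Fourier pseudospectral scheme -/

/-- The grid function with discrete Fourier coefficients `c_l`. -/
def synth (a b : ℝ) (M : ℕ) (c : ℤ → ℂ) : Grid M :=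
  fun j => ∑ l ∈ modes M, c l * mode a b l (gridPoint a b M j)

/-- The grid function `f(u)`. -/
def cubicGrid {M : ℕ} (u : Grid M) : Grid M := fun j => cubic (u j)

/-- The grid function `g(ψ₀) = 2 |ψ₀|² ψ₁ + ψ₀² \overline{ψ₁}`. -/
def gInit {M : ℕ} (u₀ u₁ : Grid M) : Grid M :=
  fun j => 2 * (‖u₀ j‖ : ℂ) ^ 2 * u₁ j + u₀ j ^ 2 * star (u₁ j)

/-- The backward difference `(f(v) - f(u)) / τ` of the nonlinearity, where `u` is the grid function
at the time step before that of `v`. -/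
def gDiff (τ : ℝ) {M : ℕ} (v u : Grid M) : Grid M :=
  fun j => (cubic (v j) - cubic (u j)) / (τ : ℂ)

/-- The first step of the scheme: `ψ^1` from the grid values of `ψ₀` and `ψ₁`. -/
def firstStep (α ε a b τ : ℝ) {M : ℕ} (u₀ u₁ : Grid M) : Grid M :=
  synth a b M fun l =>
    coefC0 α a b τ l * fourierTilde a b u₀ l
      + coefD0 α a b τ l * fourierTilde a b u₁ l
      + coefP α ε a b τ l * fourierTilde a b (cubicGrid u₀) l
      + coefQ α ε a b τ l * fourierTilde a b (gInit u₀ u₁) l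

/-- A later step of the scheme: `ψ^{n+1}` from `v = ψ^n`, `u = ψ^{n-1}`, `gv = g(ψ^n)` and
`gu = g(ψ^{n-1})`. -/
def nextStep (α ε a b τ : ℝ) {M : ℕ} (v u gv gu : Grid M) : Grid M :=
  synth a b M fun l =>
    coefC α τ * fourierTilde a b u l
      + coefD α a b τ l * fourierTilde a b v l
      + coefP α ε a b τ l * fourierTilde a b (cubicGrid v) l
      + coefQ α ε a b τ l * fourierTilde a b gv l
      - coefPStar α ε a b τ l * fourierTilde a b (cubicGrid u) l
      - coefQStar α ε a b τ l * fourierTilde a b gu l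

/-- The numerical approximations `ψ^n`, `n = 0, 1, 2, …`, with `g(ψ^0)` given by `gInit` and
`g(ψ^n)`, `n ≥ 1`, by `gDiff`. -/
def ewiFP (α ε a b τ : ℝ) (M : ℕ) (ψ₀ ψ₁ : ℝ → ℂ) : ℕ → Grid M
  | 0 => sample a b M ψ₀
  | 1 => firstStep α ε a b τ (sample a b M ψ₀) (sample a b M ψ₁)
  | 2 =>
    nextStep α ε a b τ (ewiFP α ε a b τ M ψ₀ ψ₁ 1) (ewiFP α ε a b τ M ψ₀ ψ₁ 0)
      (gDiff τ (ewiFP α ε a b τ M ψ₀ ψ₁ 1) (ewiFP α ε a b τ M ψ₀ ψ₁ 0))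
      (gInit (sample a b M ψ₀) (sample a b M ψ₁))
  | n + 3 =>
    nextStep α ε a b τ (ewiFP α ε a b τ M ψ₀ ψ₁ (n + 2)) (ewiFP α ε a b τ M ψ₀ ψ₁ (n + 1))
      (gDiff τ (ewiFP α ε a b τ M ψ₀ ψ₁ (n + 2)) (ewiFP α ε a b τ M ψ₀ ψ₁ (n + 1)))
      (gDiff τ (ewiFP α ε a b τ M ψ₀ ψ₁ (n + 1)) (ewiFP α ε a b τ M ψ₀ ψ₁ n))

end NLSW

end

/-! In each Fourier mode the equation factors as `(d/dt - iβ⁺)(d/dt - iβ⁻) û = -(ε²/α) f̂`, so `û =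
y⁺ + y⁻`, where `y±' = iβ± y± ± κ f̂` and `κ = iε²/(αβ_l)`. Two facts drive the analysis: the
propagators `e^{iβ±τ}` have modulus one, and `|κ| (1 + μ_l²)^{1/2} ≤ ε²/α`, so the source term gains
one derivative.

The two-step scheme is what remains after eliminating `y⁺` and `y⁻` separately from a one-step
method: variation of constants with the nonlinearity replaced by its linear extrapolation
(`fourierTilde_ewiFP`). Hence no stability analysis of a two-step recurrence is needed. The `H¹`
size of the error in both components (`errNorm`) grows in one step by at most `(2ε²/α) τ` times the
`L²` norm of the defect of the nonlinearity (`errNorm_succ_le`). Thanks to the gained derivative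
only `L²` bounds for the defect are required, and there pointwise Lipschitz bounds of the cubic term
suffice.

The defect is `O(τ²)` from extrapolation, plus `O(h^{m-1})` from aliasing, plus a multiple of the
errors already made (`l2_defect_succ_le`). In the first step it is only `O(τ + h^{m-1})`, which is
harmless since it occurs once and is multiplied by `ε²τ`. There are at most `T/(ε^β τ)` steps, so
`ε² · nτ ≤ T ε^{2-β}`: the Gronwall factor stays bounded, and the accumulated time error is `ε^{2-β}
τ²`. The Lipschitz bounds need a maximum bound on the numerical solution. It is carried along in the
induction, because `H¹` embeds in the bounded functions and the error bound itself is small for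
small `h` and `τ`.

Two spatial estimates need an idea. The high frequencies of `f(ψ)` are controlled by comparing `ψ`
with its truncation `v` to frequencies below `M/6`: `f(v)` is still resolved by the grid, so the
tail of `f(ψ)` is the tail of `f(ψ) - f(v)` (`sob_cubic_tail_le`). The aliasing error of `ψ₁`
requires decay of its Fourier tail beyond the `H¹` bound. That decay follows from the `H^m` bound on
`ψ` at all times in `[0, T]`: a large high-frequency component `y⁺(0)` would make `û_l(t)` oscillate
visibly, and averaging `|e^{iβ⁺t} - e^{iβ⁻t}|²` over time recovers it
(`exists_sob_velocity_tail_le`). -/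

open scoped ENNReal

noncomputable section

namespace NLSW

/-! ### `ℓ²` norms over finite sets of frequencies -/

/-- The `ℓ²` norm of the restriction of `v` to a finite set of indices. -/
def l2 (s : Finset ℤ) (v : ℤ → ℂ) : ℝ := Real.sqrt (∑ l ∈ s, ‖v l‖ ^ 2)

theorem l2_nonneg (s : Finset ℤ) (v : ℤ → ℂ) : 0 ≤ l2 s v := Real.sqrt_nonneg _

theorem l2_sq (s : Finset ℤ) (v : ℤ → ℂ) : l2 s v ^ 2 = ∑ l ∈ s, ‖v l‖ ^ 2 :=
  Real.sq_sqrt (Finset.sum_nonneg fun _ _ => sq_nonneg _)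

theorem l2_le_iff {s : Finset ℤ} {v : ℤ → ℂ} {B : ℝ} (hB : 0 ≤ B) :
    l2 s v ≤ B ↔ ∑ l ∈ s, ‖v l‖ ^ 2 ≤ B ^ 2 := Real.sqrt_le_left hB

theorem l2_eq_norm (s : Finset ℤ) (v : ℤ → ℂ) :
    l2 s v = ‖(WithLp.toLp 2 (fun l : s => v l) : EuclideanSpace ℂ s)‖ := by
  rw [EuclideanSpace.norm_eq, l2]
  congr 1
  exact (Finset.sum_coe_sort s (fun l => ‖v l‖ ^ 2)).symm

theorem l2_add_le (s : Finset ℤ) (v w : ℤ → ℂ) :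
    l2 s (fun l => v l + w l) ≤ l2 s v + l2 s w := by
  rw [l2_eq_norm, l2_eq_norm, l2_eq_norm]
  exact norm_add_le (WithLp.toLp 2 (fun l : s => v l) : EuclideanSpace ℂ s)
    (WithLp.toLp 2 (fun l : s => w l))

theorem l2_sub_le (s : Finset ℤ) (v w : ℤ → ℂ) :
    l2 s (fun l => v l - w l) ≤ l2 s v + l2 s w := by
  rw [l2_eq_norm, l2_eq_norm, l2_eq_norm]
  exact norm_sub_le (WithLp.toLp 2 (fun l : s => v l) : EuclideanSpace ℂ s)
    (WithLp.toLp 2 (fun l : s => w l))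

theorem l2_le_mul {s : Finset ℤ} {v w : ℤ → ℂ} {c : ℝ} (hc : 0 ≤ c)
    (h : ∀ l ∈ s, ‖v l‖ ≤ c * ‖w l‖) : l2 s v ≤ c * l2 s w := by
  rw [l2_le_iff (mul_nonneg hc (l2_nonneg _ _)), mul_pow, l2_sq, Finset.mul_sum]
  refine Finset.sum_le_sum fun l hl => ?_
  rw [← mul_pow]
  exact pow_le_pow_left₀ (norm_nonneg _) (h l hl) 2

theorem l2_mono {s : Finset ℤ} {v w : ℤ → ℂ} (h : ∀ l ∈ s, ‖v l‖ ≤ ‖w l‖) :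
    l2 s v ≤ l2 s w := by
  simpa using l2_le_mul zero_le_one (fun l hl => by simpa using h l hl)

theorem l2_congr {s : Finset ℤ} {v w : ℤ → ℂ} (h : ∀ l ∈ s, ‖v l‖ = ‖w l‖) :
    l2 s v = l2 s w :=
  le_antisymm (l2_mono fun l hl => (h l hl).le) (l2_mono fun l hl => (h l hl).ge)

theorem l2_subset {s t : Finset ℤ} (h : s ⊆ t) (v : ℤ → ℂ) : l2 s v ≤ l2 t v :=
  Real.sqrt_le_sqrt (Finset.sum_le_sum_of_subset_of_nonneg h fun _ _ _ => sq_nonneg _)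

theorem l2_const_mul (s : Finset ℤ) (c : ℂ) (v : ℤ → ℂ) :
    l2 s (fun l => c * v l) = ‖c‖ * l2 s v := by
  simp only [l2, norm_mul, mul_pow, ← Finset.mul_sum]
  rw [Real.sqrt_mul (sq_nonneg _), Real.sqrt_sq (norm_nonneg _)]

/-- Minkowski's integral inequality: the integrand is read as one curve in a Euclidean space, where
the norm of an integral is at most the length of the interval times a bound for the norm. -/
theorem l2_intervalIntegral_le (s : Finset ℤ) {V : ℝ → ℤ → ℂ} {p q ρ : ℝ} (hpq : p ≤ q)
    (hV : ∀ l ∈ s, IntervalIntegrable (fun t => V t l) MeasureTheory.volume p q)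
    (hρ : ∀ t ∈ Set.Icc p q, l2 s (V t) ≤ ρ) :
    l2 s (fun l => ∫ t in p..q, V t l) ≤ (q - p) * ρ := by
  let W : ℝ → EuclideanSpace ℂ s := fun t => WithLp.toLp 2 (fun l : s => V t l)
  have hW : IntervalIntegrable W MeasureTheory.volume p q := by
    have h1 : IntervalIntegrable
        (∑ l : s, fun t => (EuclideanSpace.single l (V t l) : EuclideanSpace ℂ s))
        MeasureTheory.volume p q := by
      refine IntervalIntegrable.sum (Finset.univ : Finset s)
        (f := fun l t => (EuclideanSpace.single l (V t l) : EuclideanSpace ℂ s)) fun l _ => ?_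
      have h2 : (fun t => (EuclideanSpace.single l (V t l) : EuclideanSpace ℂ s))
          = fun t => V t l • (EuclideanSpace.single l (1 : ℂ) : EuclideanSpace ℂ s) := by
        funext t
        ext k
        simp
      simp only [h2]
      exact ⟨(hV l l.2).1.smul_const _, (hV l l.2).2.smul_const _⟩
    convert h1 using 2 with t
    ext k
    simp [W, Pi.single_apply]
  have hcoord : ∀ l : s, (∫ t in p..q, W t) l = ∫ t in p..q, V t l := by
    intro l
    have := (EuclideanSpace.proj l : EuclideanSpace ℂ s →L[ℂ] ℂ).intervalIntegral_comp_comm hW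
    simpa [W] using this.symm
  have h3 : l2 s (fun l => ∫ t in p..q, V t l) = ‖∫ t in p..q, W t‖ := by
    rw [l2_eq_norm]
    congr 1
    ext l
    exact (hcoord l).symm
  rw [h3]
  have h4 := intervalIntegral.norm_integral_le_of_norm_le_const (a := p) (b := q) (C := ρ) (f := W)
    (fun t ht => by
      rw [Set.uIoc_of_le hpq] at ht
      have := hρ t ⟨ht.1.le, ht.2⟩
      rwa [l2_eq_norm] at this)
  rw [abs_of_nonneg (sub_nonneg.2 hpq)] at h4
  linarith

/-! ### Exponentials -/

section modes
variable {a b : ℝ}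

theorem freq_add (l p : ℤ) : freq a b (l + p) = freq a b l + freq a b p := by
  simp only [freq]; push_cast; ring

theorem freq_neg (l : ℤ) : freq a b (-l) = -freq a b l := by
  simp only [freq]; push_cast; ring

theorem modeConj_eq (l : ℤ) (x : ℝ) : modeConj a b l x = mode a b (-l) x := by
  simp only [modeConj, mode, freq_neg]; push_cast; ring_nf

theorem mode_zero (x : ℝ) : mode a b 0 x = 1 := by simp [mode, freq]

theorem mode_add (l p : ℤ) (x : ℝ) : mode a b (l + p) x = mode a b l x * mode a b p x := by
  simp only [mode, freq_add, ← Complex.exp_add]; push_cast; ring_nf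

theorem mode_eq_exp (l : ℤ) (x : ℝ) :
    mode a b l x = Complex.exp ((freq a b l * (x - a) : ℝ) * Complex.I) := by
  simp only [mode]; push_cast; ring_nf

theorem norm_mode (l : ℤ) (x : ℝ) : ‖mode a b l x‖ = 1 := by
  rw [mode_eq_exp, Complex.norm_exp_ofReal_mul_I]

theorem conj_mode (l : ℤ) (x : ℝ) : (starRingEnd ℂ) (mode a b l x) = mode a b (-l) x := by
  rw [mode_eq_exp, mode_eq_exp, ← Complex.exp_conj, freq_neg]
  simp

theorem norm_modeConj (l : ℤ) (x : ℝ) : ‖modeConj a b l x‖ = 1 := by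
  rw [modeConj_eq, norm_mode]

theorem hasDerivAt_mode (l : ℤ) (x : ℝ) :
    HasDerivAt (mode a b l) (Complex.I * freq a b l * mode a b l x) x := by
  have h1 : HasDerivAt (fun x : ℝ => Complex.I * (freq a b l : ℂ) * ((x : ℂ) - (a : ℂ)))
      (Complex.I * freq a b l) x := by
    simpa using ((Complex.ofRealCLM.hasDerivAt (x := x)).sub_const (a : ℂ)).const_mul
      (Complex.I * (freq a b l : ℂ))
  have h2 := h1.cexp
  rwa [mul_comm (Complex.exp _)] at h2

@[fun_prop]
theorem continuous_mode (l : ℤ) : Continuous (mode a b l) := by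
  unfold mode; fun_prop

@[fun_prop]
theorem continuous_modeConj (l : ℤ) : Continuous (modeConj a b l) := by
  unfold modeConj; fun_prop

theorem mode_periodic (hab : a < b) (l : ℤ) : Function.Periodic (mode a b l) (b - a) := by
  intro x
  have h : (b : ℂ) - a ≠ 0 := by exact_mod_cast (sub_pos.2 hab).ne'
  have h1 : Complex.I * (freq a b l : ℂ) * (((x + (b - a) : ℝ) : ℂ) - (a : ℂ))
      = Complex.I * (freq a b l : ℂ) * ((x : ℂ) - (a : ℂ)) + l * (2 * Real.pi * Complex.I) := by
    simp only [freq]; push_cast; field_simp; ring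
  rw [mode, h1, Complex.exp_add, Complex.exp_int_mul_two_pi_mul_I, mul_one, mode]

/-! ### Fourier coefficients -/

theorem intervalIntegrable_mul_modeConj {u : ℝ → ℂ} (hu : Continuous u) (l : ℤ) (p q : ℝ) :
    IntervalIntegrable (fun x => u x * modeConj a b l x) MeasureTheory.volume p q :=
  (hu.mul (continuous_modeConj l)).intervalIntegrable _ _

theorem fourierHat_add {u v : ℝ → ℂ} (hu : Continuous u) (hv : Continuous v) (l : ℤ) :
    fourierHat a b (fun x => u x + v x) l = fourierHat a b u l + fourierHat a b v l := by
  simp only [fourierHat, add_mul]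
  rw [intervalIntegral.integral_add (intervalIntegrable_mul_modeConj hu l _ _)
    (intervalIntegrable_mul_modeConj hv l _ _), mul_add]

theorem fourierHat_sub {u v : ℝ → ℂ} (hu : Continuous u) (hv : Continuous v) (l : ℤ) :
    fourierHat a b (fun x => u x - v x) l = fourierHat a b u l - fourierHat a b v l := by
  simp only [fourierHat, sub_mul]
  rw [intervalIntegral.integral_sub (intervalIntegrable_mul_modeConj hu l _ _)
    (intervalIntegrable_mul_modeConj hv l _ _), mul_sub]

theorem fourierHat_const_mul (c : ℂ) (u : ℝ → ℂ) (l : ℤ) :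
    fourierHat a b (fun x => c * u x) l = c * fourierHat a b u l := by
  simp only [fourierHat, mul_assoc]
  rw [intervalIntegral.integral_const_mul]
  ring

theorem fourierHat_finset_sum {ι : Type*} (s : Finset ι) {u : ι → ℝ → ℂ}
    (hu : ∀ i ∈ s, Continuous (u i)) (l : ℤ) :
    fourierHat a b (fun x => ∑ i ∈ s, u i x) l = ∑ i ∈ s, fourierHat a b (u i) l := by
  simp only [fourierHat, Finset.sum_mul]
  rw [intervalIntegral.integral_finsetSum, Finset.mul_sum]
  exact fun i hi => ((hu i hi).mul (continuous_modeConj l)).intervalIntegrable _ _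

theorem fourierHat_mode_mul (p : ℤ) (u : ℝ → ℂ) (l : ℤ) :
    fourierHat a b (fun x => mode a b p x * u x) l = fourierHat a b u (l - p) := by
  simp only [fourierHat, modeConj_eq]
  congr 2
  funext x
  rw [show -(l - p) = p + -l by ring, mode_add]
  ring

/-- The exponentials here are centred at `a`, those of `fourierCoeffOn` at `0`. The difference is
the phase `e^{iμ_l a}`, which is `mode a b l` evaluated at `2a`. -/
theorem fourierHat_eq_fourierCoeffOn (hab : a < b) (u : ℝ → ℂ) (l : ℤ) :
    fourierHat a b u l = mode a b l (2 * a) * fourierCoeffOn hab u l := by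
  rw [fourierCoeffOn_eq_integral, fourierHat]
  have : ∀ x : ℝ, u x * modeConj a b l x
      = mode a b l (2 * a) * ((fourier (-l) (x : AddCircle (b - a)) : ℂ) • u x) := by
    intro x
    rw [fourier_coe_apply, modeConj, mode, smul_eq_mul, ← mul_assoc, ← Complex.exp_add, mul_comm]
    congr 2
    simp only [freq]; push_cast; ring
  simp only [this]
  rw [intervalIntegral.integral_const_mul]
  simp only [Complex.real_smul]
  push_cast
  ring

theorem norm_fourierHat (hab : a < b) (u : ℝ → ℂ) (l : ℤ) :
    ‖fourierHat a b u l‖ = ‖fourierCoeffOn hab u l‖ := by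
  rw [fourierHat_eq_fourierCoeffOn hab, norm_mul, norm_mode, one_mul]

/-- Parseval's identity. -/
theorem hasSum_sq_fourierHat (hab : a < b) {u : ℝ → ℂ} (hu : Continuous u) :
    HasSum (fun l => ‖fourierHat a b u l‖ ^ 2) ((b - a)⁻¹ * ∫ x in a..b, ‖u x‖ ^ 2) := by
  simp only [norm_fourierHat hab]
  have h : MeasureTheory.MemLp u 2 (MeasureTheory.volume.restrict (Set.Ioc a b)) := by
    obtain ⟨B, hB⟩ := isCompact_Icc.exists_bound_of_continuousOn (s := Set.Icc a b) hu.continuousOn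
    refine MeasureTheory.MemLp.of_bound hu.aestronglyMeasurable B ?_
    filter_upwards [MeasureTheory.ae_restrict_mem measurableSet_Ioc] with x hx
    exact hB x ⟨hx.1.le, hx.2⟩
  simpa using hasSum_sq_fourierCoeffOn hab h

/-- Integration by parts. -/
theorem fourierHat_deriv (hab : a < b) {u u' : ℝ → ℂ} (hu : ∀ x, HasDerivAt u (u' x) x)
    (hu' : Continuous u') (hp : Function.Periodic u (b - a)) (l : ℤ) :
    fourierHat a b u' l = Complex.I * freq a b l * fourierHat a b u l := by
  have h1 : ∀ x, HasDerivAt (modeConj a b l) (-(Complex.I * freq a b l) * modeConj a b l x) x := by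
    intro x
    have h := hasDerivAt_mode (a := a) (b := b) (-l) x
    rw [show modeConj a b l = mode a b (-l) from funext (modeConj_eq l)]
    convert h using 1
    rw [freq_neg]; push_cast; ring
  have h2 := intervalIntegral.integral_deriv_mul_eq_sub (a := a) (b := b)
    (fun x _ => hu x) (fun x _ => h1 x) (hu'.intervalIntegrable _ _)
    ((continuous_const.mul (continuous_modeConj l)).intervalIntegrable _ _)
  have h3 : u b * modeConj a b l b - u a * modeConj a b l a = 0 := by
    have e1 : u b = u a := by have := hp a; rwa [add_sub_cancel] at this
    have e2 : modeConj a b l b = modeConj a b l a := by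
      have := mode_periodic hab (-l) a
      rw [add_sub_cancel] at this
      rw [modeConj_eq, modeConj_eq, this]
    rw [e1, e2, sub_self]
  have hcu : Continuous u := continuous_iff_continuousAt.2 fun x => (hu x).continuousAt
  rw [h3, intervalIntegral.integral_add (intervalIntegrable_mul_modeConj hu' l _ _)
    ((show Continuous fun x => u x * (-(Complex.I * freq a b l) * modeConj a b l x) by
      fun_prop).intervalIntegrable _ _)] at h2
  have h4 : (∫ x in a..b, u x * (-(Complex.I * freq a b l) * modeConj a b l x))
      = -(Complex.I * freq a b l) * ∫ x in a..b, u x * modeConj a b l x := by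
    rw [← intervalIntegral.integral_const_mul]
    congr 1; funext x; ring
  rw [h4] at h2
  simp only [fourierHat]
  linear_combination (1 / ((b : ℂ) - a)) * h2

theorem fourierHat_one (hab : a < b) (l : ℤ) :
    fourierHat a b (fun _ => 1) l = if l = 0 then 1 else 0 := by
  split_ifs with h
  · subst h
    have : (b : ℂ) - a ≠ 0 := by exact_mod_cast (sub_pos.2 hab).ne'
    simp [fourierHat, modeConj_eq, mode_zero, this]
  · have h1 := fourierHat_deriv hab (u := fun _ => (1 : ℂ)) (u' := fun _ => 0)
      (fun x => hasDerivAt_const x _) continuous_const (fun _ => rfl) l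
    have h2 : (freq a b l : ℂ) ≠ 0 := by
      have : b - a ≠ 0 := (sub_pos.2 hab).ne'
      have h' : (l : ℝ) ≠ 0 := by exact_mod_cast h
      have : freq a b l ≠ 0 := by
        simp only [freq]; positivity
      exact_mod_cast this
    have h3 : fourierHat a b (fun _ => (0 : ℂ)) l = 0 := by simp [fourierHat]
    rw [h3] at h1
    simpa [h2] using h1.symm

theorem fourierHat_mode (hab : a < b) (p l : ℤ) :
    fourierHat a b (mode a b p) l = if l = p then 1 else 0 := by
  have := fourierHat_mode_mul (a := a) (b := b) p (fun _ => 1) l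
  simp only [mul_one] at this
  rw [show (fun x => mode a b p x) = mode a b p from rfl] at this
  rw [this, fourierHat_one hab]
  simp [sub_eq_zero]

theorem fourierHat_trig (hab : a < b) (s : Finset ℤ) (c : ℤ → ℂ) (l : ℤ) :
    fourierHat a b (fun x => ∑ p ∈ s, c p * mode a b p x) l = if l ∈ s then c l else 0 := by
  rw [fourierHat_finset_sum s (u := fun p x => c p * mode a b p x) (fun p _ => by fun_prop)]
  simp [fourierHat_const_mul, fourierHat_mode hab]

/-! ### Sobolev norms -/

/-- The weight `(1 + μ_l²)^{1/2}`. -/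
def wt (a b : ℝ) (l : ℤ) : ℝ := Real.sqrt (1 + freq a b l ^ 2)

theorem wt_sq (l : ℤ) : wt a b l ^ 2 = 1 + freq a b l ^ 2 := Real.sq_sqrt (by positivity)

theorem one_le_wt (l : ℤ) : 1 ≤ wt a b l := by
  rw [wt, Real.one_le_sqrt]; nlinarith [sq_nonneg (freq a b l)]

theorem wt_pos (l : ℤ) : 0 < wt a b l := zero_lt_one.trans_le (one_le_wt l)

theorem abs_freq_le_wt (l : ℤ) : |freq a b l| ≤ wt a b l := by
  rw [wt, ← Real.sqrt_sq_eq_abs]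
  exact Real.sqrt_le_sqrt (by linarith)

/-- The `H^k` norm of the part of a Fourier series with frequencies in a finite set. -/
def sob (a b : ℝ) (k : ℕ) (s : Finset ℤ) (v : ℤ → ℂ) : ℝ :=
  l2 s (fun l => (wt a b l : ℂ) ^ k * v l)

theorem sob_zero (s : Finset ℤ) (v : ℤ → ℂ) : sob a b 0 s v = l2 s v := by simp [sob]

theorem norm_wt_pow_mul (k : ℕ) (l : ℤ) (z : ℂ) :
    ‖(wt a b l : ℂ) ^ k * z‖ = wt a b l ^ k * ‖z‖ := by
  rw [norm_mul, norm_pow, Complex.norm_real, Real.norm_of_nonneg (wt_pos l).le]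

theorem sob_sq (k : ℕ) (s : Finset ℤ) (v : ℤ → ℂ) :
    sob a b k s v ^ 2 = ∑ l ∈ s, (1 + freq a b l ^ 2) ^ k * ‖v l‖ ^ 2 := by
  rw [sob, l2_sq]
  refine Finset.sum_congr rfl fun l _ => ?_
  rw [norm_wt_pow_mul, ← wt_sq]; ring

theorem sob_nonneg (k : ℕ) (s : Finset ℤ) (v : ℤ → ℂ) : 0 ≤ sob a b k s v := l2_nonneg _ _

theorem sob_le_iff {k : ℕ} {s : Finset ℤ} {v : ℤ → ℂ} {B : ℝ} (hB : 0 ≤ B) :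
    sob a b k s v ≤ B ↔ ∑ l ∈ s, (1 + freq a b l ^ 2) ^ k * ‖v l‖ ^ 2 ≤ B ^ 2 := by
  rw [← sob_sq, sq_le_sq₀ (sob_nonneg _ _ _) hB]

theorem l2_le_sob (k : ℕ) (s : Finset ℤ) (v : ℤ → ℂ) : l2 s v ≤ sob a b k s v :=
  l2_mono fun l _ => by
    rw [norm_wt_pow_mul]
    exact le_mul_of_one_le_left (norm_nonneg _) (one_le_pow₀ (one_le_wt l))

theorem sob_mono {k k' : ℕ} (h : k ≤ k') (s : Finset ℤ) (v : ℤ → ℂ) :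
    sob a b k s v ≤ sob a b k' s v :=
  l2_mono fun l _ => by
    rw [norm_wt_pow_mul, norm_wt_pow_mul]
    exact mul_le_mul_of_nonneg_right (pow_le_pow_right₀ (one_le_wt l) h) (norm_nonneg _)

/-- A series of nonnegative terms is the supremum of its finite partial sums. This lets all later
estimates run over finite frequency sets, without convergence questions. -/
theorem sobolevNorm_le_iff {k : ℕ} {u : ℝ → ℂ} {B : ℝ} (hB : 0 ≤ B) :
    sobolevNorm a b k u ≤ ENNReal.ofReal B ↔ ∀ s, sob a b k s (fourierHat a b u) ≤ B := by
  have h1 : sobolevNorm a b k u ≤ ENNReal.ofReal B ↔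
      ∑' l : ℤ, ENNReal.ofReal ((1 + freq a b l ^ 2) ^ k * ‖fourierHat a b u l‖ ^ 2)
        ≤ ENNReal.ofReal (B ^ 2) := by
    rw [sobolevNorm, ENNReal.ofReal_pow hB, ← ENNReal.rpow_natCast, one_div,
      ENNReal.rpow_inv_le_iff (by norm_num)]
    norm_num
  have hnn : ∀ l : ℤ, 0 ≤ (1 + freq a b l ^ 2) ^ k * ‖fourierHat a b u l‖ ^ 2 :=
    fun l => by positivity
  rw [h1, ENNReal.tsum_eq_iSup_sum, iSup_le_iff]
  refine forall_congr' fun s => ?_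
  rw [sob_le_iff hB, ← ENNReal.ofReal_sum_of_nonneg (fun l _ => hnn l),
    ENNReal.ofReal_le_ofReal_iff (sq_nonneg B)]

end modes

/-! ### Fourier inversion, the embedding of `H¹` in the bounded functions, and passing from
pointwise to `L²` bounds. -/

section inversion
variable {a b : ℝ}

theorem sum_mul_norm_le (s : Finset ℤ) (w : ℤ → ℝ) (v : ℤ → ℂ) :
    ∑ l ∈ s, w l * ‖v l‖ ≤ Real.sqrt (∑ l ∈ s, w l ^ 2) * l2 s v :=
  Real.sum_mul_le_sqrt_mul_sqrt s w fun l => ‖v l‖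

theorem summable_one_div_wt_sq (hab : a < b) :
    Summable fun l : ℤ => (1 / wt a b l) ^ 2 := by
  have h0 : 0 < b - a := sub_pos.2 hab
  have h1 : Summable fun l : ℤ => ((b - a) / (2 * Real.pi)) ^ 2 * (1 / (l : ℝ) ^ 2) :=
    (Real.summable_one_div_int_pow.2 one_lt_two).mul_left _
  refine h1.of_norm_bounded_eventually ?_
  filter_upwards [(Set.finite_singleton (0 : ℤ)).compl_mem_cofinite] with l hl
  replace hl : l ≠ 0 := hl
  have hl' : (l : ℝ) ^ 2 > 0 := by
    have : (l : ℝ) ≠ 0 := by exact_mod_cast hl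
    positivity
  rw [Real.norm_of_nonneg (by positivity), div_pow, one_pow, wt_sq]
  have h3 : ((b - a) / (2 * Real.pi)) ^ 2 * (1 / (l : ℝ) ^ 2) = 1 / freq a b l ^ 2 := by
    simp only [freq]
    have := Real.pi_pos
    field_simp
  rw [h3]
  have h4 : 0 < freq a b l ^ 2 := by
    simp only [freq]
    have := Real.pi_pos
    have : (l : ℝ) ≠ 0 := by exact_mod_cast hl
    positivity
  exact one_div_le_one_div_of_le h4 (by linarith)

/-- The constant of the embedding of `H¹` into the bounded functions. -/
def embC (a b : ℝ) : ℝ := Real.sqrt (∑' l : ℤ, (1 / wt a b l) ^ 2)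

theorem embC_nonneg : 0 ≤ embC a b := Real.sqrt_nonneg _

/-- Cauchy–Schwarz against the weights `1 / wt`, which are square summable in one space dimension.
-/
theorem sum_norm_le_embC (hab : a < b) (s : Finset ℤ) (v : ℤ → ℂ) :
    ∑ l ∈ s, ‖v l‖ ≤ embC a b * sob a b 1 s v := by
  have h1 := sum_mul_norm_le s (fun l => 1 / wt a b l) (fun l => (wt a b l : ℂ) ^ 1 * v l)
  have h2 : ∑ l ∈ s, ‖v l‖ = ∑ l ∈ s, 1 / wt a b l * ‖(wt a b l : ℂ) ^ 1 * v l‖ := by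
    refine Finset.sum_congr rfl fun l _ => ?_
    rw [norm_wt_pow_mul]
    have := wt_pos (a := a) (b := b) l
    field_simp
  rw [h2]
  refine h1.trans (mul_le_mul_of_nonneg_right (Real.sqrt_le_sqrt ?_) (l2_nonneg _ _))
  exact (summable_one_div_wt_sq hab).sum_le_tsum _ fun _ _ => sq_nonneg _

theorem summable_of_sob_le (hab : a < b) {v : ℤ → ℂ} {B : ℝ} (h : ∀ s, sob a b 1 s v ≤ B) :
    Summable fun l => ‖v l‖ :=
  summable_of_sum_le (fun _ => norm_nonneg _) fun s =>
    (sum_norm_le_embC hab s v).trans (mul_le_mul_of_nonneg_left (h s) embC_nonneg)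

/-- Fourier inversion. -/
theorem hasSum_mode (hab : a < b) {u : ℝ → ℂ} (hu : Continuous u)
    (hp : Function.Periodic u (b - a)) (hs : Summable fun l => ‖fourierHat a b u l‖) (x : ℝ) :
    HasSum (fun l => fourierHat a b u l * mode a b l x) (u x) := by
  have : Fact (0 < b - a) := ⟨sub_pos.2 hab⟩
  let g : C(AddCircle (b - a), ℂ) := ⟨hp.lift, by
    exact continuous_coinduced_dom.mpr hu⟩
  have hg : ∀ y : ℝ, g (y : AddCircle (b - a)) = u y := fun y => hp.lift_coe y
  have hc : ∀ l, fourierCoeff g l = fourierCoeffOn hab u l := by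
    intro l
    rw [fourierCoeff_eq_intervalIntegral _ l a, fourierCoeffOn_eq_integral]
    simp only [hg, add_sub_cancel]
  have hsum : Summable (fourierCoeff g) := by
    refine Summable.of_norm ?_
    simp only [hc, ← norm_fourierHat hab]
    exact hs
  have := has_pointwise_sum_fourier_series_of_summable hsum (x : AddCircle (b - a))
  rw [hg] at this
  convert this using 2 with l
  rw [hc, fourierHat_eq_fourierCoeffOn hab, fourier_coe_apply, smul_eq_mul, mul_right_comm, mul_comm]
  congr 1
  rw [mode, mode, ← Complex.exp_add]
  congr 1
  simp only [freq]; push_cast; ring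

/-- Under an `H¹` bound the Fourier series converges absolutely to the function, and the sum of the
moduli of its coefficients bounds it everywhere. -/
theorem norm_le_embC_mul (hab : a < b) {u : ℝ → ℂ} (hu : Continuous u)
    (hp : Function.Periodic u (b - a)) {B : ℝ} (h : ∀ s, sob a b 1 s (fourierHat a b u) ≤ B)
    (x : ℝ) : ‖u x‖ ≤ embC a b * B := by
  have hs := summable_of_sob_le hab h
  refine le_of_tendsto ((hasSum_mode hab hu hp hs x).norm) (Filter.Eventually.of_forall fun s => ?_)
  refine (norm_sum_le _ _).trans ?_
  simp only [norm_mul, norm_mode, mul_one]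
  exact (sum_norm_le_embC hab s _).trans (mul_le_mul_of_nonneg_left (h s) embC_nonneg)

theorem l2_fourierHat_sq_le (hab : a < b) {u : ℝ → ℂ} (hu : Continuous u) (s : Finset ℤ) :
    l2 s (fourierHat a b u) ^ 2 ≤ (b - a)⁻¹ * ∫ x in a..b, ‖u x‖ ^ 2 := by
  rw [l2_sq]
  exact sum_le_hasSum s (fun _ _ => sq_nonneg _) (hasSum_sq_fourierHat hab hu)

theorem integral_sq_le_of_l2_le (hab : a < b) {u : ℝ → ℂ} (hu : Continuous u) {B : ℝ}
    (h : ∀ s, l2 s (fourierHat a b u) ≤ B) :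
    (b - a)⁻¹ * ∫ x in a..b, ‖u x‖ ^ 2 ≤ B ^ 2 := by
  refine hasSum_le_of_sum_le (hasSum_sq_fourierHat hab hu) fun s => ?_
  rw [← l2_sq]
  exact pow_le_pow_left₀ (l2_nonneg _ _) (h s) 2

/-- Parseval is used in both directions to transfer a pointwise inequality to Fourier coefficients.
The factor 2 is a crude consequence of `(x + y)² ≤ 2x² + 2y²`. -/
theorem l2_fourierHat_le_of_norm_le (hab : a < b) {u v w : ℝ → ℂ} (hu : Continuous u)
    (hv : Continuous v) (hw : Continuous w) {p q B B' : ℝ} (hp : 0 ≤ p) (hq : 0 ≤ q)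
    (hle : ∀ x, ‖w x‖ ≤ p * ‖u x‖ + q * ‖v x‖)
    (hB : ∀ s, l2 s (fourierHat a b u) ≤ B) (hB' : ∀ s, l2 s (fourierHat a b v) ≤ B')
    (s : Finset ℤ) : l2 s (fourierHat a b w) ≤ 2 * (p * B + q * B') := by
  have hL : 0 < b - a := sub_pos.2 hab
  have b0 : 0 ≤ B := (l2_nonneg ∅ _).trans (hB ∅)
  have b0' : 0 ≤ B' := (l2_nonneg ∅ _).trans (hB' ∅)
  have h1 := integral_sq_le_of_l2_le hab hu hB
  have h2 := integral_sq_le_of_l2_le hab hv hB'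
  have h3 := l2_fourierHat_sq_le hab hw s
  have h4 : ∫ x in a..b, ‖w x‖ ^ 2
      ≤ ∫ x in a..b, (2 * p ^ 2 * ‖u x‖ ^ 2 + 2 * q ^ 2 * ‖v x‖ ^ 2) := by
    refine intervalIntegral.integral_mono_on hab.le (Continuous.intervalIntegrable (by fun_prop) _ _)
      (Continuous.intervalIntegrable (by fun_prop) _ _) fun x _ => ?_
    have := pow_le_pow_left₀ (norm_nonneg _) (hle x) 2
    nlinarith [sq_nonneg (p * ‖u x‖ - q * ‖v x‖)]
  rw [intervalIntegral.integral_add (Continuous.intervalIntegrable (by fun_prop) _ _)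
    (Continuous.intervalIntegrable (by fun_prop) _ _), intervalIntegral.integral_const_mul,
    intervalIntegral.integral_const_mul] at h4
  have h5 : l2 s (fourierHat a b w) ^ 2 ≤ 2 * p ^ 2 * B ^ 2 + 2 * q ^ 2 * B' ^ 2 := by
    refine h3.trans ((mul_le_mul_of_nonneg_left h4 (by positivity)).trans ?_)
    have := mul_le_mul_of_nonneg_left h1 (show 0 ≤ 2 * p ^ 2 by positivity)
    have := mul_le_mul_of_nonneg_left h2 (show 0 ≤ 2 * q ^ 2 by positivity)
    linarith
  refine abs_le_of_sq_le_sq' (h5.trans ?_) (by positivity) |>.2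
  nlinarith [mul_nonneg (mul_nonneg hp b0) (mul_nonneg hq b0'), sq_nonneg (p * B), sq_nonneg (q * B')]

theorem l2_fourierHat_le_of_bound (hab : a < b) {u : ℝ → ℂ} (hu : Continuous u) {B : ℝ}
    (hB : 0 ≤ B) (h : ∀ x, ‖u x‖ ≤ B) (s : Finset ℤ) : l2 s (fourierHat a b u) ≤ B := by
  have hL : 0 < b - a := sub_pos.2 hab
  have h3 := l2_fourierHat_sq_le hab hu s
  have h4 : ∫ x in a..b, ‖u x‖ ^ 2 ≤ ∫ x in a..b, B ^ 2 :=
    intervalIntegral.integral_mono_on hab.le (Continuous.intervalIntegrable (by fun_prop) _ _)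
      (Continuous.intervalIntegrable (by fun_prop) _ _)
      fun x _ => pow_le_pow_left₀ (norm_nonneg _) (h x) 2
  rw [intervalIntegral.integral_const, smul_eq_mul] at h4
  refine abs_le_of_sq_le_sq' (h3.trans ?_) hB |>.2
  calc (b - a)⁻¹ * ∫ x in a..b, ‖u x‖ ^ 2 ≤ (b - a)⁻¹ * ((b - a) * B ^ 2) :=
        mul_le_mul_of_nonneg_left h4 (by positivity)
    _ = B ^ 2 := by field_simp

/-- The `H¹` norm in terms of the function and its derivative. -/
theorem sob_one_le_of_deriv (hab : a < b) {u u' : ℝ → ℂ} (hu : ∀ x, HasDerivAt u (u' x) x)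
    (hu' : Continuous u') (hp : Function.Periodic u (b - a)) {B B' : ℝ}
    (hB : ∀ s, l2 s (fourierHat a b u) ≤ B) (hB' : ∀ s, l2 s (fourierHat a b u') ≤ B')
    (s : Finset ℤ) : sob a b 1 s (fourierHat a b u) ≤ B + B' := by
  have b0 : 0 ≤ B := (l2_nonneg ∅ _).trans (hB ∅)
  have b0' : 0 ≤ B' := (l2_nonneg ∅ _).trans (hB' ∅)
  rw [sob_le_iff (by positivity)]
  have h1 := pow_le_pow_left₀ (l2_nonneg _ _) (hB s) 2
  have h2 := pow_le_pow_left₀ (l2_nonneg _ _) (hB' s) 2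
  rw [l2_sq] at h1 h2
  have h3 : ∑ l ∈ s, (1 + freq a b l ^ 2) ^ 1 * ‖fourierHat a b u l‖ ^ 2
      = ∑ l ∈ s, ‖fourierHat a b u l‖ ^ 2 + ∑ l ∈ s, ‖fourierHat a b u' l‖ ^ 2 := by
    rw [← Finset.sum_add_distrib]
    refine Finset.sum_congr rfl fun l _ => ?_
    rw [fourierHat_deriv hab hu hu' hp]
    simp only [norm_mul, Complex.norm_I, Complex.norm_real, Real.norm_eq_abs, mul_pow, sq_abs]
    ring
  rw [h3]
  nlinarith

theorem l2_fourierHat_deriv_le (hab : a < b) {u u' : ℝ → ℂ} (hu : ∀ x, HasDerivAt u (u' x) x)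
    (hu' : Continuous u') (hp : Function.Periodic u (b - a)) (s : Finset ℤ) :
    l2 s (fourierHat a b u') ≤ sob a b 1 s (fourierHat a b u) := by
  refine l2_mono fun l _ => ?_
  rw [fourierHat_deriv hab hu hu' hp, norm_wt_pow_mul, norm_mul, norm_mul, Complex.norm_I, one_mul,
    Complex.norm_real, Real.norm_eq_abs, pow_one]
  exact mul_le_mul_of_nonneg_right (abs_freq_le_wt l) (norm_nonneg _)

end inversion

/-! ### Discrete Fourier transform on the grid: orthogonality, inversion and Parseval. -/

section discrete
variable {a b : ℝ} {M : ℕ}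

theorem mode_gridPoint (hab : a < b) (hM : 0 < M) (l : ℤ) (j : ℕ) :
    mode a b l (gridPoint a b M j) = Complex.exp (2 * Real.pi * Complex.I * (l * j / M)) := by
  have h : (b : ℂ) - a ≠ 0 := by exact_mod_cast (sub_pos.2 hab).ne'
  have hM' : (M : ℂ) ≠ 0 := by exact_mod_cast hM.ne'
  rw [mode]
  congr 1
  simp only [freq, gridPoint, meshSize]
  push_cast
  field_simp
  ring

theorem sum_mode_gridPoint (hab : a < b) (hM : 0 < M) (k : ℤ) :
    ∑ j : Fin M, mode a b k (gridPoint a b M j) = if (M : ℤ) ∣ k then (M : ℂ) else 0 := by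
  have hM' : (M : ℂ) ≠ 0 := by exact_mod_cast hM.ne'
  set z : ℂ := Complex.exp (2 * Real.pi * Complex.I * (k / M)) with hz
  have h1 : ∀ j : ℕ, mode a b k (gridPoint a b M j) = z ^ j := by
    intro j
    rw [mode_gridPoint hab hM, hz, ← Complex.exp_nat_mul]
    congr 1; ring
  have h2 : ∑ j : Fin M, mode a b k (gridPoint a b M j) = ∑ j ∈ Finset.range M, z ^ j := by
    rw [Fin.sum_univ_eq_sum_range (fun j => mode a b k (gridPoint a b M j)) M]
    exact Finset.sum_congr rfl fun j _ => h1 j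
  rw [h2]
  split_ifs with hk
  · obtain ⟨r, rfl⟩ := hk
    have : z = 1 := by
      rw [hz, Complex.exp_eq_one_iff]
      exact ⟨r, by push_cast; field_simp⟩
    simp [this]
  · have hz1 : z ≠ 1 := by
      intro h
      rw [hz, Complex.exp_eq_one_iff] at h
      obtain ⟨r, hr⟩ := h
      have hpi : (2 * Real.pi * Complex.I : ℂ) ≠ 0 := Complex.two_pi_I_ne_zero
      have h3 : (k : ℂ) / M = r := mul_left_cancel₀ hpi (by rw [hr]; ring)
      rw [div_eq_iff hM'] at h3
      exact hk ⟨r, by rw [mul_comm]; exact_mod_cast h3⟩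
    have hzM : z ^ M = 1 := by
      rw [hz, ← Complex.exp_nat_mul, Complex.exp_eq_one_iff]
      exact ⟨k, by field_simp⟩
    rw [geom_sum_eq hz1, hzM, sub_self, zero_div]

theorem mem_modes_iff (he : Even M) {l : ℤ} : l ∈ modes M ↔ -(M : ℤ) ≤ 2 * l ∧ 2 * l < M := by
  obtain ⟨r, rfl⟩ := he
  simp only [modes, Finset.mem_Ico]
  omega

theorem eq_of_dvd_sub_of_mem_modes (he : Even M) {l p : ℤ} (hl : l ∈ modes M) (hp : p ∈ modes M)
    (h : (M : ℤ) ∣ p - l) : p = l := by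
  rw [mem_modes_iff he] at hl hp
  have : |p - l| < M := by rw [abs_lt]; constructor <;> linarith
  linarith [Int.eq_zero_of_abs_lt_dvd h this]

theorem fourierTilde_synth (hab : a < b) (hM : 0 < M) (he : Even M) (c : ℤ → ℂ) {l : ℤ}
    (hl : l ∈ modes M) : fourierTilde a b (synth a b M c) l = c l := by
  have hM' : (M : ℂ) ≠ 0 := by exact_mod_cast hM.ne'
  have h1 : ∑ j : Fin M, (synth a b M c) j.castSucc * modeConj a b l (gridPoint a b M j)
      = ∑ p ∈ modes M, c p * ∑ j : Fin M, mode a b (p + -l) (gridPoint a b M j) := by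
    simp only [synth, Finset.sum_mul, Finset.mul_sum, modeConj_eq, Fin.val_castSucc]
    rw [Finset.sum_comm]
    refine Finset.sum_congr rfl fun p _ => Finset.sum_congr rfl fun j _ => ?_
    rw [mode_add, mul_assoc]
  rw [fourierTilde, h1, Finset.sum_eq_single_of_mem l hl]
  · rw [sum_mode_gridPoint hab hM, if_pos (by simp)]
    field_simp
  · intro p hp hpl
    rw [sum_mode_gridPoint hab hM, if_neg, mul_zero]
    exact fun h => hpl (eq_of_dvd_sub_of_mem_modes he hl hp (by rwa [sub_eq_add_neg]))

theorem sum_modes_mode_mul (hab : a < b) (hM : 0 < M) (he : Even M) (j k : Fin M) :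
    ∑ l ∈ modes M, mode a b l (gridPoint a b M k) * mode a b (-l) (gridPoint a b M j)
      = if j = k then (M : ℂ) else 0 := by
  have hM' : (M : ℂ) ≠ 0 := by exact_mod_cast hM.ne'
  obtain ⟨r, hr⟩ := he
  set d : ℤ := (k : ℤ) - j with hd
  have h1 : ∑ l ∈ modes M, mode a b l (gridPoint a b M k) * mode a b (-l) (gridPoint a b M j)
      = ∑ i ∈ Finset.range M, Complex.exp (2 * Real.pi * Complex.I * (-r * d / M))
          * mode a b d (gridPoint a b M i) := by
    symm
    -- With `M = 2r`, the shift `l = i - r` turns the symmetric band into `0, …, M - 1`. Exchanging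
    -- the roles of frequency and grid index then reduces the sum to a geometric one, up to a phase
    -- independent of `i`.
    refine Finset.sum_nbij' (fun i : ℕ => (i : ℤ) - r) (fun l => (l + r).toNat) ?_ ?_ ?_ ?_ ?_
    · intro i hi
      simp only [modes, Finset.mem_range, Finset.mem_Ico] at hi ⊢
      omega
    · intro l hl
      simp only [modes, Finset.mem_range, Finset.mem_Ico] at hl ⊢
      omega
    · intro i hi
      simp
    · intro l hl
      simp only [modes, Finset.mem_Ico] at hl
      omega
    · intro i hi
      rw [mode_gridPoint hab hM, mode_gridPoint hab hM, mode_gridPoint hab hM, ← Complex.exp_add,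
        ← Complex.exp_add, hd]
      congr 1
      push_cast
      ring
  rw [h1, ← Finset.mul_sum, ← Fin.sum_univ_eq_sum_range (fun i => mode a b d (gridPoint a b M i)),
    sum_mode_gridPoint hab hM]
  split_ifs with h2 h3 h3
  · simp [hd, h3]
  · exfalso
    have : |d| < M := by rw [abs_lt]; constructor <;> omega
    have := Int.eq_zero_of_abs_lt_dvd h2 this
    exact h3 (Fin.ext (by omega))
  · exfalso
    exact h2 (by simp [hd, h3])
  · simp

theorem interp_gridPoint (hab : a < b) (hM : 0 < M) (he : Even M) (u : Grid M) (k : Fin M) :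
    interp a b u (gridPoint a b M k) = u k.castSucc := by
  have hM' : (M : ℂ) ≠ 0 := by exact_mod_cast hM.ne'
  have h1 : interp a b u (gridPoint a b M k) = ∑ j : Fin M, (1 / (M : ℂ)) * u j.castSucc *
      ∑ l ∈ modes M, mode a b l (gridPoint a b M k) * mode a b (-l) (gridPoint a b M j) := by
    simp only [interp, fourierTilde, modeConj_eq, Finset.mul_sum, Finset.sum_mul]
    rw [Finset.sum_comm]
    refine Finset.sum_congr rfl fun p _ => Finset.sum_congr rfl fun j _ => ?_
    ring
  rw [h1]
  simp only [sum_modes_mode_mul hab hM he]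
  simp
  field_simp

/-- Expanding only the conjugate factor and summing over frequencies first produces the interpolant
at a grid point, that is, the grid value itself. -/
theorem sum_norm_sq_fourierTilde (hab : a < b) (hM : 0 < M) (he : Even M) (u : Grid M) :
    ∑ l ∈ modes M, ‖fourierTilde a b u l‖ ^ 2 = 1 / (M : ℝ) * ∑ j : Fin M, ‖u j.castSucc‖ ^ 2 := by
  have h1 : ∀ l, (starRingEnd ℂ) (fourierTilde a b u l) = ∑ j : Fin M, (1 / (M : ℂ)) *
      ((starRingEnd ℂ) (u j.castSucc) * mode a b l (gridPoint a b M j)) := by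
    intro l
    rw [fourierTilde, Finset.mul_sum, map_sum]
    refine Finset.sum_congr rfl fun j _ => ?_
    simp [modeConj_eq, conj_mode]
  have h2 : ∑ l ∈ modes M, fourierTilde a b u l * (starRingEnd ℂ) (fourierTilde a b u l)
      = ∑ j : Fin M, (1 / (M : ℂ)) * (u j.castSucc * (starRingEnd ℂ) (u j.castSucc)) := by
    simp only [h1, Finset.mul_sum]
    rw [Finset.sum_comm]
    refine Finset.sum_congr rfl fun j _ => ?_
    have h3 := interp_gridPoint hab hM he u j
    rw [interp] at h3
    trans 1 / (M : ℂ) * ((starRingEnd ℂ) (u j.castSucc) *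
      ∑ l ∈ modes M, fourierTilde a b u l * mode a b l (gridPoint a b M j))
    · rw [Finset.mul_sum, Finset.mul_sum]
      exact Finset.sum_congr rfl fun l _ => by ring
    · rw [h3]; ring
  simp only [Complex.mul_conj'] at h2
  rw [← Finset.mul_sum] at h2
  apply Complex.ofReal_injective
  push_cast
  exact h2

theorem l2_fourierTilde_le_of_norm_le (hab : a < b) (hM : 0 < M) (he : Even M) {u w : Grid M}
    {c : ℝ} (hc : 0 ≤ c) (h : ∀ j : Fin M, ‖w j.castSucc‖ ≤ c * ‖u j.castSucc‖) :
    l2 (modes M) (fourierTilde a b w) ≤ c * l2 (modes M) (fourierTilde a b u) := by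
  rw [l2_le_iff (mul_nonneg hc (l2_nonneg _ _)), mul_pow, l2_sq,
    sum_norm_sq_fourierTilde hab hM he, sum_norm_sq_fourierTilde hab hM he, mul_left_comm]
  refine mul_le_mul_of_nonneg_left ?_ (by positivity)
  rw [Finset.mul_sum]
  refine Finset.sum_le_sum fun j _ => ?_
  rw [← mul_pow]
  exact pow_le_pow_left₀ (norm_nonneg _) (h j) 2

theorem l2_fourierTilde_le_of_bound (hab : a < b) (hM : 0 < M) (he : Even M) {w : Grid M}
    {B : ℝ} (hB : 0 ≤ B) (h : ∀ j : Fin M, ‖w j.castSucc‖ ≤ B) :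
    l2 (modes M) (fourierTilde a b w) ≤ B := by
  have hM' : (0 : ℝ) < M := by exact_mod_cast hM
  rw [l2_le_iff hB, sum_norm_sq_fourierTilde hab hM he]
  have : ∑ j : Fin M, ‖w j.castSucc‖ ^ 2 ≤ ∑ _j : Fin M, B ^ 2 :=
    Finset.sum_le_sum fun j _ => pow_le_pow_left₀ (norm_nonneg _) (h j) 2
  rw [Finset.sum_const, Finset.card_univ, Fintype.card_fin, nsmul_eq_mul] at this
  calc 1 / (M : ℝ) * ∑ j : Fin M, ‖w j.castSucc‖ ^ 2 ≤ 1 / (M : ℝ) * (M * B ^ 2) :=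
        mul_le_mul_of_nonneg_left this (by positivity)
    _ = B ^ 2 := by field_simp

theorem fourierTilde_sub (u v : Grid M) (l : ℤ) :
    fourierTilde a b (fun j => u j - v j) l = fourierTilde a b u l - fourierTilde a b v l := by
  simp only [fourierTilde, sub_mul, Finset.sum_sub_distrib, mul_sub]

theorem fourierTilde_const_mul (c : ℂ) (u : Grid M) (l : ℤ) :
    fourierTilde a b (fun j => c * u j) l = c * fourierTilde a b u l := by
  simp only [fourierTilde, mul_assoc, ← Finset.mul_sum]
  ring

/-! ### Aliasing -/

/-- The constant of the aliasing estimate. -/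
def aliasC : ℝ := Real.sqrt (∑' k : ℤ, 1 / (k : ℝ) ^ 2)

theorem aliasC_nonneg : 0 ≤ aliasC := Real.sqrt_nonneg _

theorem meshSize_pos (hab : a < b) (hM : 0 < M) : 0 < meshSize a b M := by
  have := sub_pos.2 hab
  have : (0 : ℝ) < M := by exact_mod_cast hM
  rw [meshSize]; positivity

/-- If `M k ≤ 2 q |p|`, then `1 ≤ h |μ_p| q / (π k)`. -/
theorem pi_mul_le_freq (hab : a < b) (hM : 0 < M) {p : ℤ} {k q : ℝ} (h : M * k ≤ 2 * q * |(p : ℝ)|) :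
    Real.pi * k ≤ q * meshSize a b M * |freq a b p| := by
  have hL := sub_pos.2 hab
  have hM' : (0 : ℝ) < M := by exact_mod_cast hM
  have hpi := Real.pi_pos
  rw [freq, abs_div, abs_mul, abs_of_pos (by positivity : 0 < 2 * Real.pi), abs_of_pos hL, meshSize]
  have : q * ((b - a) / M) * (2 * Real.pi * |(p : ℝ)| / (b - a)) = Real.pi * (2 * q * |(p : ℝ)|) / M := by
    field_simp
  rw [this, le_div_iff₀ hM']
  nlinarith

/-- An alias of `l` has the form `p = l + Mr` with `r ≠ 0`. As `|l| ≤ M/2`, this forces `|p| ≥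
M|r|/2`, hence `1 / wt p ≤ h / |r|`, and the squares sum like `∑ 1/r²`. -/
theorem sum_one_div_wt_sq_le (hab : a < b) (hM : 0 < M) (he : Even M) {l : ℤ} (hl : l ∈ modes M)
    {s : Finset ℤ} (hs : ∀ p ∈ s, (M : ℤ) ∣ p - l ∧ p ∉ modes M) :
    ∑ p ∈ s, (1 / wt a b p) ^ 2 ≤ (aliasC * meshSize a b M) ^ 2 := by
  have hh := meshSize_pos hab hM
  have hMz : (M : ℤ) ≠ 0 := by exact_mod_cast hM.ne'
  have hsum : Summable fun k : ℤ => 1 / (k : ℝ) ^ 2 := Real.summable_one_div_int_pow.2 one_lt_two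
  rw [mul_pow, aliasC, Real.sq_sqrt (tsum_nonneg fun k => by positivity)]
  have hinj : Set.InjOn (fun p : ℤ => (p - l) / M) s := by
    intro p hp q hq hpq
    obtain ⟨⟨r, hr⟩, -⟩ := hs p hp
    obtain ⟨⟨r', hr'⟩, -⟩ := hs q hq
    simp only [hr, hr', Int.mul_ediv_cancel_left _ hMz] at hpq
    subst hpq
    linarith
  have h1 : ∑ p ∈ s, (1 / wt a b p) ^ 2
      ≤ ∑ p ∈ s, meshSize a b M ^ 2 * (1 / (((p - l) / M : ℤ) : ℝ) ^ 2) := by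
    refine Finset.sum_le_sum fun p hp => ?_
    obtain ⟨⟨r, hr⟩, hpm⟩ := hs p hp
    rw [hr, Int.mul_ediv_cancel_left _ hMz]
    have hr0 : r ≠ 0 := by
      rintro rfl
      rw [mul_zero, sub_eq_zero] at hr
      exact hpm (hr ▸ hl)
    have hr1 : 1 ≤ |(r : ℝ)| := by exact_mod_cast Int.one_le_abs hr0
    have hle : (M : ℝ) * |(r : ℝ)| ≤ 2 * 1 * |(p : ℝ)| := by
      rw [mem_modes_iff he] at hl
      have h2 : (p : ℝ) = l + M * r := by
        have : p = l + M * r := by linarith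
        exact_mod_cast this
      have h3 : |(M : ℝ) * r| ≤ |(p : ℝ)| + |(l : ℝ)| := by
        have := abs_sub (p : ℝ) l
        rwa [h2, add_sub_cancel_left, ← h2] at this
      have h4 : 2 * |(l : ℝ)| ≤ M := by
        have : 2 * |l| ≤ (M : ℤ) := by
          rcases abs_cases l with h | h <;> omega
        exact_mod_cast this
      rw [abs_mul, Nat.abs_cast] at h3
      have hM' : (0 : ℝ) < M := by exact_mod_cast hM
      nlinarith
    have h5 := pi_mul_le_freq hab hM hle
    have h6 : |(r : ℝ)| ≤ meshSize a b M * wt a b p := by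
      have := abs_freq_le_wt (a := a) (b := b) p
      have hpi : 1 ≤ Real.pi := by linarith [Real.two_le_pi]
      nlinarith [abs_nonneg (r : ℝ)]
    have hw := wt_pos (a := a) (b := b) p
    have h7 : 1 / wt a b p ≤ meshSize a b M * (1 / |(r : ℝ)|) := by
      rw [mul_one_div, div_le_div_iff₀ hw (by linarith)]
      linarith
    calc (1 / wt a b p) ^ 2 ≤ (meshSize a b M * (1 / |(r : ℝ)|)) ^ 2 :=
          pow_le_pow_left₀ (by positivity) h7 2
      _ = _ := by rw [mul_pow, div_pow, one_pow, sq_abs]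
  refine h1.trans ?_
  rw [← Finset.mul_sum, mul_comm]
  refine mul_le_mul_of_nonneg_right ?_ (sq_nonneg _)
  -- The sum is reindexed by the quotient `(p - l) / M`. Extending it to all integers is harmless at
  -- `k = 0`, where the summand is `1 / 0 = 0`.
  rw [← Finset.sum_image (f := fun k : ℤ => 1 / (k : ℝ) ^ 2) hinj]
  exact hsum.sum_le_tsum _ fun _ _ => by positivity

/-- Cauchy–Schwarz within each residue class trades one derivative of the tail for a factor `h`;
summing over `l` costs nothing because the classes are disjoint. -/
theorem l2_alias_le (hab : a < b) (hM : 0 < M) (he : Even M) (v : ℤ → ℂ) {B : ℝ} (hB : 0 ≤ B)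
    (htail : ∀ s : Finset ℤ, (∀ p ∈ s, p ∉ modes M) → sob a b 1 s v ≤ B) (s : Finset ℤ) :
    l2 (modes M) (fun l => ∑ p ∈ s, if (M : ℤ) ∣ p - l ∧ p ∉ modes M then v p else 0)
      ≤ aliasC * meshSize a b M * B := by
  have hh := meshSize_pos hab hM
  have hC := aliasC_nonneg
  rw [l2_le_iff (by positivity), mul_pow]
  set s' := s.filter fun p => p ∉ modes M with hs'
  have h0 : ∑ p ∈ s', (wt a b p * ‖v p‖) ^ 2 ≤ B ^ 2 := by
    have := pow_le_pow_left₀ (sob_nonneg _ _ _) (htail s' fun p hp => (Finset.mem_filter.1 hp).2) 2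
    rw [sob, l2_sq] at this
    simp only [norm_wt_pow_mul] at this
    simpa only [pow_one] using this
  have h1 : ∀ l ∈ modes M, ‖∑ p ∈ s, if (M : ℤ) ∣ p - l ∧ p ∉ modes M then v p else 0‖ ^ 2
      ≤ (aliasC * meshSize a b M) ^ 2 *
        ∑ p ∈ s', if (M : ℤ) ∣ p - l then (wt a b p * ‖v p‖) ^ 2 else 0 := by
    intro l hl
    rw [← Finset.sum_filter, ← Finset.sum_filter, hs', Finset.filter_filter]
    simp only [and_comm (a := (M : ℤ) ∣ _ - l)]
    set t := s.filter fun p => p ∉ modes M ∧ (M : ℤ) ∣ p - l with ht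
    have h2 : ‖∑ p ∈ t, v p‖ ≤ ∑ p ∈ t, 1 / wt a b p * (wt a b p * ‖v p‖) := by
      refine (norm_sum_le _ _).trans (Finset.sum_le_sum fun p _ => ?_)
      have := wt_pos (a := a) (b := b) p
      field_simp
      rfl
    calc ‖∑ p ∈ t, v p‖ ^ 2 ≤ (∑ p ∈ t, 1 / wt a b p * (wt a b p * ‖v p‖)) ^ 2 :=
          pow_le_pow_left₀ (norm_nonneg _) h2 2
      _ ≤ (∑ p ∈ t, (1 / wt a b p) ^ 2) * ∑ p ∈ t, (wt a b p * ‖v p‖) ^ 2 :=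
          Finset.sum_mul_sq_le_sq_mul_sq _ _ _
      _ ≤ _ := by
          refine mul_le_mul_of_nonneg_right ?_ (Finset.sum_nonneg fun _ _ => sq_nonneg _)
          refine sum_one_div_wt_sq_le hab hM he hl fun p hp => ?_
          have := (Finset.mem_filter.1 hp).2
          exact ⟨this.2, this.1⟩
  refine (Finset.sum_le_sum h1).trans ?_
  rw [← Finset.mul_sum]
  refine mul_le_mul_of_nonneg_left ?_ (sq_nonneg _)
  rw [Finset.sum_comm]
  refine (Finset.sum_le_sum fun p _ => ?_).trans h0
  rw [← Finset.sum_filter, Finset.sum_const, nsmul_eq_mul]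
  refine mul_le_of_le_one_left (sq_nonneg _) ?_
  -- Each frequency `p` is an alias of at most one `l` in the band, so the double sum counts it at
  -- most once.
  have : (Finset.filter (fun l => (M : ℤ) ∣ p - l) (modes M)).card ≤ 1 := by
    rw [Finset.card_le_one]
    intro l hl l' hl'
    rw [Finset.mem_filter] at hl hl'
    refine (eq_of_dvd_sub_of_mem_modes he hl.1 hl'.1 ?_).symm
    have := dvd_sub hl.2 hl'.2
    rwa [sub_sub_sub_cancel_left] at this
  exact_mod_cast this

/-- The interpolation error in `L²`. -/
theorem l2_fourierTilde_sample_sub_le (hab : a < b) (hM : 0 < M) (he : Even M) {u : ℝ → ℂ}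
    (hu : Continuous u) (hp : Function.Periodic u (b - a)) {B₀ B : ℝ} (hB : 0 ≤ B)
    (h : ∀ s, sob a b 1 s (fourierHat a b u) ≤ B₀)
    (htail : ∀ s : Finset ℤ, (∀ p ∈ s, p ∉ modes M) → sob a b 1 s (fourierHat a b u) ≤ B) :
    l2 (modes M) (fun l => fourierTilde a b (sample a b M u) l - fourierHat a b u l)
      ≤ aliasC * meshSize a b M * B := by
  have hM' : (M : ℂ) ≠ 0 := by exact_mod_cast hM.ne'
  have hs := summable_of_sob_le hab h
  have hlim : ∀ l ∈ modes M, HasSum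
      (fun p => if (M : ℤ) ∣ p - l ∧ p ∉ modes M then fourierHat a b u p else 0)
      (fourierTilde a b (sample a b M u) l - fourierHat a b u l) := by
    intro l hl
    -- Sampling the absolutely convergent Fourier series and averaging over the grid keeps exactly
    -- the frequencies congruent to `l` modulo `M`. Removing `p = l` leaves only frequencies outside
    -- the band.
    have h1 : HasSum (fun p => if (M : ℤ) ∣ p - l then fourierHat a b u p else 0)
        (fourierTilde a b (sample a b M u) l) := by
      have h2 := (hasSum_sum (s := (Finset.univ : Finset (Fin M))) fun j _ =>
        (hasSum_mode hab hu hp hs (gridPoint a b M j)).mul_right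
          (modeConj a b l (gridPoint a b M j))).mul_left (1 / (M : ℂ))
      have h3 : (fun p => if (M : ℤ) ∣ p - l then fourierHat a b u p else 0) = fun p =>
          1 / (M : ℂ) * ∑ j : Fin M, fourierHat a b u p * mode a b p (gridPoint a b M j)
            * modeConj a b l (gridPoint a b M j) := by
        funext p
        simp only [modeConj_eq, mul_assoc, ← mode_add, ← Finset.mul_sum]
        rw [sum_mode_gridPoint hab hM, ← sub_eq_add_neg]
        split_ifs
        · field_simp
        · simp
      rw [h3]
      exact h2
    have h3 : HasSum (fun p => if p = l then fourierHat a b u p else 0) (fourierHat a b u l) := by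
      have := hasSum_ite_eq (L := SummationFilter.unconditional ℤ) l (fourierHat a b u l)
      convert this using 2 with p
      split_ifs with hpl
      · rw [hpl]
      · rfl
    have h4 := h1.sub h3
    refine h4.congr_fun ?_
    intro p
    by_cases hpl : p = l
    · subst hpl; simp [hl]
    · by_cases hd : (M : ℤ) ∣ p - l
      · have : p ∉ modes M := fun hpm => hpl (eq_of_dvd_sub_of_mem_modes he hl hpm hd)
        simp [hpl, hd, this]
      · simp [hpl, hd]
  rw [l2]
  refine le_of_tendsto ((Real.continuous_sqrt.tendsto _).comp
    (tendsto_finsetSum _ fun l hl => ((hlim l hl).norm.pow 2))) (Filter.Eventually.of_forall fun s => ?_)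
  exact l2_alias_le hab hM he _ hB htail s

end discrete

/-! ### The characteristic exponents -/

section exponents
variable {α a b : ℝ}

theorem one_le_disc (hα : 0 < α) (l : ℤ) : 1 ≤ disc α a b l := by
  rw [disc, Real.one_le_sqrt]
  nlinarith [mul_nonneg hα.le (sq_nonneg (freq a b l))]

theorem disc_sq (hα : 0 < α) (l : ℤ) : disc α a b l ^ 2 = 1 + 4 * α * freq a b l ^ 2 :=
  Real.sq_sqrt (by positivity)

theorem betaDiff_eq (hα : 0 < α) (l : ℤ) : betaDiff α a b l = disc α a b l / α := by
  simp only [betaDiff, betaPlus, betaMinus]; field_simp; ring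

theorem betaDiff_pos (hα : 0 < α) (l : ℤ) : 0 < betaDiff α a b l := by
  rw [betaDiff_eq hα]
  have := one_le_disc (a := a) (b := b) hα l
  positivity

theorem betaPlus_add_betaMinus (hα : 0 < α) (l : ℤ) :
    betaPlus α a b l + betaMinus α a b l = 1 / α := by
  simp only [betaPlus, betaMinus]; field_simp; ring

/-- Vieta: `β_l^±` are the roots of `α β² - β - μ_l² = 0`, the dispersion relation of the linear
equation. -/
theorem betaPlus_mul_betaMinus (hα : 0 < α) (l : ℤ) :
    betaPlus α a b l * betaMinus α a b l = -(freq a b l ^ 2 / α) := by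
  have h : betaPlus α a b l * betaMinus α a b l = (1 - disc α a b l ^ 2) / (4 * α ^ 2) := by
    simp only [betaPlus, betaMinus]; field_simp; ring
  rw [h, disc_sq hα]; field_simp; ring

theorem betaPlus_pos (hα : 0 < α) (l : ℤ) : 0 < betaPlus α a b l := by
  have := one_le_disc (a := a) (b := b) hα l
  rw [betaPlus]; positivity

theorem betaMinus_nonpos (hα : 0 < α) (l : ℤ) : betaMinus α a b l ≤ 0 := by
  have := one_le_disc (a := a) (b := b) hα l
  exact div_nonpos_of_nonpos_of_nonneg (by linarith) (by positivity)

theorem betaMinus_zero : betaMinus α a b 0 = 0 := by simp [betaMinus, disc, freq]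

theorem betaMinus_ne_zero (hα : 0 < α) (hab : a < b) {l : ℤ} (hl : l ≠ 0) :
    betaMinus α a b l ≠ 0 := by
  intro h
  have h1 := betaPlus_mul_betaMinus (a := a) (b := b) hα l
  have h2 : freq a b l ≠ 0 := by
    have : b - a ≠ 0 := (sub_pos.2 hab).ne'
    have h' : (l : ℝ) ≠ 0 := by exact_mod_cast hl
    simp only [freq]; positivity
  have h3 : freq a b l ^ 2 / α ≠ 0 := by positivity
  rw [h, mul_zero] at h1
  exact h3 (by linarith)

theorem abs_betaPlus_le (hα : 0 < α) (l : ℤ) : |betaPlus α a b l| ≤ betaDiff α a b l := by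
  rw [abs_of_pos (betaPlus_pos hα l), betaDiff]
  linarith [betaMinus_nonpos (a := a) (b := b) hα l]

theorem abs_betaMinus_le (hα : 0 < α) (l : ℤ) : |betaMinus α a b l| ≤ betaDiff α a b l := by
  rw [abs_of_nonpos (betaMinus_nonpos hα l), betaDiff]
  linarith [betaPlus_pos (a := a) (b := b) hα l]

end exponents

/-! ### The exponential integrals -/

theorem cis_add (x y : ℝ) : cis (x + y) = cis x * cis y := by
  simp only [cis, ← Complex.exp_add]; push_cast; ring_nf

theorem cis_zero : cis 0 = 1 := by simp [cis]

theorem norm_cis (x : ℝ) : ‖cis x‖ = 1 := by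
  rw [cis, mul_comm, Complex.norm_exp_ofReal_mul_I]

theorem cis_ne_zero (x : ℝ) : cis x ≠ 0 := Complex.exp_ne_zero _

theorem star_cis (x : ℝ) : star (cis x) = cis (-x) := by
  rw [cis, cis, Complex.star_def, ← Complex.exp_conj]
  simp

@[fun_prop]
theorem continuous_cis : Continuous cis := by unfold cis; fun_prop

theorem hasDerivAt_cis_mul (β t : ℝ) :
    HasDerivAt (fun t : ℝ => cis (β * t)) (Complex.I * β * cis (β * t)) t := by
  have h1 : HasDerivAt (fun t : ℝ => Complex.I * ((β * t : ℝ) : ℂ)) (Complex.I * β) t := by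
    have := ((hasDerivAt_id t).const_mul β).ofReal_comp.const_mul Complex.I
    simpa using this
  have h2 := h1.cexp
  rwa [mul_comm (Complex.exp _)] at h2

theorem cis_sub_cis_neg (x : ℝ) : cis x - cis (-x) = 2 * Complex.I * Real.sin x := by
  simp only [cis, mul_comm Complex.I, Complex.exp_mul_I]
  push_cast
  simp only [Complex.cos_neg, Complex.sin_neg]
  ring

theorem cis_add_cis_neg (x : ℝ) : cis x + cis (-x) = 2 * Real.cos x := by
  simp only [cis, mul_comm Complex.I, Complex.exp_mul_I]
  push_cast
  simp only [Complex.cos_neg, Complex.sin_neg]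
  ring

/-- This makes `τ σ` the integral of the exponential kernel over one step. In product form it also
covers `β τ = 0`. -/
theorem mul_sigma (β τ : ℝ) : Complex.I * β * (τ * sigma β τ) = cis (β * τ) - 1 := by
  by_cases h : β * τ = 0
  · rw [h, cis_zero, sub_self]
    rcases mul_eq_zero.1 h with h | h <;> simp [h]
  · have h2 : β * τ / 2 ≠ 0 := by simpa using h
    have hb : (β : ℂ) ≠ 0 := by exact_mod_cast left_ne_zero_of_mul h
    have ht : (τ : ℂ) ≠ 0 := by exact_mod_cast right_ne_zero_of_mul h
    have h4 : cis (β * τ) - 1 = cis (β * τ / 2) * (cis (β * τ / 2) - cis (-(β * τ / 2))) := by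
      rw [mul_sub, ← cis_add, ← cis_add, add_neg_cancel, cis_zero, add_halves]
    rw [sigma, Real.sinc_of_ne_zero h2, h4, cis_sub_cis_neg]
    push_cast
    field_simp

theorem integral_cis (β τ : ℝ) : ∫ s in (0 : ℝ)..τ, cis (β * (τ - s)) = τ * sigma β τ := by
  by_cases h : β = 0
  · simp [h, sigma, cis_zero]
  · have h' : Complex.I * (β : ℂ) ≠ 0 := mul_ne_zero Complex.I_ne_zero (by exact_mod_cast h)
    have h1 : ∫ s in (0 : ℝ)..τ, cis (β * (τ - s)) = ∫ s in (0 : ℝ)..τ, cis (β * s) := by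
      rw [intervalIntegral.integral_comp_sub_left (fun s => cis (β * s)) τ]; simp
    have h2 : ∫ s in (0 : ℝ)..τ, Complex.I * β * cis (β * s) = cis (β * τ) - cis (β * 0) :=
      intervalIntegral.integral_eq_sub_of_hasDerivAt (fun s _ => hasDerivAt_cis_mul β s)
        (Continuous.intervalIntegrable (by fun_prop) _ _)
    rw [intervalIntegral.integral_const_mul, mul_zero, cis_zero, ← mul_sigma] at h2
    rw [h1]
    exact mul_left_cancel₀ h' h2

theorem integral_mul_cis_zero (τ : ℝ) : ∫ s in (0 : ℝ)..τ, (s : ℂ) * cis (0 * (τ - s)) = τ ^ 2 / 2 := by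
  simp only [zero_mul, cis_zero, mul_one]
  rw [intervalIntegral.integral_ofReal, integral_id]
  push_cast; ring

/-- Integration by parts against `s e^{iβ(τ-s)}`: the boundary term is `τ`, and the remaining
integral is `τ σ`. -/
theorem integral_mul_cis {β : ℝ} (h : β ≠ 0) (τ : ℝ) :
    ∫ s in (0 : ℝ)..τ, (s : ℂ) * cis (β * (τ - s)) = Complex.I * τ * ((1 - sigma β τ) / β) := by
  have hb : (β : ℂ) ≠ 0 := by exact_mod_cast h
  have h' : Complex.I * (β : ℂ) ≠ 0 := mul_ne_zero Complex.I_ne_zero hb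
  have hd : ∀ s : ℝ, HasDerivAt (fun s : ℝ => (s : ℂ) * cis (β * (τ - s)))
      (cis (β * (τ - s)) - Complex.I * β * ((s : ℂ) * cis (β * (τ - s)))) s := by
    intro s
    have h1 : HasDerivAt (fun s : ℝ => cis (β * (τ - s))) (-(Complex.I * β * cis (β * (τ - s)))) s := by
      have := (hasDerivAt_cis_mul β (τ - s)).scomp s ((hasDerivAt_id s).const_sub τ)
      simpa [Function.comp_def] using this
    have h2 := (Complex.ofRealCLM.hasDerivAt (x := s)).mul h1
    refine h2.congr_deriv ?_
    simp
    ring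
  have h2 : ∫ s in (0 : ℝ)..τ, (cis (β * (τ - s)) - Complex.I * β * ((s : ℂ) * cis (β * (τ - s))))
      = (τ : ℂ) * cis (β * (τ - τ)) - ((0 : ℝ) : ℂ) * cis (β * (τ - 0)) :=
    intervalIntegral.integral_eq_sub_of_hasDerivAt (fun s _ => hd s)
        (Continuous.intervalIntegrable (by fun_prop) _ _)
  rw [intervalIntegral.integral_sub (Continuous.intervalIntegrable (by fun_prop) _ _)
    (Continuous.intervalIntegrable (by fun_prop) _ _), intervalIntegral.integral_const_mul,
    integral_cis, sub_self, mul_zero, cis_zero, Complex.ofReal_zero, zero_mul, sub_zero, mul_one] at h2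
  apply mul_left_cancel₀ h'
  have : Complex.I * (β : ℂ) * (Complex.I * τ * ((1 - sigma β τ) / β))
      = Complex.I ^ 2 * (τ * (1 - sigma β τ)) := by field_simp
  rw [this, Complex.I_sq]
  linear_combination -h2

/-- The phase `e^{iβτ/2}` of `σ` is half of `βτ` and sinc is real, so multiplying by `e^{-iβτ}` is
conjugation. This is how the conjugates in `p_l^*` arise. -/
theorem cis_neg_mul_sigma (β τ : ℝ) : cis (-(β * τ)) * sigma β τ = star (sigma β τ) := by
  rw [sigma, star_mul', star_cis, ← mul_assoc, ← cis_add]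
  congr 1
  · congr 1; ring
  · rw [Complex.star_def, Complex.conj_ofReal]

/-! ### The scheme as a one-step method in characteristic variables -/

section onestep
variable {α ε a b τ : ℝ}

/-- The factor `i ε² / (α β_l)` in the variation-of-constants formula. -/
def kap (α ε a b : ℝ) (l : ℤ) : ℂ :=
  Complex.I * (ε : ℂ) ^ 2 / ((α : ℂ) * (betaDiff α a b l : ℂ))

/-- The component along `e^{i β_l^+ t}` of a solution with value `u` and derivative `w`. -/
def charPlus (α a b : ℝ) (l : ℤ) (u w : ℂ) : ℂ :=
  (w - Complex.I * betaMinus α a b l * u) / (Complex.I * betaDiff α a b l)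

/-- The component along `e^{i β_l^- t}` of a solution with value `u` and derivative `w`. -/
def charMinus (α a b : ℝ) (l : ℤ) (u w : ℂ) : ℂ :=
  -((w - Complex.I * betaPlus α a b l * u) / (Complex.I * betaDiff α a b l))

theorem I_mul_betaDiff_ne_zero (hα : 0 < α) (l : ℤ) :
    Complex.I * (betaDiff α a b l : ℂ) ≠ 0 :=
  mul_ne_zero Complex.I_ne_zero (by exact_mod_cast (betaDiff_pos hα l).ne')

theorem ofReal_betaDiff (l : ℤ) :
    (betaDiff α a b l : ℂ) = betaPlus α a b l - betaMinus α a b l := by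
  simp [betaDiff]

theorem charPlus_add_charMinus (hα : 0 < α) (l : ℤ) (u w : ℂ) :
    charPlus α a b l u w + charMinus α a b l u w = u := by
  have h := I_mul_betaDiff_ne_zero (a := a) (b := b) hα l
  rw [charPlus, charMinus, ← sub_eq_add_neg, ← sub_div, div_eq_iff h, ofReal_betaDiff]
  ring

/-- The solution of `y' = i β y + κ (F n + (t - n τ) G n)` on the intervals `[n τ, (n + 1) τ]`. -/
def duhamelSeq (β τ : ℝ) (κ y₀ : ℂ) (F G : ℕ → ℂ) : ℕ → ℂ
  | 0 => y₀
  | n + 1 => cis (β * τ) * duhamelSeq β τ κ y₀ F G n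
      + κ * ∫ s in (0 : ℝ)..τ, cis (β * (τ - s)) * (F n + s * G n)

/-- The integral `∫_0^τ s e^{i β (τ - s)} ds`. -/
def momentInt (β τ : ℝ) : ℂ := ∫ s in (0 : ℝ)..τ, (s : ℂ) * cis (β * (τ - s))

theorem integral_cis_mul (β τ : ℝ) (p q : ℂ) :
    ∫ s in (0 : ℝ)..τ, cis (β * (τ - s)) * (p + s * q) = τ * sigma β τ * p + momentInt β τ * q := by
  have h : ∀ s : ℝ, cis (β * (τ - s)) * (p + s * q)
      = cis (β * (τ - s)) * p + (s : ℂ) * cis (β * (τ - s)) * q := fun s => by ring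
  simp only [h]
  rw [intervalIntegral.integral_add (Continuous.intervalIntegrable (by fun_prop) _ _)
    (Continuous.intervalIntegrable (by fun_prop) _ _), intervalIntegral.integral_mul_const,
    intervalIntegral.integral_mul_const, integral_cis, momentInt]

theorem duhamelSeq_succ (β τ : ℝ) (κ y₀ : ℂ) (F G : ℕ → ℂ) (n : ℕ) :
    duhamelSeq β τ κ y₀ F G (n + 1) = cis (β * τ) * duhamelSeq β τ κ y₀ F G n
      + κ * (τ * sigma β τ * F n + momentInt β τ * G n) := by
  rw [duhamelSeq, integral_cis_mul]

/-- With `coefQ_eq` this identifies `p_l` and `q_l` as the zeroth and first moments of the Duhamel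
kernels, which enter the two characteristic components with opposite signs. -/
theorem coefP_eq (l : ℤ) : coefP α ε a b τ l = kap α ε a b l *
    (τ * sigma (betaPlus α a b l) τ - τ * sigma (betaMinus α a b l) τ) := by
  rw [coefP, kap]; ring

/-- At `l = 0` the exponent vanishes and the moment is `τ²/2`, which is `iτ` times the prescribed
limit value `-iτ/2`. -/
theorem momentInt_betaMinus (hα : 0 < α) (hab : a < b) (l : ℤ) :
    momentInt (betaMinus α a b l) τ = Complex.I * τ * if l = 0 then -(Complex.I * (τ : ℂ) / 2)
        else (1 - sigma (betaMinus α a b l) τ) / (betaMinus α a b l : ℂ) := by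
  split_ifs with h
  · subst h
    rw [momentInt, betaMinus_zero, integral_mul_cis_zero]
    linear_combination ((τ : ℂ) ^ 2 / 2) * Complex.I_sq
  · exact integral_mul_cis (betaMinus_ne_zero hα hab h) τ

theorem coefQ_eq (hα : 0 < α) (hab : a < b) (l : ℤ) : coefQ α ε a b τ l = kap α ε a b l *
    (momentInt (betaPlus α a b l) τ - momentInt (betaMinus α a b l) τ) := by
  rw [momentInt_betaMinus hα hab, momentInt, integral_mul_cis (betaPlus_pos hα l).ne', coefQ, kap,
    ← mul_sub]
  have : ∀ X Y : ℂ, Complex.I * (ε : ℂ) ^ 2 / Y * (Complex.I * τ * X)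
      = Complex.I ^ 2 * (ε : ℂ) ^ 2 * τ / Y * X := fun X Y => by ring
  rw [this, Complex.I_sq]
  ring

theorem cis_betaPlus_mul_cis_betaMinus (hα : 0 < α) (l : ℤ) (t : ℝ) :
    cis (betaPlus α a b l * t) * cis (betaMinus α a b l * t) = cis (t / α) := by
  rw [← cis_add, ← add_mul, betaPlus_add_betaMinus hα, one_div_mul_eq_div]

/-- Since `e^{iτ/α} = e^{iβ⁺τ} e^{iβ⁻τ}`, multiplying a conjugate `σ^±` by it leaves `σ^±` times the
propagator of the other component, as elimination of the components requires. -/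
theorem coefPStar_eq (hα : 0 < α) (l : ℤ) : coefPStar α ε a b τ l = kap α ε a b l *
    (cis (betaMinus α a b l * τ) * (τ * sigma (betaPlus α a b l) τ)
      - cis (betaPlus α a b l * τ) * (τ * sigma (betaMinus α a b l) τ)) := by
  have h1 : cis (τ / α) * cis (-(betaPlus α a b l * τ)) = cis (betaMinus α a b l * τ) := by
    rw [← cis_betaPlus_mul_cis_betaMinus (a := a) (b := b) hα l, mul_right_comm, ← cis_add,
      add_neg_cancel, cis_zero, one_mul]
  have h2 : cis (τ / α) * cis (-(betaMinus α a b l * τ)) = cis (betaPlus α a b l * τ) := by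
    rw [← cis_betaPlus_mul_cis_betaMinus (a := a) (b := b) hα l, mul_assoc, ← cis_add,
      add_neg_cancel, cis_zero, mul_one]
  rw [coefPStar, kap, ← cis_neg_mul_sigma, ← cis_neg_mul_sigma, ← h1, ← h2]
  ring

theorem coefQStar_eq (hα : 0 < α) (hab : a < b) (l : ℤ) : coefQStar α ε a b τ l = kap α ε a b l *
    (cis (betaMinus α a b l * τ) * momentInt (betaPlus α a b l) τ
      - cis (betaPlus α a b l * τ) * momentInt (betaMinus α a b l) τ) := by
  have hp := cis_ne_zero (betaPlus α a b l * τ)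
  have hm := cis_ne_zero (betaMinus α a b l * τ)
  have h3 : (if l = 0 then -(Complex.I * (τ : ℂ) / 2)
        else (1 - sigma (betaMinus α a b l) τ)
          / ((betaMinus α a b l : ℂ) * cis (betaMinus α a b l * τ)))
      = (if l = 0 then -(Complex.I * (τ : ℂ) / 2)
        else (1 - sigma (betaMinus α a b l) τ) / (betaMinus α a b l : ℂ))
          / cis (betaMinus α a b l * τ) := by
    split_ifs with h
    · subst h; simp [betaMinus_zero, cis_zero]
    · rw [div_div]
  rw [momentInt_betaMinus hα hab, momentInt, integral_mul_cis (betaPlus_pos hα l).ne', coefQStar, kap,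
    h3]
  set X := (1 - sigma (betaPlus α a b l) τ) / (betaPlus α a b l : ℂ)
  set Y := (if l = 0 then -(Complex.I * (τ : ℂ) / 2)
        else (1 - sigma (betaMinus α a b l) τ) / (betaMinus α a b l : ℂ))
  have h4 := cis_betaPlus_mul_cis_betaMinus (a := a) (b := b) hα l τ
  have h5 : cis (τ / α) * (X / cis (betaPlus α a b l * τ)) = cis (betaMinus α a b l * τ) * X := by
    rw [← h4, mul_comm (cis (betaPlus α a b l * τ)), mul_assoc, mul_div_cancel₀ _ hp]
  have h6 : cis (τ / α) * (Y / cis (betaMinus α a b l * τ)) = cis (betaPlus α a b l * τ) * Y := by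
    rw [← h4, mul_assoc, mul_div_cancel₀ _ hm]
  have h8 : (1 - sigma (betaPlus α a b l) τ) / ((betaPlus α a b l : ℂ) * cis (betaPlus α a b l * τ))
      = X / cis (betaPlus α a b l * τ) := by rw [div_div]
  have h7 : ∀ Z c p q : ℂ, -(ε : ℂ) ^ 2 * (τ : ℂ) * c / Z * (p - q)
      = -(ε : ℂ) ^ 2 * (τ : ℂ) / Z * (c * p - c * q) := fun Z c p q => by ring
  rw [h8, h7, h5, h6]
  have : ∀ X Y Z c d : ℂ, Complex.I * (ε : ℂ) ^ 2 / Z * (c * (Complex.I * τ * X) - d * (Complex.I * τ * Y))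
      = Complex.I ^ 2 * (ε : ℂ) ^ 2 * τ / Z * (c * X - d * Y) := fun X Y Z c d => by ring
  rw [this, Complex.I_sq]
  ring

theorem betaPlus_eq_half (hα : 0 < α) (l : ℤ) :
    betaPlus α a b l * τ = τ / (2 * α) + τ * betaDiff α a b l / 2 := by
  simp only [betaDiff, betaPlus, betaMinus]; field_simp; ring

theorem betaMinus_eq_half (hα : 0 < α) (l : ℤ) :
    betaMinus α a b l * τ = τ / (2 * α) + -(τ * betaDiff α a b l / 2) := by
  simp only [betaDiff, betaPlus, betaMinus]; field_simp; ring

/-- `d_l` and `-c_l` are the sum and product of the two propagators, so the homogeneous recurrence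
has characteristic roots `e^{iβ⁺τ}` and `e^{iβ⁻τ}`. -/
theorem coefD_eq (hα : 0 < α) (l : ℤ) :
    coefD α a b τ l = cis (betaPlus α a b l * τ) + cis (betaMinus α a b l * τ) := by
  rw [betaPlus_eq_half hα, betaMinus_eq_half hα, cis_add, cis_add, ← mul_add, cis_add_cis_neg, coefD]
  ring

theorem coefC_eq (hα : 0 < α) (l : ℤ) :
    coefC α τ = -(cis (betaPlus α a b l * τ) * cis (betaMinus α a b l * τ)) := by
  rw [cis_betaPlus_mul_cis_betaMinus hα, coefC]

theorem coefD0_eq (hα : 0 < α) (hτ : 0 < τ) (l : ℤ) :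
    coefD0 α a b τ l = (cis (betaPlus α a b l * τ) - cis (betaMinus α a b l * τ))
      / (Complex.I * betaDiff α a b l) := by
  have h := betaDiff_pos (a := a) (b := b) hα l
  have h' : (betaDiff α a b l : ℂ) ≠ 0 := by exact_mod_cast h.ne'
  have ht : (τ : ℂ) ≠ 0 := by exact_mod_cast hτ.ne'
  rw [betaPlus_eq_half hα, betaMinus_eq_half hα, cis_add, cis_add, ← mul_sub, cis_sub_cis_neg, coefD0,
    Real.sinc_of_ne_zero (by positivity)]
  have hI := Complex.I_ne_zero
  push_cast
  field_simp

/-- The initial step and the characteristic variables. -/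
theorem coefC0_mul_add (hα : 0 < α) (hτ : 0 < τ) (l : ℤ) (u w : ℂ) :
    coefC0 α a b τ l * u + coefD0 α a b τ l * w
      = cis (betaPlus α a b l * τ) * charPlus α a b l u w
        + cis (betaMinus α a b l * τ) * charMinus α a b l u w := by
  have h := betaDiff_pos (a := a) (b := b) hα l
  have h' : (betaDiff α a b l : ℂ) ≠ 0 := by exact_mod_cast h.ne'
  have hI := Complex.I_ne_zero
  rw [coefD0_eq hα hτ, coefC0, charPlus, charMinus]
  field_simp
  ring

/-- The values of `g` used in the scheme. -/
def gSeq (α ε a b τ : ℝ) (M : ℕ) (ψ₀ ψ₁ : ℝ → ℂ) : ℕ → Grid M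
  | 0 => gInit (sample a b M ψ₀) (sample a b M ψ₁)
  | n + 1 => gDiff τ (ewiFP α ε a b τ M ψ₀ ψ₁ (n + 1)) (ewiFP α ε a b τ M ψ₀ ψ₁ n)

theorem ewiFP_add_two (M : ℕ) (ψ₀ ψ₁ : ℝ → ℂ) (n : ℕ) :
    ewiFP α ε a b τ M ψ₀ ψ₁ (n + 2) = nextStep α ε a b τ (ewiFP α ε a b τ M ψ₀ ψ₁ (n + 1))
      (ewiFP α ε a b τ M ψ₀ ψ₁ n) (gSeq α ε a b τ M ψ₀ ψ₁ (n + 1)) (gSeq α ε a b τ M ψ₀ ψ₁ n) := by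
  cases n with
  | zero => rfl
  | succ k => rw [ewiFP, gSeq, gSeq]

/-- The component along `e^{i β_l^+ t}` of the numerical solution. -/
def numPlus (α ε a b τ : ℝ) (M : ℕ) (ψ₀ ψ₁ : ℝ → ℂ) (n : ℕ) (l : ℤ) : ℂ :=
  duhamelSeq (betaPlus α a b l) τ (kap α ε a b l)
    (charPlus α a b l (fourierTilde a b (sample a b M ψ₀) l) (fourierTilde a b (sample a b M ψ₁) l))
    (fun n => fourierTilde a b (cubicGrid (ewiFP α ε a b τ M ψ₀ ψ₁ n)) l)
    (fun n => fourierTilde a b (gSeq α ε a b τ M ψ₀ ψ₁ n) l) n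

/-- The component along `e^{i β_l^- t}` of the numerical solution. -/
def numMinus (α ε a b τ : ℝ) (M : ℕ) (ψ₀ ψ₁ : ℝ → ℂ) (n : ℕ) (l : ℤ) : ℂ :=
  duhamelSeq (betaMinus α a b l) τ (-kap α ε a b l)
    (charMinus α a b l (fourierTilde a b (sample a b M ψ₀) l) (fourierTilde a b (sample a b M ψ₁) l))
    (fun n => fourierTilde a b (cubicGrid (ewiFP α ε a b τ M ψ₀ ψ₁ n)) l)
    (fun n => fourierTilde a b (gSeq α ε a b τ M ψ₀ ψ₁ n) l) n

/-- Two first-order recursions with multipliers `E⁺`, `E⁻` add up to a second-order one: `E⁺y⁺ +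
E⁻y⁻ = (E⁺ + E⁻)(y⁺ + y⁻) - E⁻y⁺ - E⁺y⁻`. Expanding the last two terms one step back yields `-E⁺E⁻`
times the older value and the starred source terms. -/
theorem fourierTilde_ewiFP (hα : 0 < α) (hab : a < b) (hτ : 0 < τ) {M : ℕ} (hM : 0 < M)
    (he : Even M) (ψ₀ ψ₁ : ℝ → ℂ) {l : ℤ} (hl : l ∈ modes M) (n : ℕ) :
    fourierTilde a b (ewiFP α ε a b τ M ψ₀ ψ₁ n) l
      = numPlus α ε a b τ M ψ₀ ψ₁ n l + numMinus α ε a b τ M ψ₀ ψ₁ n l := by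
  have h0 : fourierTilde a b (ewiFP α ε a b τ M ψ₀ ψ₁ 0) l
      = numPlus α ε a b τ M ψ₀ ψ₁ 0 l + numMinus α ε a b τ M ψ₀ ψ₁ 0 l := by
    rw [numPlus, numMinus, duhamelSeq, duhamelSeq, charPlus_add_charMinus hα, ewiFP]
  induction n using Nat.twoStepInduction with
  | zero => exact h0
  | one =>
    rw [ewiFP, firstStep, fourierTilde_synth hab hM he _ hl, numPlus, numMinus, duhamelSeq_succ,
      duhamelSeq_succ, duhamelSeq, duhamelSeq, coefC0_mul_add hα hτ, coefP_eq, coefQ_eq hα hab, ewiFP,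
      gSeq]
    ring
  | more n ih0 ih1 =>
    rw [ewiFP_add_two, nextStep, fourierTilde_synth hab hM he _ hl, ih0, ih1, coefP_eq,
      coefQ_eq hα hab, coefPStar_eq hα, coefQStar_eq hα hab, coefD_eq hα, coefC_eq (a := a) (b := b) hα l]
    simp only [numPlus, numMinus]
    simp only [duhamelSeq_succ]
    ring

end onestep

/-! ### Fourier coefficients as functions of time, and variation of constants. -/

section time
variable {a b S : ℝ}

theorem continuous_of_continuousOn_prod {G : ℝ → ℝ → ℂ}
    (hG : ContinuousOn (fun z : ℝ × ℝ => G z.1 z.2) (Set.Icc 0 S ×ˢ Set.univ)) {t : ℝ}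
    (ht : t ∈ Set.Icc 0 S) : Continuous (G t) := by
  have : Continuous fun x : ℝ => (t, x) := by fun_prop
  exact hG.comp_continuous this fun x => ⟨ht, trivial⟩

theorem continuousOn_fourierHat {G : ℝ → ℝ → ℂ}
    (hG : ContinuousOn (fun z : ℝ × ℝ => G z.1 z.2) (Set.Icc 0 S ×ˢ Set.univ)) (l : ℤ) :
    ContinuousOn (fun t => fourierHat a b (G t) l) (Set.Icc 0 S) := by
  rcases lt_or_ge S 0 with hS | hS
  · rw [Set.Icc_eq_empty (not_le.2 hS)]; exact continuousOn_empty _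
  -- `G` is controlled only for times in `[0, S]`; freezing it at the end values outside gives a
  -- globally continuous function, so the parametric integral theorem applies.
  have h1 : Continuous fun z : ℝ × ℝ => G (Set.projIcc 0 S hS z.1) z.2 := by
    refine hG.comp_continuous (f := fun z : ℝ × ℝ => ((Set.projIcc 0 S hS z.1 : ℝ), z.2)) ?_
      fun z => ⟨(Set.projIcc 0 S hS z.1).2, trivial⟩
    have := continuous_projIcc (h := hS)
    fun_prop
  have h2 : Continuous fun t : ℝ => fourierHat a b (G (Set.projIcc 0 S hS t)) l := by
    unfold fourierHat
    refine continuous_const.mul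
      (intervalIntegral.continuous_parametric_intervalIntegral_of_continuous' ?_ a b)
    exact h1.mul ((continuous_modeConj l).comp continuous_snd)
  refine h2.continuousOn.congr fun t ht => ?_
  simp only [Set.projIcc_of_mem hS ht]

theorem hasDerivAt_fourierHat {G dG : ℝ → ℝ → ℂ}
    (hG : ContinuousOn (fun z : ℝ × ℝ => G z.1 z.2) (Set.Icc 0 S ×ˢ Set.univ))
    (hdG : ContinuousOn (fun z : ℝ × ℝ => dG z.1 z.2) (Set.Icc 0 S ×ˢ Set.univ))
    (hd : ∀ t ∈ Set.Ioo 0 S, ∀ x, HasDerivAt (fun s => G s x) (dG t x) t) (l : ℤ) {t : ℝ}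
    (ht : t ∈ Set.Ioo 0 S) :
    HasDerivAt (fun t => fourierHat a b (G t) l) (fourierHat a b (dG t) l) t := by
  -- A constant dominates the time derivative on the compact set `[0, S] × [a, b]`, which justifies
  -- differentiating under the integral.
  obtain ⟨C, hC⟩ := (isCompact_Icc.prod isCompact_uIcc).exists_bound_of_continuousOn
    (hdG.mono (Set.prod_mono_right (Set.subset_univ (Set.uIcc a b))))
  have hnhds := Ioo_mem_nhds ht.1 ht.2
  have hcont : ∀ s ∈ Set.Ioo 0 S, Continuous (fun x => G s x * modeConj a b l x) := fun s hs =>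
    (continuous_of_continuousOn_prod hG (Set.Ioo_subset_Icc_self hs)).mul (continuous_modeConj l)
  have hcont' : Continuous (fun x => dG t x * modeConj a b l x) :=
    (continuous_of_continuousOn_prod hdG (Set.Ioo_subset_Icc_self ht)).mul (continuous_modeConj l)
  have := (intervalIntegral.hasDerivAt_integral_of_dominated_loc_of_deriv_le
    (μ := MeasureTheory.volume) (a := a) (b := b)
    (F := fun s x => G s x * modeConj a b l x) (F' := fun s x => dG s x * modeConj a b l x)
    (bound := fun _ => C) hnhds
    (Filter.eventually_of_mem hnhds fun s hs => (hcont s hs).aestronglyMeasurable)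
    ((hcont t ht).intervalIntegrable _ _) hcont'.aestronglyMeasurable
    (Filter.Eventually.of_forall fun x hx s hs => ?_) intervalIntegrable_const
    (Filter.Eventually.of_forall fun x _ s hs => (hd s hs x).mul_const _)).2
  · exact this.const_mul _
  · rw [norm_mul, norm_modeConj, mul_one]
    exact hC (s, x) ⟨Set.Ioo_subset_Icc_self hs, Set.uIoc_subset_uIcc hx⟩

/-- Variation of constants for a scalar equation `y' = i β y + κ F`. -/
theorem duhamel_formula {β : ℝ} {κ : ℂ} {y F : ℝ → ℂ} (hy : ContinuousOn y (Set.Icc 0 S))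
    (hF : ContinuousOn F (Set.Icc 0 S))
    (hd : ∀ t ∈ Set.Ioo 0 S, HasDerivAt y (Complex.I * β * y t + κ * F t) t) {t τ : ℝ} (ht : 0 ≤ t)
    (hτ : 0 ≤ τ) (htτ : t + τ ≤ S) :
    y (t + τ) = cis (β * τ) * y t + κ * ∫ s in (0 : ℝ)..τ, cis (β * (τ - s)) * F (t + s) := by
  have hmaps : Set.MapsTo (fun s => t + s) (Set.Icc 0 τ) (Set.Icc 0 S) := fun s hs =>
    ⟨add_nonneg ht hs.1, (add_le_add_right hs.2 t).trans htτ⟩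
  have hct : ContinuousOn (fun s => t + s) (Set.Icc 0 τ) := by fun_prop
  have hyt : ContinuousOn (fun s => y (t + s)) (Set.Icc 0 τ) := hy.comp hct hmaps
  have hFt : ContinuousOn (fun s => F (t + s)) (Set.Icc 0 τ) := hF.comp hct hmaps
  have hc : Continuous fun s : ℝ => cis (β * (τ - s)) := by fun_prop
  have h1 := intervalIntegral.integral_eq_sub_of_hasDerivAt_of_le hτ
    (f := fun s => cis (β * (τ - s)) * y (t + s))
    (f' := fun s => κ * (cis (β * (τ - s)) * F (t + s))) (hc.continuousOn.mul hyt)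
    (fun s hs => by
      have h2 : HasDerivAt (fun s : ℝ => cis (β * (τ - s)))
          (-(Complex.I * β * cis (β * (τ - s)))) s := by
        have := (hasDerivAt_cis_mul β (τ - s)).scomp s ((hasDerivAt_id s).const_sub τ)
        simpa [Function.comp_def] using this
      have h3 := (hd (t + s) ⟨by linarith [hs.1], by linarith [hs.2]⟩).scomp s
        ((hasDerivAt_id s).const_add t)
      refine (h2.mul h3).congr_deriv ?_
      simp
      ring)
    (ContinuousOn.intervalIntegrable_of_Icc hτ
      (continuousOn_const.mul (hc.continuousOn.mul hFt)))
  rw [intervalIntegral.integral_const_mul] at h1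
  simp only [sub_self, mul_zero, cis_zero, one_mul, sub_zero, add_zero] at h1
  rw [h1]
  ring

end time

/-! ### The exact solution in Fourier and characteristic variables. -/

section solution
variable {α ε a b S : ℝ} {ψ₀ ψ₁ : ℝ → ℂ} {ψ : ℝ → ℝ → ℂ}

theorem hasDerivWithinAt_timeDeriv (hψ : IsSolution α ε a b S ψ₀ ψ₁ ψ) {t : ℝ}
    (ht : t ∈ Set.Icc 0 S) (x : ℝ) :
    HasDerivWithinAt (fun s => ψ s x) (timeDeriv S ψ t x) (Set.Icc 0 S) t :=
  (((hψ.contDiff_time x).differentiableOn (by norm_num)) t ht).hasDerivWithinAt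

theorem hasDerivWithinAt_timeDeriv_timeDeriv (hS : 0 < S) (hψ : IsSolution α ε a b S ψ₀ ψ₁ ψ)
    {t : ℝ} (ht : t ∈ Set.Icc 0 S) (x : ℝ) :
    HasDerivWithinAt (fun s => timeDeriv S ψ s x) (timeDeriv S (timeDeriv S ψ) t x)
      (Set.Icc 0 S) t :=
  ((((hψ.contDiff_time x).derivWithin (m := 1) (uniqueDiffOn_Icc hS) (by norm_num)).differentiableOn
    (by norm_num)) t ht).hasDerivWithinAt

theorem timeDeriv_periodic {G : ℝ → ℝ → ℂ} {L : ℝ}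
    (hG : ∀ t ∈ Set.Icc 0 S, Function.Periodic (G t) L) {t : ℝ} (ht : t ∈ Set.Icc 0 S) :
    Function.Periodic (timeDeriv S G t) L := fun x =>
  derivWithin_congr (fun s hs => hG s hs x) (hG t ht x)

theorem hasDerivAt_spaceDeriv (hψ : IsSolution α ε a b S ψ₀ ψ₁ ψ) {t : ℝ} (ht : t ∈ Set.Icc 0 S)
    (x : ℝ) : HasDerivAt (ψ t) (spaceDeriv ψ t x) x :=
  ((hψ.contDiff_space t ht).differentiable (by norm_num) x).hasDerivAt

theorem hasDerivAt_spaceDeriv_spaceDeriv (hψ : IsSolution α ε a b S ψ₀ ψ₁ ψ) {t : ℝ}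
    (ht : t ∈ Set.Icc 0 S) (x : ℝ) :
    HasDerivAt (spaceDeriv ψ t) (spaceDeriv (spaceDeriv ψ) t x) x := by
  have h1 : ContDiff ℝ 1 (deriv (ψ t)) := (contDiff_succ_iff_deriv (n := 1)).1
    (by simpa [one_add_one_eq_two] using hψ.contDiff_space t ht) |>.2.2
  exact (h1.differentiable (by norm_num) x).hasDerivAt

theorem spaceDeriv_periodic (hψ : IsSolution α ε a b S ψ₀ ψ₁ ψ) {t : ℝ} (ht : t ∈ Set.Icc 0 S) :
    Function.Periodic (spaceDeriv ψ t) (b - a) := by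
  intro x
  have h1 := (hasDerivAt_spaceDeriv hψ ht (x + (b - a))).comp_add_const x (b - a)
  have h2 : (fun y => ψ t (y + (b - a))) = ψ t := funext fun y => hψ.periodic t ht y
  rw [h2] at h1
  exact h1.unique (hasDerivAt_spaceDeriv hψ ht x)

@[fun_prop]
theorem continuous_cubic : Continuous cubic := by unfold cubic; fun_prop

theorem continuousOn_cubic_comp (hψ : IsSolution α ε a b S ψ₀ ψ₁ ψ) :
    ContinuousOn (fun z : ℝ × ℝ => cubic (ψ z.1 z.2)) (Set.Icc 0 S ×ˢ Set.univ) :=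
  continuous_cubic.comp_continuousOn hψ.continuous

theorem fourierHat_spaceDeriv_spaceDeriv (hab : a < b) (hψ : IsSolution α ε a b S ψ₀ ψ₁ ψ) {t : ℝ}
    (ht : t ∈ Set.Icc 0 S) (l : ℤ) :
    fourierHat a b (spaceDeriv (spaceDeriv ψ) t) l = -(freq a b l : ℂ) ^ 2 * fourierHat a b (ψ t) l := by
  rw [fourierHat_deriv hab (hasDerivAt_spaceDeriv_spaceDeriv hψ ht)
    (continuous_of_continuousOn_prod hψ.continuous_xx ht) (spaceDeriv_periodic hψ ht),
    fourierHat_deriv hab (hasDerivAt_spaceDeriv hψ ht)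
    (continuous_of_continuousOn_prod hψ.continuous_x ht) (hψ.periodic t ht)]
  linear_combination ((freq a b l : ℂ) ^ 2 * fourierHat a b (ψ t) l) * Complex.I_sq

theorem fourierHat_equation (hab : a < b) (hψ : IsSolution α ε a b S ψ₀ ψ₁ ψ) {t : ℝ}
    (ht : t ∈ Set.Ioo 0 S) (l : ℤ) :
    (α : ℂ) * fourierHat a b (timeDeriv S (timeDeriv S ψ) t) l
      = Complex.I * fourierHat a b (timeDeriv S ψ t) l - (freq a b l : ℂ) ^ 2 * fourierHat a b (ψ t) l
        - (ε : ℂ) ^ 2 * fourierHat a b (fun x => cubic (ψ t x)) l := by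
  have ht' := Set.Ioo_subset_Icc_self ht
  have h1 := continuous_of_continuousOn_prod hψ.continuous_t ht'
  have h2 := continuous_of_continuousOn_prod hψ.continuous_xx ht'
  have h3 := (continuous_of_continuousOn_prod hψ.continuous ht')
  have h4 : (fun x => (α : ℂ) * timeDeriv S (timeDeriv S ψ) t x)
      = fun x => (Complex.I * timeDeriv S ψ t x + spaceDeriv (spaceDeriv ψ) t x)
        - (ε : ℂ) ^ 2 * cubic (ψ t x) := by
    funext x
    linear_combination -hψ.equation t (Set.Ioo_subset_Ioc_self ht) x
  rw [← fourierHat_const_mul, h4, fourierHat_sub (by fun_prop) (by fun_prop),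
    fourierHat_add (by fun_prop) (by fun_prop), fourierHat_const_mul, fourierHat_const_mul,
    fourierHat_spaceDeriv_spaceDeriv hab hψ ht']
  ring

/-- The component along `e^{i β_l^+ t}` of the exact solution. -/
def exPlus (α a b S : ℝ) (ψ : ℝ → ℝ → ℂ) (t : ℝ) (l : ℤ) : ℂ :=
  charPlus α a b l (fourierHat a b (ψ t) l) (fourierHat a b (timeDeriv S ψ t) l)

/-- The component along `e^{i β_l^- t}` of the exact solution. -/
def exMinus (α a b S : ℝ) (ψ : ℝ → ℝ → ℂ) (t : ℝ) (l : ℤ) : ℂ :=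
  charMinus α a b l (fourierHat a b (ψ t) l) (fourierHat a b (timeDeriv S ψ t) l)

theorem exPlus_add_exMinus (hα : 0 < α) (t : ℝ) (l : ℤ) :
    exPlus α a b S ψ t l + exMinus α a b S ψ t l = fourierHat a b (ψ t) l :=
  charPlus_add_charMinus hα l _ _

theorem hasDerivAt_hat (hψ : IsSolution α ε a b S ψ₀ ψ₁ ψ) {t : ℝ}
    (ht : t ∈ Set.Ioo 0 S) (l : ℤ) : HasDerivAt (fun t => fourierHat a b (ψ t) l)
      (fourierHat a b (timeDeriv S ψ t) l) t :=
  hasDerivAt_fourierHat hψ.continuous hψ.continuous_t (fun _ hs x =>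
    (hasDerivWithinAt_timeDeriv hψ (Set.Ioo_subset_Icc_self hs) x).hasDerivAt
      (Icc_mem_nhds hs.1 hs.2)) l ht

theorem hasDerivAt_hat_timeDeriv (hS : 0 < S) (hψ : IsSolution α ε a b S ψ₀ ψ₁ ψ) {t : ℝ}
    (ht : t ∈ Set.Ioo 0 S) (l : ℤ) : HasDerivAt (fun t => fourierHat a b (timeDeriv S ψ t) l)
      (fourierHat a b (timeDeriv S (timeDeriv S ψ) t) l) t :=
  hasDerivAt_fourierHat hψ.continuous_t hψ.continuous_tt (fun _ hs x =>
    (hasDerivWithinAt_timeDeriv_timeDeriv hS hψ (Set.Ioo_subset_Icc_self hs) x).hasDerivAt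
      (Icc_mem_nhds hs.1 hs.2)) l ht

/-- By Vieta the equation takes the factored form `(d/dt - iβ⁺)(d/dt - iβ⁻) û = -(ε²/α) f̂`, in
which the characteristic components decouple. -/
theorem char_deriv_aux (hα : 0 < α) (hab : a < b) (hψ : IsSolution α ε a b S ψ₀ ψ₁ ψ) {t : ℝ}
    (ht : t ∈ Set.Ioo 0 S) (l : ℤ) :
    fourierHat a b (timeDeriv S (timeDeriv S ψ) t) l
      = Complex.I * (betaPlus α a b l + betaMinus α a b l) * fourierHat a b (timeDeriv S ψ t) l
        + betaPlus α a b l * betaMinus α a b l * fourierHat a b (ψ t) l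
        - (ε : ℂ) ^ 2 / α * fourierHat a b (fun x => cubic (ψ t x)) l := by
  have hα' : (α : ℂ) ≠ 0 := by exact_mod_cast hα.ne'
  have h1 := fourierHat_equation hab hψ ht l
  have h2 : (betaPlus α a b l : ℂ) + betaMinus α a b l = 1 / α := by
    exact_mod_cast congrArg (Complex.ofReal) (betaPlus_add_betaMinus (a := a) (b := b) hα l)
  have h3 : (betaPlus α a b l : ℂ) * betaMinus α a b l = -((freq a b l : ℂ) ^ 2 / α) := by
    exact_mod_cast congrArg (Complex.ofReal) (betaPlus_mul_betaMinus (a := a) (b := b) hα l)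
  rw [h2, h3]
  apply mul_left_cancel₀ hα'
  rw [h1]
  field_simp
  ring

theorem hasDerivAt_exPlus (hα : 0 < α) (hab : a < b) (hS : 0 < S)
    (hψ : IsSolution α ε a b S ψ₀ ψ₁ ψ) {t : ℝ} (ht : t ∈ Set.Ioo 0 S) (l : ℤ) :
    HasDerivAt (fun t => exPlus α a b S ψ t l) (Complex.I * betaPlus α a b l * exPlus α a b S ψ t l
      + kap α ε a b l * fourierHat a b (fun x => cubic (ψ t x)) l) t := by
  have h := ((hasDerivAt_hat_timeDeriv (a := a) (b := b) hS hψ ht l).sub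
    ((hasDerivAt_hat hψ ht l).const_mul (Complex.I * betaMinus α a b l))).div_const
      (Complex.I * betaDiff α a b l)
  refine h.congr_deriv ?_
  have hb := I_mul_betaDiff_ne_zero (a := a) (b := b) hα l
  have hb' := right_ne_zero_of_mul hb
  have hα' : (α : ℂ) ≠ 0 := by exact_mod_cast hα.ne'
  have hI := Complex.I_ne_zero
  rw [char_deriv_aux hα hab hψ ht l, exPlus, charPlus, kap]
  field_simp
  linear_combination (α * fourierHat a b (ψ t) l * betaPlus α a b l * betaMinus α a b l
    - (ε : ℂ) ^ 2 * fourierHat a b (fun x => cubic (ψ t x)) l) * Complex.I_sq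

theorem hasDerivAt_exMinus (hα : 0 < α) (hab : a < b) (hS : 0 < S)
    (hψ : IsSolution α ε a b S ψ₀ ψ₁ ψ) {t : ℝ} (ht : t ∈ Set.Ioo 0 S) (l : ℤ) :
    HasDerivAt (fun t => exMinus α a b S ψ t l) (Complex.I * betaMinus α a b l * exMinus α a b S ψ t l
      + -kap α ε a b l * fourierHat a b (fun x => cubic (ψ t x)) l) t := by
  have h := (((hasDerivAt_hat_timeDeriv (a := a) (b := b) hS hψ ht l).sub
    ((hasDerivAt_hat hψ ht l).const_mul (Complex.I * betaPlus α a b l))).div_const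
      (Complex.I * betaDiff α a b l)).neg
  refine h.congr_deriv ?_
  have hb := I_mul_betaDiff_ne_zero (a := a) (b := b) hα l
  have hb' := right_ne_zero_of_mul hb
  have hα' : (α : ℂ) ≠ 0 := by exact_mod_cast hα.ne'
  have hI := Complex.I_ne_zero
  rw [char_deriv_aux hα hab hψ ht l, exMinus, charMinus, kap]
  field_simp
  linear_combination (-α * fourierHat a b (ψ t) l * betaPlus α a b l * betaMinus α a b l
    + (ε : ℂ) ^ 2 * fourierHat a b (fun x => cubic (ψ t x)) l) * Complex.I_sq

theorem exPlus_duhamel (hα : 0 < α) (hab : a < b) (hS : 0 < S)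
    (hψ : IsSolution α ε a b S ψ₀ ψ₁ ψ) (l : ℤ) {t τ : ℝ} (ht : 0 ≤ t) (hτ : 0 ≤ τ)
    (htτ : t + τ ≤ S) :
    exPlus α a b S ψ (t + τ) l = cis (betaPlus α a b l * τ) * exPlus α a b S ψ t l
      + kap α ε a b l * ∫ s in (0 : ℝ)..τ, cis (betaPlus α a b l * (τ - s))
        * fourierHat a b (fun x => cubic (ψ (t + s) x)) l := by
  have h1 := continuousOn_fourierHat (a := a) (b := b) hψ.continuous l
  have h2 := continuousOn_fourierHat (a := a) (b := b) hψ.continuous_t l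
  refine duhamel_formula (y := fun t => exPlus α a b S ψ t l)
    (F := fun t => fourierHat a b (fun x => cubic (ψ t x)) l) ?_
    (continuousOn_fourierHat (continuousOn_cubic_comp hψ) l)
    (fun t ht => hasDerivAt_exPlus hα hab hS hψ ht l) ht hτ htτ
  unfold exPlus charPlus
  fun_prop

theorem exMinus_duhamel (hα : 0 < α) (hab : a < b) (hS : 0 < S)
    (hψ : IsSolution α ε a b S ψ₀ ψ₁ ψ) (l : ℤ) {t τ : ℝ} (ht : 0 ≤ t) (hτ : 0 ≤ τ)
    (htτ : t + τ ≤ S) :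
    exMinus α a b S ψ (t + τ) l = cis (betaMinus α a b l * τ) * exMinus α a b S ψ t l
      + -kap α ε a b l * ∫ s in (0 : ℝ)..τ, cis (betaMinus α a b l * (τ - s))
        * fourierHat a b (fun x => cubic (ψ (t + s) x)) l := by
  have h1 := continuousOn_fourierHat (a := a) (b := b) hψ.continuous l
  have h2 := continuousOn_fourierHat (a := a) (b := b) hψ.continuous_t l
  refine duhamel_formula (y := fun t => exMinus α a b S ψ t l)
    (F := fun t => fourierHat a b (fun x => cubic (ψ t x)) l) ?_
    (continuousOn_fourierHat (continuousOn_cubic_comp hψ) l)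
    (fun t ht => hasDerivAt_exMinus hα hab hS hψ ht l) ht hτ htτ
  unfold exMinus charMinus
  fun_prop

end solution

/-! ### The cubic nonlinearity -/

/-- The derivative of the cubic nonlinearity at `v` in the direction `w`. -/
def dcubic (v w : ℂ) : ℂ := 2 * (‖v‖ : ℂ) ^ 2 * w + v ^ 2 * star w

theorem cubic_eq (v : ℂ) : cubic v = v * (v * star v) := by
  rw [cubic, ← Complex.mul_conj', Complex.star_def]; ring

theorem dcubic_eq (v w : ℂ) : dcubic v w = 2 * (v * star v) * w + v ^ 2 * star w := by
  rw [dcubic, ← Complex.mul_conj', Complex.star_def]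

theorem norm_cubic_sub_le {v w : ℂ} {R : ℝ} (hv : ‖v‖ ≤ R) (hw : ‖w‖ ≤ R) :
    ‖cubic v - cubic w‖ ≤ 3 * R ^ 2 * ‖v - w‖ := by
  have hR : 0 ≤ R := (norm_nonneg _).trans hv
  have h : cubic v - cubic w = (v - w) * (v + w) * star v + w ^ 2 * star (v - w) := by
    rw [cubic_eq, cubic_eq, star_sub]; ring
  have h1 : ‖v + w‖ ≤ 2 * R := (norm_add_le _ _).trans (by linarith)
  rw [h]
  refine (norm_add_le _ _).trans ?_
  rw [norm_mul, norm_mul, norm_mul, norm_star, norm_star, norm_pow]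
  have h2 : ‖v - w‖ * ‖v + w‖ * ‖v‖ ≤ ‖v - w‖ * (2 * R) * R := by gcongr
  have h3 : ‖w‖ ^ 2 * ‖v - w‖ ≤ R ^ 2 * ‖v - w‖ := by gcongr
  linarith

theorem norm_cubic_le {v : ℂ} {R : ℝ} (hv : ‖v‖ ≤ R) : ‖cubic v‖ ≤ R ^ 3 := by
  rw [cubic, norm_mul, norm_pow, Complex.norm_real, norm_norm, ← pow_succ]
  exact pow_le_pow_left₀ (norm_nonneg _) hv 3

theorem norm_dcubic_le {v w : ℂ} {R : ℝ} (hv : ‖v‖ ≤ R) : ‖dcubic v w‖ ≤ 3 * R ^ 2 * ‖w‖ := by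
  rw [dcubic_eq]
  refine (norm_add_le _ _).trans ?_
  have hR : 0 ≤ R := (norm_nonneg _).trans hv
  simp only [norm_mul, norm_star, norm_pow, Complex.norm_ofNat]
  have h2 : 2 * (‖v‖ * ‖v‖) * ‖w‖ ≤ 2 * (R * R) * ‖w‖ := by gcongr
  have h3 : ‖v‖ ^ 2 * ‖w‖ ≤ R ^ 2 * ‖w‖ := by gcongr
  linarith

/-- The estimate is asymmetric on purpose: only `w'` appears with its size. It is later used with
`w` the derivative of a truncated Fourier series, for which no pointwise bound is at hand. -/
theorem norm_dcubic_sub_le {v v' w w' : ℂ} {R : ℝ} (hv : ‖v‖ ≤ R) (hv' : ‖v'‖ ≤ R) :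
    ‖dcubic v w - dcubic v' w'‖ ≤ 3 * R ^ 2 * ‖w - w'‖ + 6 * R * ‖w'‖ * ‖v - v'‖ := by
  have hR : 0 ≤ R := (norm_nonneg _).trans hv
  have h : dcubic v w - dcubic v' w' = dcubic v (w - w')
      + (2 * ((v - v') * star v + v' * star (v - v')) * w' + (v - v') * (v + v') * star w') := by
    simp only [dcubic_eq, star_sub]; ring
  have h1 : ‖v + v'‖ ≤ 2 * R := (norm_add_le _ _).trans (by linarith)
  have h2 : ‖(v - v') * star v + v' * star (v - v')‖ ≤ 2 * R * ‖v - v'‖ := by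
    refine (norm_add_le _ _).trans ?_
    rw [norm_mul, norm_mul, norm_star, norm_star]
    have e1 : ‖v - v'‖ * ‖v‖ ≤ ‖v - v'‖ * R := by gcongr
    have e2 : ‖v'‖ * ‖v - v'‖ ≤ R * ‖v - v'‖ := by gcongr
    linarith
  rw [h]
  refine (norm_add_le _ _).trans (add_le_add (norm_dcubic_le hv) ((norm_add_le _ _).trans ?_))
  rw [norm_mul, norm_mul, norm_mul, norm_mul, norm_star, Complex.norm_ofNat]
  have h3 : 2 * ‖(v - v') * star v + v' * star (v - v')‖ * ‖w'‖
      ≤ 2 * (2 * R * ‖v - v'‖) * ‖w'‖ := by gcongr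
  have h4 : ‖v - v'‖ * ‖v + v'‖ * ‖w'‖ ≤ ‖v - v'‖ * (2 * R) * ‖w'‖ := by gcongr
  linarith

theorem continuous_dcubic {f g : ℝ → ℂ} (hf : Continuous f) (hg : Continuous g) :
    Continuous fun x => dcubic (f x) (g x) := by
  unfold dcubic; fun_prop

theorem hasDerivWithinAt_cubic {f : ℝ → ℂ} {f' : ℂ} {s : Set ℝ} {t : ℝ}
    (h : HasDerivWithinAt f f' s t) :
    HasDerivWithinAt (fun t => cubic (f t)) (dcubic (f t) f') s t := by
  simp only [cubic_eq]
  refine (h.mul (h.mul h.star)).congr_deriv ?_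
  simp only [Pi.mul_apply, dcubic_eq]
  ring

theorem hasDerivAt_cubic {f : ℝ → ℂ} {f' : ℂ} {t : ℝ} (h : HasDerivAt f f' t) :
    HasDerivAt (fun t => cubic (f t)) (dcubic (f t) f') t :=
  hasDerivWithinAt_univ.1 (hasDerivWithinAt_cubic h.hasDerivWithinAt)

/-! ### Regularity of the solution -/

/-- The bounds on the solution contained in the regularity assumption. -/
structure RegBound (a b S : ℝ) (m : ℕ) (K : ℝ) (ψ : ℝ → ℝ → ℂ) : Prop where
  norm_le : ∀ t ∈ Set.Icc 0 S, ∀ x, ‖ψ t x‖ ≤ K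
  norm_deriv_le : ∀ t ∈ Set.Icc 0 S, ∀ x, ‖spaceDeriv ψ t x‖ ≤ K
  sob_le : ∀ t ∈ Set.Icc 0 S, ∀ s, sob a b m s (fourierHat a b (ψ t)) ≤ K
  sob_t_le : ∀ t ∈ Set.Icc 0 S, ∀ s, sob a b 1 s (fourierHat a b (timeDeriv S ψ t)) ≤ K
  sob_tt_le : ∀ t ∈ Set.Icc 0 S, ∀ s,
    sob a b 1 s (fourierHat a b (timeDeriv S (timeDeriv S ψ) t)) ≤ K

theorem regBound_of_regularityNorm_le {a b S K : ℝ} {m : ℕ} {ψ : ℝ → ℝ → ℂ} (hK : 0 ≤ K)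
    (h : regularityNorm a b S m ψ ≤ ENNReal.ofReal K) : RegBound a b S m K ψ := by
  rw [regularityNorm] at h
  have h1 : ∀ t ∈ Set.Icc 0 S, lipNorm (ψ t) + sobolevNorm a b m (ψ t) ≤ ENNReal.ofReal K :=
    fun t ht => (le_iSup₂ (f := fun t _ => lipNorm (ψ t) + sobolevNorm a b m (ψ t)) t ht).trans
      (le_self_add.trans (le_self_add.trans h))
  have h2 : ∀ t ∈ Set.Icc 0 S, sobolevNorm a b 1 (timeDeriv S ψ t) ≤ ENNReal.ofReal K :=
    fun t ht => (le_iSup₂ (f := fun t _ => sobolevNorm a b 1 (timeDeriv S ψ t)) t ht).trans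
      (le_add_self.trans (le_self_add.trans h))
  have h3 : ∀ t ∈ Set.Icc 0 S,
      sobolevNorm a b 1 (timeDeriv S (timeDeriv S ψ) t) ≤ ENNReal.ofReal K :=
    fun t ht => (le_iSup₂ (f := fun t _ => sobolevNorm a b 1 (timeDeriv S (timeDeriv S ψ) t))
      t ht).trans (le_add_self.trans h)
  have h4 : ∀ z : ℂ, ‖z‖ₑ ≤ ENNReal.ofReal K → ‖z‖ ≤ K := fun z hz => by
    rwa [← ofReal_norm, ENNReal.ofReal_le_ofReal_iff hK] at hz
  refine ⟨fun t ht x => h4 _ ?_, fun t ht x => h4 _ ?_, fun t ht => ?_, fun t ht => ?_,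
    fun t ht => ?_⟩
  · exact (le_iSup (fun x => ‖ψ t x‖ₑ) x).trans (le_self_add.trans (le_self_add.trans (h1 t ht)))
  · exact (le_iSup (fun x => ‖deriv (ψ t) x‖ₑ) x).trans
      (le_add_self.trans (le_self_add.trans (h1 t ht)))
  · exact (sobolevNorm_le_iff hK).1 (le_add_self.trans (h1 t ht))
  · exact (sobolevNorm_le_iff hK).1 (h2 t ht)
  · exact (sobolevNorm_le_iff hK).1 (h3 t ht)

section estimates
variable {α ε a b S K : ℝ} {m : ℕ} {ψ₀ ψ₁ : ℝ → ℂ} {ψ : ℝ → ℝ → ℂ}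

/-- A common bound for the solution and its first derivatives and second time derivative. -/
def supC (a b K : ℝ) : ℝ := (1 + embC a b) * K

theorem le_supC (hK : 1 ≤ K) : K ≤ supC a b K := by
  have := embC_nonneg (a := a) (b := b)
  rw [supC]; nlinarith

theorem embC_mul_le_supC (hK : 1 ≤ K) : embC a b * K ≤ supC a b K := by
  rw [supC]; nlinarith

theorem norm_le_supC (hK : 1 ≤ K) (hr : RegBound a b S m K ψ) {t : ℝ} (ht : t ∈ Set.Icc 0 S)
    (x : ℝ) : ‖ψ t x‖ ≤ supC a b K := (hr.norm_le t ht x).trans (le_supC hK)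

theorem norm_timeDeriv_le (hab : a < b) (hK : 1 ≤ K) (hψ : IsSolution α ε a b S ψ₀ ψ₁ ψ)
    (hr : RegBound a b S m K ψ) {t : ℝ} (ht : t ∈ Set.Icc 0 S) (x : ℝ) :
    ‖timeDeriv S ψ t x‖ ≤ supC a b K :=
  (norm_le_embC_mul hab (continuous_of_continuousOn_prod hψ.continuous_t ht)
    (timeDeriv_periodic hψ.periodic ht) (hr.sob_t_le t ht) x).trans (embC_mul_le_supC hK)

theorem norm_timeDeriv_timeDeriv_le (hab : a < b) (hK : 1 ≤ K) (hψ : IsSolution α ε a b S ψ₀ ψ₁ ψ)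
    (hr : RegBound a b S m K ψ) {t : ℝ} (ht : t ∈ Set.Icc 0 S) (x : ℝ) :
    ‖timeDeriv S (timeDeriv S ψ) t x‖ ≤ supC a b K :=
  (norm_le_embC_mul hab (continuous_of_continuousOn_prod hψ.continuous_tt ht)
    (timeDeriv_periodic (fun _ hs => timeDeriv_periodic hψ.periodic hs) ht)
    (hr.sob_tt_le t ht) x).trans (embC_mul_le_supC hK)

theorem norm_sub_le_time (hab : a < b) (hK : 1 ≤ K) (hψ : IsSolution α ε a b S ψ₀ ψ₁ ψ)
    (hr : RegBound a b S m K ψ) {t t' : ℝ} (ht : t ∈ Set.Icc 0 S) (ht' : t' ∈ Set.Icc 0 S) (x : ℝ) :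
    ‖ψ t x - ψ t' x‖ ≤ supC a b K * |t - t'| :=
  (convex_Icc 0 S).norm_image_sub_le_of_norm_hasDerivWithin_le
    (fun _ hs => hasDerivWithinAt_timeDeriv hψ hs x)
    (fun _ hs => norm_timeDeriv_le hab hK hψ hr hs x) ht' ht

theorem norm_timeDeriv_sub_le_time (hab : a < b) (hK : 1 ≤ K) (hS : 0 < S)
    (hψ : IsSolution α ε a b S ψ₀ ψ₁ ψ) (hr : RegBound a b S m K ψ) {t t' : ℝ}
    (ht : t ∈ Set.Icc 0 S) (ht' : t' ∈ Set.Icc 0 S) (x : ℝ) :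
    ‖timeDeriv S ψ t x - timeDeriv S ψ t' x‖ ≤ supC a b K * |t - t'| :=
  (convex_Icc 0 S).norm_image_sub_le_of_norm_hasDerivWithin_le
    (fun _ hs => hasDerivWithinAt_timeDeriv_timeDeriv hS hψ hs x)
    (fun _ hs => norm_timeDeriv_timeDeriv_le hab hK hψ hr hs x) ht' ht

theorem norm_cubic_sub_le_time (hab : a < b) (hK : 1 ≤ K) (hψ : IsSolution α ε a b S ψ₀ ψ₁ ψ)
    (hr : RegBound a b S m K ψ) {t t' : ℝ} (ht : t ∈ Set.Icc 0 S) (ht' : t' ∈ Set.Icc 0 S) (x : ℝ) :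
    ‖cubic (ψ t x) - cubic (ψ t' x)‖ ≤ 3 * supC a b K ^ 3 * |t - t'| := by
  have h1 := norm_cubic_sub_le (norm_le_supC hK hr ht x) (norm_le_supC hK hr ht' x)
  have h2 := mul_le_mul_of_nonneg_left (norm_sub_le_time hab hK hψ hr ht ht' x)
    (show 0 ≤ 3 * supC a b K ^ 2 by positivity)
  linarith

theorem supC_pos (hK : 1 ≤ K) : 0 < supC a b K :=
  zero_lt_one.trans_le (hK.trans (le_supC hK))

theorem norm_dcubic_sub_le_time (hab : a < b) (hK : 1 ≤ K) (hS : 0 < S)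
    (hψ : IsSolution α ε a b S ψ₀ ψ₁ ψ) (hr : RegBound a b S m K ψ) {t t' : ℝ}
    (ht : t ∈ Set.Icc 0 S) (ht' : t' ∈ Set.Icc 0 S) (x : ℝ) :
    ‖dcubic (ψ t x) (timeDeriv S ψ t x) - dcubic (ψ t' x) (timeDeriv S ψ t' x)‖
      ≤ 9 * supC a b K ^ 3 * |t - t'| := by
  have hR := supC_pos (a := a) (b := b) hK
  have h0 := norm_dcubic_sub_le (w := timeDeriv S ψ t x) (w' := timeDeriv S ψ t' x)
    (norm_le_supC hK hr ht x) (norm_le_supC hK hr ht' x)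
  have h1 := norm_sub_le_time hab hK hψ hr ht ht' x
  have h2 := norm_timeDeriv_sub_le_time hab hK hS hψ hr ht ht' x
  have h3 := norm_timeDeriv_le hab hK hψ hr ht' x
  have h4 : 3 * supC a b K ^ 2 * ‖timeDeriv S ψ t x - timeDeriv S ψ t' x‖
      ≤ 3 * supC a b K ^ 2 * (supC a b K * |t - t'|) := by gcongr
  have h5 : 6 * supC a b K * ‖timeDeriv S ψ t' x‖ * ‖ψ t x - ψ t' x‖
      ≤ 6 * supC a b K * supC a b K * (supC a b K * |t - t'|) := by gcongr
  linarith

/-- The error of linear extrapolation of the nonlinearity. -/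
theorem norm_cubic_extrapolation_le (hab : a < b) (hK : 1 ≤ K) (hS : 0 < S)
    (hψ : IsSolution α ε a b S ψ₀ ψ₁ ψ) (hr : RegBound a b S m K ψ) {t τ s : ℝ} (hτ : 0 < τ)
    (ht : τ ≤ t) (hs : s ∈ Set.Icc 0 τ) (hts : t + s ≤ S) (x : ℝ) :
    ‖cubic (ψ (t + s) x) - cubic (ψ t x) - (s / τ : ℝ) * (cubic (ψ t x) - cubic (ψ (t - τ) x))‖
      ≤ 18 * supC a b K ^ 3 * τ ^ 2 := by
  have hR := supC_pos (a := a) (b := b) hK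
  have ht0 : t ∈ Set.Icc 0 S := ⟨hτ.le.trans ht, by linarith [hs.1]⟩
  have hsub : Set.Icc (t - τ) (t + s) ⊆ Set.Icc 0 S :=
    Set.Icc_subset_Icc (by linarith) hts
  set c := dcubic (ψ t x) (timeDeriv S ψ t x) with hc
  -- First-order Taylor estimate with the slope `c` frozen at the central time `t`: the mean value
  -- inequality is applied to `r ↦ f(ψ(r)) - r c`, whose derivative is `O(τ)` because the derivative
  -- of `f(ψ)` is Lipschitz in time.
  have key : ∀ p ∈ Set.Icc (t - τ) (t + s), ∀ q ∈ Set.Icc (t - τ) (t + s), |q - p| ≤ τ →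
      ‖cubic (ψ q x) - cubic (ψ p x) - (q - p : ℝ) * c‖ ≤ 9 * supC a b K ^ 3 * τ ^ 2 := by
    intro p hp q hq hpq
    have h1 := (convex_Icc (t - τ) (t + s)).norm_image_sub_le_of_norm_hasDerivWithin_le
      (f := fun r => cubic (ψ r x) - (r : ℂ) * c)
      (f' := fun r => dcubic (ψ r x) (timeDeriv S ψ r x) - c) (C := 9 * supC a b K ^ 3 * τ)
      (fun r hr' => by
        have e1 := (hasDerivWithinAt_cubic (hasDerivWithinAt_timeDeriv hψ (hsub hr') x)).mono hsub
        have e2 := ((Complex.ofRealCLM.hasDerivAt (x := r)).mul_const c).hasDerivWithinAt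
          (s := Set.Icc (t - τ) (t + s))
        refine (e1.sub e2).congr_deriv ?_
        simp)
      (fun r hr' => by
        refine (norm_dcubic_sub_le_time hab hK hS hψ hr (hsub hr') ht0 x).trans ?_
        have : |r - t| ≤ τ := abs_le.2 ⟨by linarith [hr'.1], by linarith [hr'.2, hs.2]⟩
        gcongr) hp hq
    have h2 : 9 * supC a b K ^ 3 * τ * ‖q - p‖ ≤ 9 * supC a b K ^ 3 * τ * τ := by
      rw [Real.norm_eq_abs]; gcongr
    refine le_trans (le_of_eq ?_) (h1.trans (h2.trans (le_of_eq (by ring))))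
    congr 1
    push_cast
    ring
  have hst : 0 ≤ s / τ := div_nonneg hs.1 hτ.le
  have hst1 : s / τ ≤ 1 := (div_le_one hτ).2 hs.2
  have k1 := key t ⟨by linarith, by linarith [hs.1]⟩ (t + s) ⟨by linarith [hs.1], le_rfl⟩
    (by rw [add_sub_cancel_left, abs_of_nonneg hs.1]; exact hs.2)
  have k2 := key (t - τ) ⟨le_rfl, by linarith [hs.1]⟩ t ⟨by linarith, by linarith [hs.1]⟩
    (by rw [sub_sub_cancel, abs_of_pos hτ])
  have hτ' : (τ : ℂ) ≠ 0 := by exact_mod_cast hτ.ne'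
  -- The linear parts `s c` and `(s/τ) τ c` cancel, leaving one Taylor remainder forward and at most
  -- one backward; hence `18 = 9 + 9`.
  have h3 : cubic (ψ (t + s) x) - cubic (ψ t x)
        - (s / τ : ℝ) * (cubic (ψ t x) - cubic (ψ (t - τ) x))
      = (cubic (ψ (t + s) x) - cubic (ψ t x) - (t + s - t : ℝ) * c)
        - (s / τ : ℝ) * (cubic (ψ t x) - cubic (ψ (t - τ) x) - (t - (t - τ) : ℝ) * c) := by
    push_cast
    field_simp
    ring
  rw [h3]
  refine (norm_sub_le _ _).trans ?_
  rw [norm_mul, Complex.norm_real, Real.norm_of_nonneg hst]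
  have h4 : s / τ * ‖cubic (ψ t x) - cubic (ψ (t - τ) x) - (t - (t - τ) : ℝ) * c‖
      ≤ 1 * (9 * supC a b K ^ 3 * τ ^ 2) := by gcongr
  linarith

/-! ### Spectral tails -/

/-- On frequencies with `h · wt ≥ 1`, each derivative given up is worth a factor `h`. -/
theorem sob_le_of_high {M : ℕ} {j k : ℕ} (hjk : j ≤ k) {s : Finset ℤ} (v : ℤ → ℂ)
    (hh : 0 ≤ meshSize a b M) (hs : ∀ p ∈ s, 1 ≤ meshSize a b M * wt a b p) :
    sob a b j s v ≤ meshSize a b M ^ (k - j) * sob a b k s v := by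
  refine l2_le_mul (pow_nonneg hh _) fun p hp => ?_
  rw [norm_wt_pow_mul, norm_wt_pow_mul]
  have h1 : 1 ≤ (meshSize a b M * wt a b p) ^ (k - j) := one_le_pow₀ (hs p hp)
  have h2 : wt a b p ^ k = wt a b p ^ (k - j) * wt a b p ^ j := by
    rw [← pow_add, Nat.sub_add_cancel hjk]
  rw [h2]
  have h3 : 0 ≤ wt a b p ^ j * ‖v p‖ := mul_nonneg (pow_nonneg (wt_pos p).le _) (norm_nonneg _)
  rw [mul_pow] at h1
  nlinarith

/-- The threshold `M/6` serves two ends: `6|p| ≥ M` still gives `h |μ_p| ≥ π/3 > 1`, while three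
frequencies below it add up to one inside the band. -/
theorem one_le_meshSize_mul_wt {M : ℕ} (hab : a < b) (hM : 0 < M) {p : ℤ}
    (h : (M : ℤ) ≤ 6 * |p|) : 1 ≤ meshSize a b M * wt a b p := by
  have hM' : (M : ℝ) ≤ 6 * |(p : ℝ)| := by exact_mod_cast h
  have h1 := pi_mul_le_freq (a := a) (b := b) hab hM (p := p) (k := 1) (q := 3) (by linarith)
  have h2 := mul_le_mul_of_nonneg_left (abs_freq_le_wt (a := a) (b := b) p)
    (meshSize_pos hab hM).le
  linarith [Real.pi_gt_three]

theorem le_of_notMem_modes {M : ℕ} (he : Even M) {p : ℤ} (hp : p ∉ modes M) : (M : ℤ) ≤ 2 * |p| := by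
  rw [mem_modes_iff he] at hp
  rcases abs_cases p with h | h <;> omega

theorem sob_tail_le {M : ℕ} (hab : a < b) (hM : 0 < M) (he : Even M) {j k : ℕ} (hjk : j ≤ k)
    {v : ℤ → ℂ} {s : Finset ℤ} (hs : ∀ p ∈ s, p ∉ modes M) :
    sob a b j s v ≤ meshSize a b M ^ (k - j) * sob a b k s v := by
  refine sob_le_of_high hjk v (meshSize_pos hab hM).le fun p hp => one_le_meshSize_mul_wt hab hM ?_
  have := le_of_notMem_modes he (hs p hp)
  have := abs_nonneg p
  omega

/-- Multiplication by `mode p` shifts frequencies by `p`, so bandwidths add under products. -/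
theorem fourierHat_trig_mul_eq_zero {ι : Type*} (I : Finset ι) (c : ι → ℂ) (φ : ι → ℤ) {u : ℝ → ℂ}
    (hu : Continuous u) {N A : ℤ} (hφ : ∀ i ∈ I, |φ i| ≤ N)
    (h : ∀ l, A < |l| → fourierHat a b u l = 0) (l : ℤ) (hl : A + N < |l|) :
    fourierHat a b (fun x => (∑ i ∈ I, c i * mode a b (φ i) x) * u x) l = 0 := by
  simp only [Finset.sum_mul, mul_assoc]
  rw [fourierHat_finset_sum I (u := fun i x => c i * (mode a b (φ i) x * u x))
    (fun i _ => by fun_prop)]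
  refine Finset.sum_eq_zero fun i hi => ?_
  rw [fourierHat_const_mul, fourierHat_mode_mul, h, mul_zero]
  have := hφ i hi
  have := abs_sub_abs_le_abs_sub l (φ i)
  linarith

theorem fourierHat_cubic_trig_eq_zero (hab : a < b) {N : ℤ} (c : ℤ → ℂ) (l : ℤ)
    (hl : 3 * N < |l|) :
    fourierHat a b (fun x => cubic (∑ p ∈ Finset.Icc (-N) N, c p * mode a b p x)) l = 0 := by
  have hI : ∀ p ∈ Finset.Icc (-N) N, |p| ≤ N := fun p hp => abs_le.2 (Finset.mem_Icc.1 hp)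
  have hI' : ∀ p ∈ Finset.Icc (-N) N, |-p| ≤ N := fun p hp => by rw [abs_neg]; exact hI p hp
  have h1 : ∀ x, cubic (∑ p ∈ Finset.Icc (-N) N, c p * mode a b p x)
      = (∑ p ∈ Finset.Icc (-N) N, c p * mode a b p x) *
        ((∑ p ∈ Finset.Icc (-N) N, star (c p) * mode a b (-p) x) *
          (∑ p ∈ Finset.Icc (-N) N, c p * mode a b p x)) := by
    intro x
    rw [cubic_eq, mul_comm _ (star _), star_sum]
    congr 2
    refine Finset.sum_congr rfl fun p _ => ?_
    rw [star_mul', show star (mode a b p x) = mode a b (-p) x from conj_mode p x]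
  simp only [h1]
  refine fourierHat_trig_mul_eq_zero _ c (fun p => p) (by fun_prop) hI (A := 2 * N)
    (fun l hl => ?_) l (by linarith)
  refine fourierHat_trig_mul_eq_zero _ (fun p => star (c p)) (fun p => -p) (by fun_prop) hI' (A := N)
    (fun l hl => ?_) l (by linarith)
  rw [fourierHat_trig hab, if_neg]
  exact fun h => absurd (hI l h) (not_le.2 hl)

theorem hasDerivAt_trig (s : Finset ℤ) (c : ℤ → ℂ) (x : ℝ) :
    HasDerivAt (fun x => ∑ p ∈ s, c p * mode a b p x)
      (∑ p ∈ s, c p * (Complex.I * freq a b p * mode a b p x)) x :=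
  HasDerivAt.fun_sum fun p _ => (hasDerivAt_mode p x).const_mul _

theorem trig_periodic (hab : a < b) (s : Finset ℤ) (c : ℤ → ℂ) :
    Function.Periodic (fun x => ∑ p ∈ s, c p * mode a b p x) (b - a) := fun x =>
  Finset.sum_congr rfl fun p _ => by rw [mode_periodic hab p x]

/-- The size matters little: the bound provides the absolute convergence needed to sample the
Fourier series of `f(ψ)` on the grid. -/
theorem sob_cubic_le (hab : a < b) (hK : 1 ≤ K) (hψ : IsSolution α ε a b S ψ₀ ψ₁ ψ)
    (hr : RegBound a b S m K ψ) {t : ℝ} (ht : t ∈ Set.Icc 0 S) (s : Finset ℤ) :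
    sob a b 1 s (fourierHat a b (fun x => cubic (ψ t x))) ≤ supC a b K ^ 3 + 3 * supC a b K ^ 3 := by
  have hR := supC_pos (a := a) (b := b) hK
  have hc := continuous_of_continuousOn_prod hψ.continuous ht
  have hc' := continuous_of_continuousOn_prod hψ.continuous_x ht
  have hd : ∀ x, HasDerivAt (fun x => cubic (ψ t x)) (dcubic (ψ t x) (spaceDeriv ψ t x)) x := fun x =>
    hasDerivAt_cubic (hasDerivAt_spaceDeriv hψ ht x)
  have hcd : Continuous fun x => dcubic (ψ t x) (spaceDeriv ψ t x) :=
    continuous_dcubic hc hc'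
  have hcp : Function.Periodic (fun x => cubic (ψ t x)) (b - a) := fun x => by
    simp only [hψ.periodic t ht x]
  refine sob_one_le_of_deriv hab hd hcd hcp
    (l2_fourierHat_le_of_bound hab (by fun_prop) (by positivity)
      fun x => norm_cubic_le (norm_le_supC hK hr ht x))
    (l2_fourierHat_le_of_bound hab hcd (by positivity) fun x => ?_) s
  refine (norm_dcubic_le (norm_le_supC hK hr ht x)).trans ?_
  have := (hr.norm_deriv_le t ht x).trans (le_supC (a := a) (b := b) hK)
  have h1 : 3 * supC a b K ^ 2 * ‖spaceDeriv ψ t x‖ ≤ 3 * supC a b K ^ 2 * supC a b K := by gcongr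
  linarith

/-- Truncating `ψ` below `M/6` gives `v` with `f(v)` band-limited below `M/2`, so on the tail `f(ψ)`
and `f(ψ) - f(v)` have the same coefficients. The latter is small in `H¹` by Lipschitz estimates,
and no `H^m` bound for `f(ψ)` is needed. -/
theorem sob_cubic_tail_le {M : ℕ} (hab : a < b) (hM : 0 < M) (he : Even M) (hm : 1 ≤ m) (hK : 1 ≤ K)
    (hψ : IsSolution α ε a b S ψ₀ ψ₁ ψ) (hr : RegBound a b S m K ψ) {t : ℝ} (ht : t ∈ Set.Icc 0 S)
    {s : Finset ℤ} (hs : ∀ p ∈ s, p ∉ modes M) :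
    sob a b 1 s (fourierHat a b (fun x => cubic (ψ t x)))
      ≤ 24 * supC a b K ^ 3 * meshSize a b M ^ (m - 1) := by
  have hR := supC_pos (a := a) (b := b) hK
  have hh := (meshSize_pos hab hM).le
  have hc := continuous_of_continuousOn_prod hψ.continuous ht
  have hc' := continuous_of_continuousOn_prod hψ.continuous_x ht
  -- `N` is the largest integer strictly below `M/6`: products of three modes up to `N` stay below
  -- `M/2`, and every frequency beyond `N` is already high.
  obtain ⟨N, hN1, hN2⟩ : ∃ N : ℤ, 6 * N < M ∧ (M : ℤ) ≤ 6 * (N + 1) :=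
    ⟨((M : ℤ) - 1) / 6, by omega, by omega⟩
  have hN0 : ∀ p : ℤ, p ∉ Finset.Icc (-N) N → (M : ℤ) ≤ 6 * |p| := by
    intro p hp
    rw [Finset.mem_Icc] at hp
    rcases abs_cases p with h | h <;> omega
  set I := Finset.Icc (-N) N
  set û := fourierHat a b (ψ t) with hû
  set v : ℝ → ℂ := fun x => ∑ p ∈ I, û p * mode a b p x with hv
  set v' : ℝ → ℂ := fun x => ∑ p ∈ I, û p * (Complex.I * freq a b p * mode a b p x) with hv'
  have hvc : Continuous v := by fun_prop
  have hvc' : Continuous v' := by fun_prop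
  have hvd : ∀ x, HasDerivAt v (v' x) x := fun x => hasDerivAt_trig I û x
  have hvp : Function.Periodic v (b - a) := trig_periodic hab I û
  have hH1 : ∀ s, sob a b 1 s û ≤ K := fun s => (sob_mono hm s û).trans (hr.sob_le t ht s)
  have hvR : ∀ x, ‖v x‖ ≤ supC a b K := fun x => by
    refine (norm_sum_le _ _).trans ?_
    simp only [norm_mul, norm_mode, mul_one]
    exact (sum_norm_le_embC hab I û).trans ((mul_le_mul_of_nonneg_left (hH1 I)
      embC_nonneg).trans (embC_mul_le_supC hK))
  set δ := meshSize a b M ^ (m - 1) * K with hδ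
  have hd : ∀ s, sob a b 1 s (fourierHat a b (fun x => ψ t x - v x)) ≤ δ := by
    intro s
    have e1 : sob a b 1 s (fourierHat a b (fun x => ψ t x - v x))
        ≤ sob a b 1 (s.filter fun p => p ∉ I) û := by
      refine Real.sqrt_le_sqrt (le_of_eq ?_)
      rw [Finset.sum_filter]
      refine Finset.sum_congr rfl fun p _ => ?_
      have e2 : fourierHat a b (fun x => ψ t x - v x) p = if p ∈ I then 0 else û p := by
        rw [fourierHat_sub hc hvc, show fourierHat a b v p = _ from fourierHat_trig hab I û p]
        split_ifs <;> simp [hû]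
      simp only [e2]
      by_cases hp : p ∈ I <;> simp [hp]
    refine e1.trans ((sob_le_of_high hm û hh fun p hp => one_le_meshSize_mul_wt hab hM
      (hN0 p (Finset.mem_filter.1 hp).2)).trans ?_)
    exact mul_le_mul_of_nonneg_left (hr.sob_le t ht _) (pow_nonneg hh _)
  have hdd : ∀ x, HasDerivAt (fun x => ψ t x - v x) (spaceDeriv ψ t x - v' x) x := fun x =>
    (hasDerivAt_spaceDeriv hψ ht x).sub (hvd x)
  have hd0 : ∀ s, l2 s (fourierHat a b (fun x => ψ t x - v x)) ≤ δ := fun s =>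
    (l2_le_sob 1 s _).trans (hd s)
  have hd1 : ∀ s, l2 s (fourierHat a b (fun x => spaceDeriv ψ t x - v' x)) ≤ δ := fun s =>
    (l2_fourierHat_deriv_le hab hdd (hc'.sub hvc') ((hψ.periodic t ht).sub hvp) s).trans (hd s)
  have hWd : ∀ x, HasDerivAt (fun x => cubic (v x) - cubic (ψ t x))
      (dcubic (v x) (v' x) - dcubic (ψ t x) (spaceDeriv ψ t x)) x := fun x =>
    (hasDerivAt_cubic (hvd x)).sub (hasDerivAt_cubic (hasDerivAt_spaceDeriv hψ ht x))
  have hWc : Continuous fun x => dcubic (v x) (v' x) - dcubic (ψ t x) (spaceDeriv ψ t x) :=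
    (continuous_dcubic hvc hvc').sub (continuous_dcubic hc hc')
  have hW0 := l2_fourierHat_le_of_norm_le hab (u := fun x => ψ t x - v x) (v := fun x => ψ t x - v x)
    (w := fun x => cubic (v x) - cubic (ψ t x)) (by fun_prop) (by fun_prop) (by fun_prop)
    (p := 3 * supC a b K ^ 2) (q := 0) (by positivity) le_rfl
    (fun x => by
      have := norm_cubic_sub_le (hvR x) (norm_le_supC hK hr ht x)
      rw [norm_sub_rev (v x)] at this
      linarith) hd0 hd0
  -- The pointwise bound falls on the derivative of `ψ`, which assumption (A) provides; `v'` enters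
  -- only through its `L²` distance to it.
  have hW1 := l2_fourierHat_le_of_norm_le hab (u := fun x => spaceDeriv ψ t x - v' x)
    (v := fun x => ψ t x - v x)
    (w := fun x => dcubic (v x) (v' x) - dcubic (ψ t x) (spaceDeriv ψ t x))
    (by fun_prop) (by fun_prop) hWc (p := 3 * supC a b K ^ 2) (q := 6 * supC a b K ^ 2)
    (by positivity) (by positivity)
    (fun x => by
      have e1 := norm_dcubic_sub_le (w := v' x) (w' := spaceDeriv ψ t x)
        (hvR x) (norm_le_supC hK hr ht x)
      rw [norm_sub_rev (v x), norm_sub_rev (v' x)] at e1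
      have e2 := (hr.norm_deriv_le t ht x).trans (le_supC (a := a) (b := b) hK)
      have e3 : 6 * supC a b K * ‖spaceDeriv ψ t x‖ * ‖ψ t x - v x‖
        ≤ 6 * supC a b K * supC a b K * ‖ψ t x - v x‖ := by gcongr
      linarith) hd1 hd0
  have hWp : Function.Periodic (fun x => cubic (v x) - cubic (ψ t x)) (b - a) := fun x => by
    simp only [hvp x, hψ.periodic t ht x]
  have hW := sob_one_le_of_deriv hab hWd hWc hWp hW0 hW1 s
  -- Outside the band `f(v)` has no Fourier coefficients, so subtracting it changes nothing there.
  have heq : sob a b 1 s (fourierHat a b (fun x => cubic (ψ t x)))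
      = sob a b 1 s (fourierHat a b (fun x => cubic (v x) - cubic (ψ t x))) := by
    refine l2_congr fun p hp => ?_
    rw [norm_wt_pow_mul, norm_wt_pow_mul, fourierHat_sub (by fun_prop) (by fun_prop),
      fourierHat_cubic_trig_eq_zero hab û p, zero_sub, norm_neg]
    have := le_of_notMem_modes he (hs p hp)
    omega
  rw [heq]
  refine hW.trans ?_
  have h5 : δ ≤ meshSize a b M ^ (m - 1) * supC a b K :=
    mul_le_mul_of_nonneg_left (le_supC hK) (pow_nonneg hh _)
  have h6 := mul_le_mul_of_nonneg_left h5 (show 0 ≤ 24 * supC a b K ^ 2 by positivity)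
  linarith

end estimates

/-! ### Smoothing by the Duhamel term. -/

section duhamelBounds
variable {α ε a b : ℝ}

/-- The difference of the exponents grows like `|μ_l|`, which is the source of the gained
derivative. With `α ≤ 1` the constant is 1, and in particular `β_l ≥ 1` for every `l`. -/
theorem wt_le_betaDiff (hα : 0 < α) (hα₁ : α ≤ 1) (l : ℤ) : wt a b l ≤ betaDiff α a b l := by
  refine abs_le_of_sq_le_sq' ?_ (betaDiff_pos hα l).le |>.2
  rw [wt_sq, betaDiff_eq hα, div_pow, disc_sq hα, le_div_iff₀ (by positivity)]
  nlinarith [sq_nonneg (freq a b l), mul_nonneg hα.le (sq_nonneg (freq a b l)),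
    mul_nonneg (mul_nonneg hα.le (sub_nonneg.2 hα₁)) (sq_nonneg (freq a b l))]

theorem betaDiff_le (hα : 0 < α) (hα₁ : α ≤ 1) (l : ℤ) : betaDiff α a b l ≤ 2 / α * wt a b l := by
  have h : disc α a b l ≤ 2 * wt a b l := by
    refine abs_le_of_sq_le_sq' ?_ (by linarith [one_le_wt (a := a) (b := b) l]) |>.2
    rw [mul_pow, wt_sq, disc_sq hα]
    nlinarith [mul_nonneg (sub_nonneg.2 hα₁) (sq_nonneg (freq a b l))]
  rw [betaDiff_eq hα, div_mul_eq_mul_div]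
  gcongr

theorem norm_kap_mul_wt_le (hα : 0 < α) (hα₁ : α ≤ 1) (l : ℤ) :
    ‖kap α ε a b l‖ * wt a b l ≤ ε ^ 2 / α := by
  have hb := betaDiff_pos (a := a) (b := b) hα l
  have h : ‖kap α ε a b l‖ = ε ^ 2 / (α * betaDiff α a b l) := by
    rw [kap, norm_div, norm_mul, norm_mul, Complex.norm_I, norm_pow, Complex.norm_real,
      Complex.norm_real, Complex.norm_real, Real.norm_of_nonneg hα.le, Real.norm_of_nonneg hb.le,
      Real.norm_eq_abs, sq_abs, one_mul]
  rw [h, div_mul_eq_mul_div, div_le_div_iff₀ (by positivity) hα]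
  have := wt_le_betaDiff (a := a) (b := b) hα hα₁ l
  have h2 : 0 ≤ ε ^ 2 * α := by positivity
  nlinarith

/-- The bound on the inhomogeneous part of the variation-of-constants formula; one derivative is
gained. -/
theorem sob_kap_integral_le (hα : 0 < α) (hα₁ : α ≤ 1) (k : ℕ) (s : Finset ℤ) (β : ℤ → ℝ)
    {V : ℝ → ℤ → ℂ} {τ ρ : ℝ} (hτ : 0 ≤ τ)
    (hV : ∀ l ∈ s, ContinuousOn (fun t => V t l) (Set.Icc 0 τ))
    (hρ : ∀ t ∈ Set.Icc 0 τ, sob a b k s (V t) ≤ ρ) :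
    sob a b (k + 1) s (fun l => kap α ε a b l * ∫ t in (0 : ℝ)..τ, cis (β l * (τ - t)) * V t l)
      ≤ ε ^ 2 / α * (τ * ρ) := by
  have h1 : sob a b (k + 1) s
      (fun l => kap α ε a b l * ∫ t in (0 : ℝ)..τ, cis (β l * (τ - t)) * V t l)
      ≤ ε ^ 2 / α * l2 s (fun l => ∫ t in (0 : ℝ)..τ, (wt a b l : ℂ) ^ k * (cis (β l * (τ - t)) * V t l)) := by
    refine l2_le_mul (by positivity) fun l _ => ?_
    rw [intervalIntegral.integral_const_mul, norm_wt_pow_mul, norm_wt_pow_mul, norm_mul, pow_succ]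
    have := norm_kap_mul_wt_le (ε := ε) (a := a) (b := b) hα hα₁ l
    set X := wt a b l ^ k * ‖∫ t in (0 : ℝ)..τ, cis (β l * (τ - t)) * V t l‖ with hX
    have hX0 : 0 ≤ X := mul_nonneg (pow_nonneg (wt_pos l).le _) (norm_nonneg _)
    calc wt a b l ^ k * wt a b l * (‖kap α ε a b l‖ * ‖∫ t in (0 : ℝ)..τ, cis (β l * (τ - t)) * V t l‖)
        = ‖kap α ε a b l‖ * wt a b l * X := by rw [hX]; ring
      _ ≤ ε ^ 2 / α * X := mul_le_mul_of_nonneg_right this hX0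
  refine h1.trans (mul_le_mul_of_nonneg_left ?_ (by positivity))
  have h2 := l2_intervalIntegral_le s (p := 0) (q := τ) (ρ := ρ)
    (V := fun t l => (wt a b l : ℂ) ^ k * (cis (β l * (τ - t)) * V t l)) hτ
    (fun l hl => by
      refine ContinuousOn.intervalIntegrable_of_Icc hτ ?_
      have hc : Continuous fun t : ℝ => cis (β l * (τ - t)) := by fun_prop
      exact continuousOn_const.mul (hc.continuousOn.mul (hV l hl)))
    (fun t ht => by
      refine le_trans (le_of_eq (l2_congr fun l _ => ?_)) (hρ t ht)
      rw [norm_wt_pow_mul, norm_wt_pow_mul, norm_mul, norm_cis, one_mul])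
  rwa [sub_zero] at h2

end duhamelBounds

/-! ### Decay of the high frequencies of the initial velocity. -/

/-- Compactness gives a positive minimum of `1 - sin x / x` on `[T, T + 2]`, and beyond that `sin x
≤ 1 ≤ x/2`. It is applied at `x = β_l T ≥ T`, so one constant serves all frequencies. -/
theorem exists_sin_le (T : ℝ) (hT : 0 < T) : ∃ c > 0, ∀ x, T ≤ x → c * x ≤ x - Real.sin x := by
  have hcont : ContinuousOn (fun x => 1 - Real.sin x / x) (Set.Icc T (T + 2)) := by
    refine continuousOn_const.sub (Real.continuous_sin.continuousOn.div continuousOn_id fun x hx => ?_)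
    exact (hT.trans_le hx.1).ne'
  obtain ⟨x₀, hx₀, hmin⟩ := isCompact_Icc.exists_isMinOn ⟨T, le_rfl, by linarith⟩ hcont
  have hx₀pos : 0 < x₀ := hT.trans_le hx₀.1
  have hpos : 0 < 1 - Real.sin x₀ / x₀ := by
    rw [sub_pos, div_lt_one hx₀pos]
    exact Real.sin_lt hx₀pos
  refine ⟨min (1 - Real.sin x₀ / x₀) (1 / 2), lt_min hpos (by norm_num), fun x hx => ?_⟩
  have hx0 : 0 < x := hT.trans_le hx
  rcases le_total x (T + 2) with h | h
  · have h1 : 1 - Real.sin x₀ / x₀ ≤ 1 - Real.sin x / x := hmin ⟨hx, h⟩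
    have h2 := mul_le_mul_of_nonneg_right ((min_le_left _ (1 / 2)).trans h1) hx0.le
    rwa [sub_mul, one_mul, div_mul_cancel₀ _ hx0.ne'] at h2
  · have h1 := mul_le_mul_of_nonneg_right (min_le_right (1 - Real.sin x₀ / x₀) (1 / 2)) hx0.le
    linarith [Real.sin_le_one x]

theorem integral_two_sub_two_cos {β : ℝ} (hβ : β ≠ 0) (T : ℝ) :
    ∫ t in (0 : ℝ)..T, (2 - 2 * Real.cos (β * t)) = 2 / β * (β * T - Real.sin (β * T)) := by
  have h : ∀ t, HasDerivAt (fun t => 2 / β * (β * t - Real.sin (β * t)))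
      (2 - 2 * Real.cos (β * t)) t := by
    intro t
    have h1 : HasDerivAt (fun t => β * t) β t := by simpa using (hasDerivAt_id t).const_mul β
    refine ((h1.sub h1.sin).const_mul (2 / β)).congr_deriv ?_
    field_simp
  rw [intervalIntegral.integral_eq_sub_of_hasDerivAt (fun t _ => h t)
    (Continuous.intervalIntegrable (by fun_prop) _ _)]
  simp

theorem norm_cis_sub_cis_sq (x y : ℝ) : ‖cis x - cis y‖ ^ 2 = 2 - 2 * Real.cos (x - y) := by
  have h : ∀ x, cis x = ⟨Real.cos x, Real.sin x⟩ := fun x => by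
    rw [cis, mul_comm, Complex.exp_mul_I]
    apply Complex.ext <;> simp [← Complex.ofReal_cos, ← Complex.ofReal_sin]
  rw [h, h, Complex.sq_norm, Complex.normSq_apply, Real.cos_sub]
  simp only [Complex.sub_re, Complex.sub_im]
  nlinarith [Real.sin_sq_add_cos_sq x, Real.sin_sq_add_cos_sq y]

section initialVelocity
variable {α ε a b S K : ℝ} {m : ℕ} {ψ₀ ψ₁ : ℝ → ℂ} {ψ : ℝ → ℝ → ℂ}

theorem sob_add_le (k : ℕ) (s : Finset ℤ) (v w : ℤ → ℂ) :
    sob a b k s (fun l => v l + w l) ≤ sob a b k s v + sob a b k s w := by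
  simp only [sob, mul_add]
  exact l2_add_le _ _ _

theorem sob_sub_le (k : ℕ) (s : Finset ℤ) (v w : ℤ → ℂ) :
    sob a b k s (fun l => v l - w l) ≤ sob a b k s v + sob a b k s w := by
  simp only [sob, mul_sub]
  exact l2_sub_le _ _ _

theorem sob_congr (k : ℕ) {s : Finset ℤ} {v w : ℤ → ℂ} (h : ∀ l ∈ s, ‖v l‖ = ‖w l‖) :
    sob a b k s v = sob a b k s w :=
  l2_congr fun l hl => by rw [norm_wt_pow_mul, norm_wt_pow_mul, h l hl]

/-- A component is controlled by the time average of the size of its contribution to the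
oscillation of the solution. -/
theorem sob_le_of_oscillation (hα : 0 < α) (hα₁ : α ≤ 1) {T c Q : ℝ} (hT : 0 < T) (hc : 0 < c)
    (hcT : ∀ x, T ≤ x → c * x ≤ x - Real.sin x) (k : ℕ) (s : Finset ℤ) (y : ℤ → ℂ)
    (hQ : 0 ≤ Q)
    (h : ∀ t ∈ Set.Icc 0 T, sob a b k s (fun l =>
      y l * (cis (betaPlus α a b l * t) - cis (betaMinus α a b l * t))) ≤ Q) :
    sob a b k s y ≤ Q / Real.sqrt (2 * c) := by
  have h1 : ∀ t ∈ Set.Icc 0 T,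
      ∑ l ∈ s, (wt a b l ^ k * ‖y l‖) ^ 2 * (2 - 2 * Real.cos (betaDiff α a b l * t)) ≤ Q ^ 2 := by
    intro t ht
    have h2 := (sob_le_iff hQ).1 (h t ht)
    refine le_trans (le_of_eq (Finset.sum_congr rfl fun l _ => ?_)) h2
    rw [norm_mul, mul_pow ‖y l‖, norm_cis_sub_cis_sq, ← sub_mul, ← wt_sq, betaDiff]
    ring
  have h2 : ∫ t in (0 : ℝ)..T, ∑ l ∈ s, (wt a b l ^ k * ‖y l‖) ^ 2
      * (2 - 2 * Real.cos (betaDiff α a b l * t)) ≤ ∫ _t in (0 : ℝ)..T, Q ^ 2 :=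
    intervalIntegral.integral_mono_on hT.le (Continuous.intervalIntegrable (by fun_prop) _ _)
      (Continuous.intervalIntegrable (by fun_prop) _ _) h1
  rw [intervalIntegral.integral_finsetSum
    (fun l _ => Continuous.intervalIntegrable (by fun_prop) _ _), intervalIntegral.integral_const,
    sub_zero, smul_eq_mul] at h2
  simp only [intervalIntegral.integral_const_mul] at h2
  -- The time integral of `|e^{iβ⁺t} - e^{iβ⁻t}|²` equals `(2/β_l)(β_l T - sin(β_l T))`, at least
  -- `2cT` uniformly in `l` because `β_l ≥ 1`.
  have h3 : ∑ l ∈ s, (wt a b l ^ k * ‖y l‖) ^ 2 * (2 * c * T) ≤ T * Q ^ 2 := by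
    refine le_trans (Finset.sum_le_sum fun l _ => mul_le_mul_of_nonneg_left ?_ (sq_nonneg _)) h2
    have hb := betaDiff_pos (a := a) (b := b) hα l
    rw [integral_two_sub_two_cos hb.ne']
    have hb1 : 1 ≤ betaDiff α a b l := (one_le_wt l).trans (wt_le_betaDiff hα hα₁ l)
    have := hcT (betaDiff α a b l * T) (le_mul_of_one_le_left hT.le hb1)
    have h4 := mul_le_mul_of_nonneg_left this (show 0 ≤ 2 / betaDiff α a b l by positivity)
    refine le_trans (le_of_eq ?_) h4
    field_simp
  rw [← Finset.sum_mul] at h3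
  have h5 : ∑ l ∈ s, (wt a b l ^ k * ‖y l‖) ^ 2 = sob a b k s y ^ 2 := by
    rw [sob, l2_sq]; exact Finset.sum_congr rfl fun l _ => by rw [norm_wt_pow_mul]
  rw [h5] at h3
  have h6 : sob a b k s y ^ 2 * (2 * c) ≤ Q ^ 2 := by
    refine le_of_mul_le_mul_left ?_ hT
    linarith
  have hs : 0 < Real.sqrt (2 * c) := Real.sqrt_pos.2 (by positivity)
  rw [le_div_iff₀ hs]
  refine abs_le_of_sq_le_sq' ?_ hQ |>.2
  rw [mul_pow, Real.sq_sqrt (by positivity)]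
  exact h6

theorem continuousOn_hat_cubic_add (hψ : IsSolution α ε a b S ψ₀ ψ₁ ψ) {t τ : ℝ} (ht : 0 ≤ t)
    (htτ : t + τ ≤ S) (l : ℤ) :
    ContinuousOn (fun s => fourierHat a b (fun x => cubic (ψ (t + s) x)) l) (Set.Icc 0 τ) := by
  have h1 : ContinuousOn (fun s => fourierHat a b (fun x => cubic (ψ s x)) l) (Set.Icc 0 S) :=
    continuousOn_fourierHat (G := fun s x => cubic (ψ s x)) (continuousOn_cubic_comp hψ) l
  have h2 : ContinuousOn (fun s => t + s) (Set.Icc 0 τ) := by fun_prop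
  exact ContinuousOn.comp (g := fun s => fourierHat a b (fun x => cubic (ψ s x)) l) h1 h2
    fun s hs => ⟨add_nonneg ht hs.1, by linarith [hs.2]⟩

/-- The high frequencies of the initial velocity. -/
theorem exists_sob_velocity_tail_le (hα : 0 < α) (hα₁ : α ≤ 1) (hab : a < b) {T : ℝ} (hT : 0 < T)
    (hm : 2 ≤ m) (hK : 1 ≤ K) : ∃ C, 0 ≤ C ∧ ∀ (ε S : ℝ) (ψ₀ ψ₁ : ℝ → ℂ) (ψ : ℝ → ℝ → ℂ) (M : ℕ),
      0 < ε → ε ≤ 1 → T ≤ S → IsSolution α ε a b S ψ₀ ψ₁ ψ → RegBound a b S m K ψ →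
      0 < M → Even M → meshSize a b M ≤ 1 → ∀ s : Finset ℤ, (∀ p ∈ s, p ∉ modes M) →
      sob a b 1 s (fourierHat a b ψ₁) ≤ C * meshSize a b M ^ (m - 2) := by
  obtain ⟨c, hc, hcT⟩ := exists_sin_le T hT
  have hR := supC_pos (a := a) (b := b) hK
  set P : ℝ := 2 * K + 2 * (1 / α * (T * (24 * supC a b K ^ 3))) with hP
  have hP0 : 0 ≤ P := by positivity
  refine ⟨2 / α * (P / Real.sqrt (2 * c) + K), by positivity, ?_⟩
  intro ε S ψ₀ ψ₁ ψ M hε hε₁ hTS hψ hr hM he hh1 s hs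
  have hS : 0 < S := hT.trans_le hTS
  have hh := (meshSize_pos hab hM).le
  set h := meshSize a b M with hh_def
  have hmono : h ^ (m - 1) ≤ h ^ (m - 2) := pow_le_pow_of_le_one hh hh1 (by omega)
  have hu : ∀ t ∈ Set.Icc 0 S, sob a b 2 s (fourierHat a b (ψ t)) ≤ h ^ (m - 2) * K := fun t ht =>
    (sob_tail_le hab hM he hm hs).trans
      (mul_le_mul_of_nonneg_left (hr.sob_le t ht s) (pow_nonneg hh _))
  have h0 : (0 : ℝ) ∈ Set.Icc 0 S := ⟨le_rfl, hS.le⟩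
  set y := fun l => exPlus α a b S ψ 0 l with hy
  -- Only times up to the fixed `T`, not up to `S`, are used; this keeps the constant independent of
  -- `ε` and `β`.
  have hD : ∀ β : ℤ → ℝ, ∀ t ∈ Set.Icc 0 T, sob a b 2 s (fun l => kap α ε a b l *
      ∫ r in (0 : ℝ)..t, cis (β l * (t - r)) * fourierHat a b (fun x => cubic (ψ (0 + r) x)) l)
      ≤ 1 / α * (T * (24 * supC a b K ^ 3 * h ^ (m - 2))) := by
    intro β t ht
    have h1 := sob_kap_integral_le (ε := ε) (a := a) (b := b) hα hα₁ 1 s β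
      (V := fun r l => fourierHat a b (fun x => cubic (ψ (0 + r) x)) l) ht.1
      (ρ := 24 * supC a b K ^ 3 * h ^ (m - 2))
      (fun l _ => continuousOn_hat_cubic_add hψ le_rfl (by linarith [ht.2]) l)
      (fun r hr' => by
        refine (sob_cubic_tail_le hab hM he (by omega) hK hψ hr
          ⟨by linarith [hr'.1], by linarith [hr'.2, ht.2]⟩ hs).trans ?_
        exact mul_le_mul_of_nonneg_left hmono (by positivity))
    refine h1.trans ?_
    have e1 : ε ^ 2 ≤ 1 := pow_le_one₀ hε.le hε₁
    have e2 := ht.2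
    have e3 := ht.1
    gcongr
  -- Subtracting `e^{iβ⁻t} û(0)` from `û(t)` removes the initial minus component and leaves `y
  -- (e^{iβ⁺t} - e^{iβ⁻t})` plus Duhamel terms. Everything else in the identity has an `H²` tail of
  -- order `h^{m-2}`.
  have hQ : ∀ t ∈ Set.Icc 0 T, sob a b 2 s (fun l =>
      y l * (cis (betaPlus α a b l * t) - cis (betaMinus α a b l * t))) ≤ P * h ^ (m - 2) := by
    intro t ht
    have htS : 0 + t ≤ S := by linarith [ht.2]
    have h1 : ∀ l, y l * (cis (betaPlus α a b l * t) - cis (betaMinus α a b l * t))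
        = (fourierHat a b (ψ t) l - cis (betaMinus α a b l * t) * fourierHat a b (ψ 0) l)
          - (kap α ε a b l * (∫ r in (0 : ℝ)..t, cis (betaPlus α a b l * (t - r))
              * fourierHat a b (fun x => cubic (ψ (0 + r) x)) l)
            - kap α ε a b l * ∫ r in (0 : ℝ)..t, cis (betaMinus α a b l * (t - r))
              * fourierHat a b (fun x => cubic (ψ (0 + r) x)) l) := by
      intro l
      have e1 := exPlus_duhamel hα hab hS hψ l le_rfl ht.1 htS
      have e2 := exMinus_duhamel hα hab hS hψ l le_rfl ht.1 htS
      have e3 := exPlus_add_exMinus (a := a) (b := b) (S := S) (ψ := ψ) hα (0 + t) l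
      have e4 := exPlus_add_exMinus (a := a) (b := b) (S := S) (ψ := ψ) hα 0 l
      rw [e1, e2] at e3
      rw [zero_add] at e3
      rw [← e3, ← e4]
      ring
    simp only [h1]
    refine (sob_sub_le _ _ _ _).trans ?_
    have e1 := sob_sub_le (a := a) (b := b) 2 s (fourierHat a b (ψ t))
      (fun l => cis (betaMinus α a b l * t) * fourierHat a b (ψ 0) l)
    have e2 : sob a b 2 s (fun l => cis (betaMinus α a b l * t) * fourierHat a b (ψ 0) l)
        = sob a b 2 s (fourierHat a b (ψ 0)) :=
      sob_congr 2 fun l _ => by rw [norm_mul, norm_cis, one_mul]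
    have e3 := hu t ⟨ht.1, by linarith [ht.2]⟩
    have e4 := hu 0 h0
    have e5 := (sob_sub_le (a := a) (b := b) 2 s _ _).trans (add_le_add (hD (betaPlus α a b) t ht)
      (hD (betaMinus α a b) t ht))
    rw [hP]
    linarith
  have hysob := sob_le_of_oscillation hα hα₁ hT hc hcT 2 s y
    (mul_nonneg hP0 (pow_nonneg hh _)) hQ
  have hψ₁ : timeDeriv S ψ 0 = ψ₁ := funext hψ.initial_t
  -- The velocity is `iβ_l y + iβ_l^- û(0)`, and both factors are at most `(2/α) wt`: one derivative
  -- is spent in passing from `H²` to `H¹`.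
  have h2 : sob a b 1 s (fourierHat a b ψ₁)
      ≤ 2 / α * sob a b 2 s (fun l => ((‖y l‖ + ‖fourierHat a b (ψ 0) l‖ : ℝ) : ℂ)) := by
    refine l2_le_mul (by positivity) fun l _ => ?_
    rw [norm_wt_pow_mul, norm_wt_pow_mul, Complex.norm_real,
      Real.norm_of_nonneg (by positivity : 0 ≤ ‖y l‖ + ‖fourierHat a b (ψ 0) l‖)]
    have hb := I_mul_betaDiff_ne_zero (a := a) (b := b) hα l
    have hb0 := betaDiff_pos (a := a) (b := b) hα l
    have e1 : fourierHat a b ψ₁ l = Complex.I * betaDiff α a b l * y l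
        + Complex.I * betaMinus α a b l * fourierHat a b (ψ 0) l := by
      simp only [hy, exPlus, charPlus, hψ₁]
      rw [mul_div_cancel₀ _ hb]
      ring
    have e2 : ‖fourierHat a b ψ₁ l‖ ≤ betaDiff α a b l * (‖y l‖ + ‖fourierHat a b (ψ 0) l‖) := by
      rw [e1]
      refine (norm_add_le _ _).trans ?_
      simp only [norm_mul, Complex.norm_I, Complex.norm_real, Real.norm_eq_abs, one_mul]
      rw [abs_of_pos hb0, mul_add]
      have := abs_betaMinus_le (a := a) (b := b) hα l
      gcongr
    have e3 := betaDiff_le (a := a) (b := b) hα hα₁ l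
    have e4 := wt_pos (a := a) (b := b) l
    calc wt a b l ^ 1 * ‖fourierHat a b ψ₁ l‖
        ≤ wt a b l ^ 1 * (2 / α * wt a b l * (‖y l‖ + ‖fourierHat a b (ψ 0) l‖)) := by
          refine mul_le_mul_of_nonneg_left (e2.trans ?_) (by positivity)
          gcongr
      _ = _ := by ring
  refine h2.trans ?_
  rw [mul_assoc]
  refine mul_le_mul_of_nonneg_left ?_ (by positivity)
  have h3 := sob_add_le (a := a) (b := b) 2 s (fun l => ((‖y l‖ : ℝ) : ℂ))
    (fun l => ((‖fourierHat a b (ψ 0) l‖ : ℝ) : ℂ))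
  have h4 : sob a b 2 s (fun l => ((‖y l‖ : ℝ) : ℂ)) = sob a b 2 s y :=
    sob_congr 2 fun l _ => by rw [Complex.norm_real, norm_norm]
  have h5 : sob a b 2 s (fun l => ((‖fourierHat a b (ψ 0) l‖ : ℝ) : ℂ))
      = sob a b 2 s (fourierHat a b (ψ 0)) :=
    sob_congr 2 fun l _ => by rw [Complex.norm_real, norm_norm]
  push_cast at h3 ⊢
  rw [h4, h5] at h3
  have h6 := hu 0 h0
  rw [mul_div_right_comm] at hysob
  linarith

end initialVelocity

/-! ### The error recursion in characteristic variables. -/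

section error
variable {α ε a b S K τ : ℝ} {m M : ℕ} {ψ₀ ψ₁ : ℝ → ℂ} {ψ : ℝ → ℝ → ℂ}

/-- The error in the component along `e^{i β_l^+ t}`. -/
def errPlus (α ε a b S τ : ℝ) (M : ℕ) (ψ₀ ψ₁ : ℝ → ℂ) (ψ : ℝ → ℝ → ℂ) (n : ℕ) (l : ℤ) : ℂ :=
  exPlus α a b S ψ (n * τ) l - numPlus α ε a b τ M ψ₀ ψ₁ n l

/-- The error in the component along `e^{i β_l^- t}`. -/
def errMinus (α ε a b S τ : ℝ) (M : ℕ) (ψ₀ ψ₁ : ℝ → ℂ) (ψ : ℝ → ℝ → ℂ) (n : ℕ) (l : ℤ) : ℂ :=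
  exMinus α a b S ψ (n * τ) l - numMinus α ε a b τ M ψ₀ ψ₁ n l

/-- The `H¹` size of the error in both components. -/
def errNorm (α ε a b S τ : ℝ) (M : ℕ) (ψ₀ ψ₁ : ℝ → ℂ) (ψ : ℝ → ℝ → ℂ) (n : ℕ) : ℝ :=
  sob a b 1 (modes M) (errPlus α ε a b S τ M ψ₀ ψ₁ ψ n)
    + sob a b 1 (modes M) (errMinus α ε a b S τ M ψ₀ ψ₁ ψ n)

theorem errNorm_nonneg (n : ℕ) : 0 ≤ errNorm α ε a b S τ M ψ₀ ψ₁ ψ n :=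
  add_nonneg (sob_nonneg _ _ _) (sob_nonneg _ _ _)

/-- The defect of the nonlinearity in the `n`-th time step. -/
def defect (α ε a b τ : ℝ) (M : ℕ) (ψ₀ ψ₁ : ℝ → ℂ) (ψ : ℝ → ℝ → ℂ) (n : ℕ) (s : ℝ) (l : ℤ) : ℂ :=
  fourierHat a b (fun x => cubic (ψ (n * τ + s) x)) l
    - (fourierTilde a b (cubicGrid (ewiFP α ε a b τ M ψ₀ ψ₁ n)) l
      + s * fourierTilde a b (gSeq α ε a b τ M ψ₀ ψ₁ n) l)

theorem sob_hat_sub_tilde_le (hα : 0 < α) (hab : a < b) (hτ : 0 < τ) (hM : 0 < M) (he : Even M)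
    (n : ℕ) {s : Finset ℤ} (hs : s ⊆ modes M) :
    sob a b 1 s (fun l => fourierHat a b (ψ (n * τ)) l
      - fourierTilde a b (ewiFP α ε a b τ M ψ₀ ψ₁ n) l) ≤ errNorm α ε a b S τ M ψ₀ ψ₁ ψ n := by
  have h1 : sob a b 1 s (fun l => fourierHat a b (ψ (n * τ)) l
      - fourierTilde a b (ewiFP α ε a b τ M ψ₀ ψ₁ n) l)
      = sob a b 1 s (fun l => errPlus α ε a b S τ M ψ₀ ψ₁ ψ n l + errMinus α ε a b S τ M ψ₀ ψ₁ ψ n l) := by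
    refine sob_congr 1 fun l hl => ?_
    rw [fourierTilde_ewiFP hα hab hτ hM he ψ₀ ψ₁ (hs hl) n, ← exPlus_add_exMinus (S := S) hα,
      errPlus, errMinus]
    congr 1
    ring
  rw [h1]
  exact (sob_add_le _ _ _ _).trans (add_le_add (l2_subset hs _) (l2_subset hs _))

theorem continuousOn_defect (hψ : IsSolution α ε a b S ψ₀ ψ₁ ψ) {n : ℕ} (hτ : 0 ≤ τ)
    (hn : n * τ + τ ≤ S) (l : ℤ) :
    ContinuousOn (fun s => defect α ε a b τ M ψ₀ ψ₁ ψ n s l) (Set.Icc 0 τ) := by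
  have h := continuousOn_hat_cubic_add (a := a) (b := b) hψ (t := n * τ) (by positivity) hn l
  unfold defect
  fun_prop

theorem errPlus_succ (hα : 0 < α) (hab : a < b) (hS : 0 < S) (hψ : IsSolution α ε a b S ψ₀ ψ₁ ψ)
    {n : ℕ} (hτ : 0 ≤ τ) (hn : n * τ + τ ≤ S) (l : ℤ) :
    errPlus α ε a b S τ M ψ₀ ψ₁ ψ (n + 1) l
      = cis (betaPlus α a b l * τ) * errPlus α ε a b S τ M ψ₀ ψ₁ ψ n l
        + kap α ε a b l * ∫ s in (0 : ℝ)..τ, cis (betaPlus α a b l * (τ - s))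
          * defect α ε a b τ M ψ₀ ψ₁ ψ n s l := by
  have h := continuousOn_hat_cubic_add (a := a) (b := b) hψ (t := n * τ) (by positivity) hn l
  have hc : Continuous fun s : ℝ => cis (betaPlus α a b l * (τ - s)) := by fun_prop
  have hi : IntervalIntegrable (fun s : ℝ => cis (betaPlus α a b l * (τ - s))
      * fourierHat a b (fun x => cubic (ψ (n * τ + s) x)) l) MeasureTheory.volume 0 τ :=
    ContinuousOn.intervalIntegrable_of_Icc hτ (hc.continuousOn.mul h)
  have h1 := exPlus_duhamel hα hab hS hψ l (t := n * τ) (by positivity) hτ hn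
  have h2 : ((n + 1 : ℕ) : ℝ) * τ = n * τ + τ := by push_cast; ring
  simp only [errPlus, h2, h1, defect, mul_sub (cis _)]
  rw [intervalIntegral.integral_sub hi (Continuous.intervalIntegrable (by fun_prop) _ _),
    numPlus, duhamelSeq, numPlus]
  ring

theorem errMinus_succ (hα : 0 < α) (hab : a < b) (hS : 0 < S) (hψ : IsSolution α ε a b S ψ₀ ψ₁ ψ)
    {n : ℕ} (hτ : 0 ≤ τ) (hn : n * τ + τ ≤ S) (l : ℤ) :
    errMinus α ε a b S τ M ψ₀ ψ₁ ψ (n + 1) l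
      = cis (betaMinus α a b l * τ) * errMinus α ε a b S τ M ψ₀ ψ₁ ψ n l
        - kap α ε a b l * ∫ s in (0 : ℝ)..τ, cis (betaMinus α a b l * (τ - s))
          * defect α ε a b τ M ψ₀ ψ₁ ψ n s l := by
  have h := continuousOn_hat_cubic_add (a := a) (b := b) hψ (t := n * τ) (by positivity) hn l
  have hc : Continuous fun s : ℝ => cis (betaMinus α a b l * (τ - s)) := by fun_prop
  have hi : IntervalIntegrable (fun s : ℝ => cis (betaMinus α a b l * (τ - s))
      * fourierHat a b (fun x => cubic (ψ (n * τ + s) x)) l) MeasureTheory.volume 0 τ :=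
    ContinuousOn.intervalIntegrable_of_Icc hτ (hc.continuousOn.mul h)
  have h1 := exMinus_duhamel hα hab hS hψ l (t := n * τ) (by positivity) hτ hn
  have h2 : ((n + 1 : ℕ) : ℝ) * τ = n * τ + τ := by push_cast; ring
  simp only [errMinus, h2, h1, defect, mul_sub (cis _)]
  rw [intervalIntegral.integral_sub hi (Continuous.intervalIntegrable (by fun_prop) _ _),
    numMinus, duhamelSeq, numMinus]
  ring

/-- Propagation of the error over one time step. -/
theorem errNorm_succ_le (hα : 0 < α) (hα₁ : α ≤ 1) (hab : a < b) (hS : 0 < S)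
    (hψ : IsSolution α ε a b S ψ₀ ψ₁ ψ) {n : ℕ} (hτ : 0 ≤ τ) (hn : n * τ + τ ≤ S) {ρ : ℝ}
    (hρ : ∀ s ∈ Set.Icc 0 τ, l2 (modes M) (defect α ε a b τ M ψ₀ ψ₁ ψ n s) ≤ ρ) :
    errNorm α ε a b S τ M ψ₀ ψ₁ ψ (n + 1)
      ≤ errNorm α ε a b S τ M ψ₀ ψ₁ ψ n + 2 * ε ^ 2 / α * (τ * ρ) := by
  have hD : ∀ β : ℤ → ℝ, sob a b 1 (modes M) (fun l => kap α ε a b l *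
      ∫ s in (0 : ℝ)..τ, cis (β l * (τ - s)) * defect α ε a b τ M ψ₀ ψ₁ ψ n s l)
      ≤ ε ^ 2 / α * (τ * ρ) := fun β =>
    sob_kap_integral_le hα hα₁ 0 (modes M) β hτ (fun l _ => continuousOn_defect hψ hτ hn l)
      fun s hs => by rw [sob_zero]; exact hρ s hs
  -- The old error is multiplied by a number of modulus one in each mode, so it enters with constant
  -- exactly 1.
  have h1 : sob a b 1 (modes M) (errPlus α ε a b S τ M ψ₀ ψ₁ ψ (n + 1))
      ≤ sob a b 1 (modes M) (errPlus α ε a b S τ M ψ₀ ψ₁ ψ n) + ε ^ 2 / α * (τ * ρ) := by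
    rw [show errPlus α ε a b S τ M ψ₀ ψ₁ ψ (n + 1) = _ from
      funext fun l => errPlus_succ hα hab hS hψ hτ hn l]
    refine (sob_add_le _ _ _ _).trans (add_le_add (le_of_eq ?_) (hD _))
    exact sob_congr 1 fun l _ => by rw [norm_mul, norm_cis, one_mul]
  have h2 : sob a b 1 (modes M) (errMinus α ε a b S τ M ψ₀ ψ₁ ψ (n + 1))
      ≤ sob a b 1 (modes M) (errMinus α ε a b S τ M ψ₀ ψ₁ ψ n) + ε ^ 2 / α * (τ * ρ) := by
    rw [show errMinus α ε a b S τ M ψ₀ ψ₁ ψ (n + 1) = _ from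
      funext fun l => errMinus_succ hα hab hS hψ hτ hn l]
    refine (sob_sub_le _ _ _ _).trans (add_le_add (le_of_eq ?_) (hD _))
    exact sob_congr 1 fun l _ => by rw [norm_mul, norm_cis, one_mul]
  rw [errNorm, errNorm]
  have h3 : 2 * ε ^ 2 / α * (τ * ρ) = ε ^ 2 / α * (τ * ρ) + ε ^ 2 / α * (τ * ρ) := by ring
  linarith

/-! ### Bounds for the defect -/

theorem l2_alias_cubic_le (hab : a < b) (hM : 0 < M) (he : Even M) (hh : meshSize a b M ≤ 1)
    (hm : 1 ≤ m) (hK : 1 ≤ K) (hψ : IsSolution α ε a b S ψ₀ ψ₁ ψ) (hr : RegBound a b S m K ψ) {t : ℝ}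
    (ht : t ∈ Set.Icc 0 S) :
    l2 (modes M) (fun l => fourierTilde a b (sample a b M fun x => cubic (ψ t x)) l
      - fourierHat a b (fun x => cubic (ψ t x)) l)
      ≤ 24 * aliasC * supC a b K ^ 3 * meshSize a b M ^ (m - 1) := by
  have hR := supC_pos (a := a) (b := b) hK
  have hh0 := meshSize_pos hab hM
  have hc := continuous_of_continuousOn_prod hψ.continuous ht
  have hcp : Function.Periodic (fun x => cubic (ψ t x)) (b - a) := fun x => by
    simp only [hψ.periodic t ht x]
  have h1 := l2_fourierTilde_sample_sub_le hab hM he (by fun_prop : Continuous fun x => cubic (ψ t x))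
    hcp (by positivity) (sob_cubic_le hab hK hψ hr ht)
    (fun s hs => sob_cubic_tail_le hab hM he hm hK hψ hr ht hs)
  refine h1.trans ?_
  have h2 : 0 ≤ 24 * aliasC * supC a b K ^ 3 * meshSize a b M ^ (m - 1) := by
    have := aliasC_nonneg; positivity
  nlinarith

theorem l2_alias_solution_le (hab : a < b) (hM : 0 < M) (he : Even M)
    (hm : 1 ≤ m) (hψ : IsSolution α ε a b S ψ₀ ψ₁ ψ) (hr : RegBound a b S m K ψ) (hK : 1 ≤ K) {t : ℝ}
    (ht : t ∈ Set.Icc 0 S) :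
    l2 (modes M) (fun l => fourierTilde a b (sample a b M (ψ t)) l - fourierHat a b (ψ t) l)
      ≤ aliasC * meshSize a b M * (meshSize a b M ^ (m - 1) * K) := by
  have hh0 := meshSize_pos hab hM
  refine l2_fourierTilde_sample_sub_le hab hM he (continuous_of_continuousOn_prod hψ.continuous ht)
    (hψ.periodic t ht) (by positivity) (fun s => (sob_mono hm s _).trans (hr.sob_le t ht s))
    fun s hs => (sob_tail_le hab hM he hm hs).trans ?_
  exact mul_le_mul_of_nonneg_left (hr.sob_le t ht s) (by positivity)

/-- The defect in the first time step. -/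
theorem l2_defect_zero_le (hab : a < b) (hM : 0 < M) (he : Even M) (hh : meshSize a b M ≤ 1)
    (hm : 1 ≤ m) (hK : 1 ≤ K) (hψ : IsSolution α ε a b S ψ₀ ψ₁ ψ) (hr : RegBound a b S m K ψ)
    (hτ : τ ≤ S) {s : ℝ} (hs : s ∈ Set.Icc 0 τ) :
    l2 (modes M) (defect α ε a b τ M ψ₀ ψ₁ ψ 0 s)
      ≤ 6 * supC a b K ^ 3 * τ + 24 * aliasC * supC a b K ^ 3 * meshSize a b M ^ (m - 1) := by
  have hR := supC_pos (a := a) (b := b) hK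
  have hsS : s ∈ Set.Icc 0 S := ⟨hs.1, hs.2.trans hτ⟩
  have h0 : (0 : ℝ) ∈ Set.Icc 0 S := ⟨le_rfl, hsS.1.trans hsS.2⟩
  have hψ0 : ψ 0 = ψ₀ := funext hψ.initial
  have hψ1 : timeDeriv S ψ 0 = ψ₁ := funext hψ.initial_t
  have hc := continuous_of_continuousOn_prod hψ.continuous hsS
  have hc0 := continuous_of_continuousOn_prod hψ.continuous h0
  -- The time part is estimated crudely: the increment of `f(ψ)` and the term `s g(ψ⁰)` are each at
  -- most `3 supC³ τ`, without using their cancellation. Order `τ` suffices for this single step.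
  have h1 : defect α ε a b τ M ψ₀ ψ₁ ψ 0 s = fun l =>
      (fourierHat a b (fun x => cubic (ψ s x) - cubic (ψ 0 x)) l
        - (fourierTilde a b (sample a b M fun x => cubic (ψ 0 x)) l
          - fourierHat a b (fun x => cubic (ψ 0 x)) l))
      - s * fourierTilde a b (gInit (sample a b M ψ₀) (sample a b M ψ₁)) l := by
    funext l
    have e1 : cubicGrid (ewiFP α ε a b τ M ψ₀ ψ₁ 0) = sample a b M fun x => cubic (ψ 0 x) := by
      rw [hψ0]; rfl
    rw [defect, e1, gSeq, fourierHat_sub (by fun_prop) (by fun_prop)]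
    simp only [Nat.cast_zero, zero_mul, zero_add]
    ring
  rw [h1]
  refine (l2_sub_le _ _ _).trans ?_
  have h2 := l2_sub_le (modes M) (fun l => fourierHat a b (fun x => cubic (ψ s x) - cubic (ψ 0 x)) l)
    (fun l => fourierTilde a b (sample a b M fun x => cubic (ψ 0 x)) l
          - fourierHat a b (fun x => cubic (ψ 0 x)) l)
  have h3 : l2 (modes M) (fourierHat a b fun x => cubic (ψ s x) - cubic (ψ 0 x))
      ≤ 3 * supC a b K ^ 3 * τ := by
    refine l2_fourierHat_le_of_bound hab (by fun_prop)
      (mul_nonneg (by positivity) (hs.1.trans hs.2)) (fun x => ?_) _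
    refine (norm_cubic_sub_le_time hab hK hψ hr hsS h0 x).trans ?_
    rw [sub_zero, abs_of_nonneg hs.1]
    exact mul_le_mul_of_nonneg_left hs.2 (by positivity)
  have h4 := l2_alias_cubic_le hab hM he hh hm hK hψ hr h0
  have h5 : l2 (modes M) (fourierTilde a b (gInit (sample a b M ψ₀) (sample a b M ψ₁)))
      ≤ 3 * supC a b K ^ 3 := by
    refine l2_fourierTilde_le_of_bound hab hM he (by positivity) fun j => ?_
    have e1 : gInit (sample a b M ψ₀) (sample a b M ψ₁) j.castSucc
        = dcubic (ψ 0 (gridPoint a b M j)) (timeDeriv S ψ 0 (gridPoint a b M j)) := by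
      rw [hψ0, hψ1]; rfl
    rw [e1]
    refine (norm_dcubic_le (norm_le_supC hK hr h0 _)).trans ?_
    have e2 := mul_le_mul_of_nonneg_left
      (norm_timeDeriv_le hab hK hψ hr h0 (gridPoint a b M j))
      (show 0 ≤ 3 * supC a b K ^ 2 by positivity)
    linarith
  rw [l2_const_mul, Complex.norm_real, Real.norm_of_nonneg hs.1]
  have h6 : s * l2 (modes M) (fourierTilde a b (gInit (sample a b M ψ₀) (sample a b M ψ₁)))
      ≤ τ * (3 * supC a b K ^ 3) :=
    mul_le_mul hs.2 h5 (l2_nonneg _ _) (hs.1.trans hs.2)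
  have h7 : l2 (modes M) (fun l => fourierHat a b (fun x => cubic (ψ s x) - cubic (ψ 0 x)) l)
    = l2 (modes M) (fourierHat a b fun x => cubic (ψ s x) - cubic (ψ 0 x)) := rfl
  linarith

/-- Stability of the nonlinearity on the grid. -/
theorem l2_cubicGrid_sub_le (hα : 0 < α) (hab : a < b) (hτ : 0 < τ) (hM : 0 < M) (he : Even M)
    (hh : meshSize a b M ≤ 1)
    (hm : 1 ≤ m) (hK : 1 ≤ K) (hψ : IsSolution α ε a b S ψ₀ ψ₁ ψ) (hr : RegBound a b S m K ψ) {n : ℕ}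
    (hn : n * τ ≤ S)
    (hg : ∀ j : Fin M, ‖ewiFP α ε a b τ M ψ₀ ψ₁ n j.castSucc‖ ≤ supC a b K + 1) :
    l2 (modes M) (fun l => fourierTilde a b (sample a b M fun x => cubic (ψ (n * τ) x)) l
      - fourierTilde a b (cubicGrid (ewiFP α ε a b τ M ψ₀ ψ₁ n)) l)
      ≤ 3 * (supC a b K + 1) ^ 2 *
        (aliasC * K * meshSize a b M ^ (m - 1) + errNorm α ε a b S τ M ψ₀ ψ₁ ψ n) := by
  have hR := supC_pos (a := a) (b := b) hK
  have hh0 := meshSize_pos hab hM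
  have ht : (n : ℝ) * τ ∈ Set.Icc 0 S := ⟨by positivity, hn⟩
  have h1 := l2_fourierTilde_le_of_norm_le (a := a) (b := b) hab hM he
    (w := fun j => (sample a b M fun x => cubic (ψ (n * τ) x)) j
      - cubicGrid (ewiFP α ε a b τ M ψ₀ ψ₁ n) j)
    (u := fun j => sample a b M (ψ (n * τ)) j - ewiFP α ε a b τ M ψ₀ ψ₁ n j)
    (c := 3 * (supC a b K + 1) ^ 2) (by positivity)
    (fun j => norm_cubic_sub_le ((norm_le_supC hK hr ht _).trans (by linarith)) (hg j))
  have h2 : ∀ l, fourierTilde a b (fun j => (sample a b M fun x => cubic (ψ (n * τ) x)) j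
      - cubicGrid (ewiFP α ε a b τ M ψ₀ ψ₁ n) j) l
      = fourierTilde a b (sample a b M fun x => cubic (ψ (n * τ) x)) l
      - fourierTilde a b (cubicGrid (ewiFP α ε a b τ M ψ₀ ψ₁ n)) l := fun l => fourierTilde_sub _ _ l
  rw [← funext h2]
  refine h1.trans (mul_le_mul_of_nonneg_left ?_ (by positivity))
  have h3 : ∀ l, fourierTilde a b (fun j => sample a b M (ψ (n * τ)) j
      - ewiFP α ε a b τ M ψ₀ ψ₁ n j) l
      = (fourierTilde a b (sample a b M (ψ (n * τ))) l - fourierHat a b (ψ (n * τ)) l)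
        + (fourierHat a b (ψ (n * τ)) l - fourierTilde a b (ewiFP α ε a b τ M ψ₀ ψ₁ n) l) := fun l => by
    rw [fourierTilde_sub]; ring
  rw [funext h3]
  refine (l2_add_le _ _ _).trans (add_le_add ?_ ((l2_le_sob 1 _ _).trans
    (sob_hat_sub_tilde_le hα hab hτ hM he n le_rfl)))
  refine (l2_alias_solution_le hab hM he hm hψ hr hK ht).trans ?_
  have h4 : 0 ≤ aliasC * K * meshSize a b M ^ (m - 1) := by
    have := aliasC_nonneg; positivity
  nlinarith

/-- The constant in the bound for the defect. -/
def defectC (a b K : ℝ) : ℝ :=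
  72 * aliasC * supC a b K ^ 3 + 18 * supC a b K ^ 3
    + 9 * (supC a b K + 1) ^ 2 * (aliasC * K + 1)

theorem defectC_pos (hK : 1 ≤ K) : 0 < defectC a b K := by
  have hR := supC_pos (a := a) (b := b) hK
  have := aliasC_nonneg
  rw [defectC]; positivity

/-- The defect after the first time step. -/
theorem l2_defect_succ_le (hα : 0 < α) (hab : a < b) (hS : 0 < S) (hτ : 0 < τ) (hM : 0 < M)
    (he : Even M) (hh : meshSize a b M ≤ 1)
    (hm : 1 ≤ m) (hK : 1 ≤ K) (hψ : IsSolution α ε a b S ψ₀ ψ₁ ψ) (hr : RegBound a b S m K ψ) {k : ℕ}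
    (hk : (k + 1 : ℕ) * τ + τ ≤ S)
    (hg : ∀ j : Fin M, ‖ewiFP α ε a b τ M ψ₀ ψ₁ k j.castSucc‖ ≤ supC a b K + 1)
    (hg' : ∀ j : Fin M, ‖ewiFP α ε a b τ M ψ₀ ψ₁ (k + 1) j.castSucc‖ ≤ supC a b K + 1)
    {s : ℝ} (hs : s ∈ Set.Icc 0 τ) :
    l2 (modes M) (defect α ε a b τ M ψ₀ ψ₁ ψ (k + 1) s)
      ≤ defectC a b K * (τ ^ 2 + meshSize a b M ^ (m - 1)
        + errNorm α ε a b S τ M ψ₀ ψ₁ ψ (k + 1) + errNorm α ε a b S τ M ψ₀ ψ₁ ψ k) := by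
  have hR := supC_pos (a := a) (b := b) hK
  have hh0 := meshSize_pos hab hM
  have hA := aliasC_nonneg
  have hτ' : (τ : ℂ) ≠ 0 := by exact_mod_cast hτ.ne'
  set t : ℝ := (k + 1 : ℕ) * τ with ht_def
  have htk : t - τ = k * τ := by rw [ht_def]; push_cast; ring
  have hτt : τ ≤ t := by
    have : 0 ≤ (k : ℝ) * τ := by positivity
    linarith
  have ht : t ∈ Set.Icc 0 S := ⟨by linarith, by linarith⟩
  have htk0 : (k : ℝ) * τ ∈ Set.Icc 0 S := ⟨by positivity, by linarith⟩
  have hts : t + s ∈ Set.Icc 0 S := ⟨by linarith [hs.1], by linarith [hs.2]⟩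
  have hc := continuous_of_continuousOn_prod hψ.continuous ht
  have hck := continuous_of_continuousOn_prod hψ.continuous htk0
  have hcs := continuous_of_continuousOn_prod hψ.continuous hts
  have hst : 0 ≤ s / τ := div_nonneg hs.1 hτ.le
  have hst1 : s / τ ≤ 1 := (div_le_one hτ).2 hs.2
  set X : ℤ → ℂ := fourierHat a b (fun x => cubic (ψ (t + s) x) - cubic (ψ t x)
    - (s / τ : ℝ) * (cubic (ψ t x) - cubic (ψ (t - τ) x))) with hX
  set A : ℝ → ℤ → ℂ := fun r l => fourierTilde a b (sample a b M fun x => cubic (ψ r x)) l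
      - fourierHat a b (fun x => cubic (ψ r x)) l with hA_def
  set B : ℕ → ℤ → ℂ := fun n l => fourierTilde a b (sample a b M fun x => cubic (ψ (n * τ) x)) l
      - fourierTilde a b (cubicGrid (ewiFP α ε a b τ M ψ₀ ψ₁ n)) l with hB_def
  -- `X` is the extrapolation error of the exact solution, `A` the aliasing error and `B` the effect
  -- of the numerical error on the grid. The extrapolation weights `1 + s/τ` and `-s/τ` are at most
  -- 2 and 1 in modulus.
  have h1 : defect α ε a b τ M ψ₀ ψ₁ ψ (k + 1) s = fun l =>
      X l + (((1 + s / τ : ℝ) : ℂ) * (B (k + 1) l - A t l) - ((s / τ : ℝ) : ℂ) * (B k l - A (k * τ) l)) := by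
    funext l
    have e1 : X l = fourierHat a b (fun x => cubic (ψ (t + s) x)) l
        - fourierHat a b (fun x => cubic (ψ t x)) l
        - (s / τ : ℝ) * (fourierHat a b (fun x => cubic (ψ t x)) l
          - fourierHat a b (fun x => cubic (ψ (k * τ) x)) l) := by
      rw [hX, htk, fourierHat_sub (by fun_prop) (by fun_prop), fourierHat_sub (by fun_prop) (by fun_prop),
        fourierHat_const_mul, fourierHat_sub (by fun_prop) (by fun_prop)]
    have e2 : fourierTilde a b (gSeq α ε a b τ M ψ₀ ψ₁ (k + 1)) l
        = 1 / (τ : ℂ) * (fourierTilde a b (cubicGrid (ewiFP α ε a b τ M ψ₀ ψ₁ (k + 1))) l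
          - fourierTilde a b (cubicGrid (ewiFP α ε a b τ M ψ₀ ψ₁ k)) l) := by
      rw [← fourierTilde_sub, ← fourierTilde_const_mul]
      congr 1
      funext j
      simp only [gSeq, gDiff, cubicGrid]
      ring
    rw [defect, e2, e1]
    simp only [hA_def, hB_def, ← ht_def]
    push_cast
    field_simp
    ring
  have hXle : l2 (modes M) X ≤ 18 * supC a b K ^ 3 * τ ^ 2 := by
    have hck' : Continuous (ψ (t - τ)) := by rw [htk]; exact hck
    exact l2_fourierHat_le_of_bound hab (by fun_prop) (by positivity)
      (fun x => norm_cubic_extrapolation_le hab hK hS hψ hr hτ hτt hs hts.2 x) _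
  have hA1 := l2_alias_cubic_le hab hM he hh hm hK hψ hr ht
  have hA2 := l2_alias_cubic_le hab hM he hh hm hK hψ hr htk0
  have hB1 := l2_cubicGrid_sub_le hα hab hτ hM he hh hm hK hψ hr (n := k + 1) ht.2 hg'
  have hB2 := l2_cubicGrid_sub_le hα hab hτ hM he hh hm hK hψ hr (n := k) htk0.2 hg
  have h2 := l2_sub_le (modes M) (B (k + 1)) (A t)
  have h3 := l2_sub_le (modes M) (B k) (A (k * τ))
  have h4 : l2 (modes M) (fun l => ((1 + s / τ : ℝ) : ℂ) * (B (k + 1) l - A t l))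
      ≤ 2 * l2 (modes M) (fun l => B (k + 1) l - A t l) := by
    rw [l2_const_mul, Complex.norm_real, Real.norm_of_nonneg (by linarith)]
    exact mul_le_mul_of_nonneg_right (by linarith) (l2_nonneg _ _)
  have h5 : l2 (modes M) (fun l => ((s / τ : ℝ) : ℂ) * (B k l - A (k * τ) l))
      ≤ 1 * l2 (modes M) (fun l => B k l - A (k * τ) l) := by
    rw [l2_const_mul, Complex.norm_real, Real.norm_of_nonneg hst]
    exact mul_le_mul_of_nonneg_right hst1 (l2_nonneg _ _)
  rw [h1]
  refine (l2_add_le _ _ _).trans ?_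
  have h6 := l2_sub_le (modes M) (fun l => ((1 + s / τ : ℝ) : ℂ) * (B (k + 1) l - A t l))
    (fun l => ((s / τ : ℝ) : ℂ) * (B k l - A (k * τ) l))
  have hA1' : l2 (modes M) (A t) ≤ 24 * aliasC * supC a b K ^ 3 * meshSize a b M ^ (m - 1) := hA1
  have hA2' : l2 (modes M) (A (k * τ)) ≤ 24 * aliasC * supC a b K ^ 3 * meshSize a b M ^ (m - 1) := hA2
  set H := meshSize a b M ^ (m - 1) with hH
  have hH0 : 0 ≤ H := by positivity
  set Y := errNorm α ε a b S τ M ψ₀ ψ₁ ψ k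
  set Y' := errNorm α ε a b S τ M ψ₀ ψ₁ ψ (k + 1)
  have hY : 0 ≤ Y := errNorm_nonneg k
  have hY' : 0 ≤ Y' := errNorm_nonneg (k + 1)
  have hB1' : l2 (modes M) (B (k + 1)) ≤ 3 * (supC a b K + 1) ^ 2 * (aliasC * K * H + Y') := hB1
  have hB2' : l2 (modes M) (B k) ≤ 3 * (supC a b K + 1) ^ 2 * (aliasC * K * H + Y) := hB2
  set W := (supC a b K + 1) ^ 2 with hW
  have hW0 : 0 ≤ W := sq_nonneg _
  -- The total weight `2 + 1 = 3` accounts for the `72 = 3 · 24` of aliasing and the `9 = 3 · 3` in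
  -- front of the squared radius.
  have hsum : l2 (modes M) X + l2 (modes M) (fun l =>
        ((1 + s / τ : ℝ) : ℂ) * (B (k + 1) l - A t l) - ((s / τ : ℝ) : ℂ) * (B k l - A (k * τ) l))
      ≤ 18 * supC a b K ^ 3 * τ ^ 2 + 72 * aliasC * supC a b K ^ 3 * H
        + 9 * W * (aliasC * K) * H + 6 * W * Y' + 3 * W * Y := by
    linarith
  refine hsum.trans ?_
  rw [defectC, ← hW]
  have p1 : 0 ≤ aliasC * K := by positivity
  have p2 : 0 ≤ W * (aliasC * K) := by positivity
  have p3 : 0 ≤ aliasC * supC a b K ^ 3 := by positivity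
  have p4 : 0 ≤ supC a b K ^ 3 := by positivity
  have q1 : 0 ≤ (72 * (aliasC * supC a b K ^ 3) + 9 * (W * (aliasC * K)) + 9 * W) * τ ^ 2 := by positivity
  have q2 : 0 ≤ (18 * supC a b K ^ 3 + 9 * W) * H := by positivity
  have q3 : 0 ≤ (72 * (aliasC * supC a b K ^ 3) + 18 * supC a b K ^ 3 + 9 * (W * (aliasC * K)) + 3 * W) * Y' := by
    positivity
  have q4 : 0 ≤ (72 * (aliasC * supC a b K ^ 3) + 18 * supC a b K ^ 3 + 9 * (W * (aliasC * K)) + 6 * W) * Y := by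
    positivity
  linarith

end error

/-! ### Initial error, maximum bound on the numerical solution, and Gronwall's inequality. -/

section convergence
variable {α ε a b S K τ : ℝ} {m M : ℕ} {ψ₀ ψ₁ : ℝ → ℂ} {ψ : ℝ → ℝ → ℂ}

/-- An inverse inequality: in the band `|μ_l| ≤ π/h`, and with `h ≤ 1` one has `1 + π/h ≤ 5/h`. -/
theorem wt_le_of_mem_modes (hab : a < b) (hM : 0 < M) (he : Even M) (hh : meshSize a b M ≤ 1) {l : ℤ}
    (hl : l ∈ modes M) : wt a b l ≤ 5 / meshSize a b M := by
  have hL := sub_pos.2 hab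
  have hM' : (0 : ℝ) < M := by exact_mod_cast hM
  have hh0 := meshSize_pos hab hM
  have hpi := Real.pi_pos
  have h1 : wt a b l ≤ 1 + |freq a b l| := by
    refine abs_le_of_sq_le_sq' ?_ (by positivity) |>.2
    rw [wt_sq]
    nlinarith [abs_nonneg (freq a b l), sq_abs (freq a b l)]
  have h2 : 2 * |(l : ℝ)| ≤ M := by
    rw [mem_modes_iff he] at hl
    have : 2 * |l| ≤ (M : ℤ) := by rcases abs_cases l with h | h <;> omega
    exact_mod_cast this
  have h3 : |freq a b l| * meshSize a b M ≤ Real.pi := by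
    rw [freq, abs_div, abs_mul, abs_of_pos (by positivity : 0 < 2 * Real.pi), abs_of_pos hL, meshSize]
    have : 2 * Real.pi * |(l : ℝ)| / (b - a) * ((b - a) / M) = Real.pi * (2 * |(l : ℝ)|) / M := by
      field_simp
    rw [this, div_le_iff₀ hM']
    gcongr
  rw [le_div_iff₀ hh0]
  nlinarith [Real.pi_le_four]

/-- Division by `β_l ≥ wt` smooths the velocity by one derivative, while `|β_l^-| ≤ β_l` leaves the
value unchanged. Thus an `L²` error in `ψ₁` is enough for `H¹`. -/
theorem wt_mul_norm_charPlus_le (hα : 0 < α) (hα₁ : α ≤ 1) (l : ℤ) (u w : ℂ) :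
    wt a b l * ‖charPlus α a b l u w‖ ≤ ‖w‖ + wt a b l * ‖u‖ := by
  have hb := betaDiff_pos (a := a) (b := b) hα l
  have hw := wt_le_betaDiff (a := a) (b := b) hα hα₁ l
  have hw0 := wt_pos (a := a) (b := b) l
  have hm := abs_betaMinus_le (a := a) (b := b) hα l
  have h1 : ‖w - Complex.I * betaMinus α a b l * u‖ ≤ ‖w‖ + betaDiff α a b l * ‖u‖ := by
    refine (norm_sub_le _ _).trans ?_
    rw [norm_mul, norm_mul, Complex.norm_I, one_mul, Complex.norm_real, Real.norm_eq_abs]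
    gcongr
  rw [charPlus, norm_div, norm_mul, Complex.norm_I, one_mul, Complex.norm_real,
    Real.norm_of_nonneg hb.le, ← mul_div_assoc, div_le_iff₀ hb]
  have h2 := mul_le_mul_of_nonneg_left h1 hw0.le
  have h3 := mul_le_mul_of_nonneg_right hw (norm_nonneg w)
  linarith

theorem wt_mul_norm_charMinus_le (hα : 0 < α) (hα₁ : α ≤ 1) (l : ℤ) (u w : ℂ) :
    wt a b l * ‖charMinus α a b l u w‖ ≤ ‖w‖ + wt a b l * ‖u‖ := by
  have hb := betaDiff_pos (a := a) (b := b) hα l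
  have hw := wt_le_betaDiff (a := a) (b := b) hα hα₁ l
  have hw0 := wt_pos (a := a) (b := b) l
  have hm := abs_betaPlus_le (a := a) (b := b) hα l
  have h1 : ‖w - Complex.I * betaPlus α a b l * u‖ ≤ ‖w‖ + betaDiff α a b l * ‖u‖ := by
    refine (norm_sub_le _ _).trans ?_
    rw [norm_mul, norm_mul, Complex.norm_I, one_mul, Complex.norm_real, Real.norm_eq_abs]
    gcongr
  rw [charMinus, norm_neg, norm_div, norm_mul, Complex.norm_I, one_mul, Complex.norm_real,
    Real.norm_of_nonneg hb.le, ← mul_div_assoc, div_le_iff₀ hb]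
  have h2 := mul_le_mul_of_nonneg_left h1 hw0.le
  have h3 := mul_le_mul_of_nonneg_right hw (norm_nonneg w)
  linarith

/-- The error of the discretized initial data. -/
theorem errNorm_zero_le (hα : 0 < α) (hα₁ : α ≤ 1) (hab : a < b) (hS : 0 < S) (hM : 0 < M)
    (he : Even M) (hh : meshSize a b M ≤ 1) (hm : 2 ≤ m) (hK : 1 ≤ K)
    (hψ : IsSolution α ε a b S ψ₀ ψ₁ ψ) (hr : RegBound a b S m K ψ) {C : ℝ} (hC : 0 ≤ C)
    (htail : ∀ s : Finset ℤ, (∀ p ∈ s, p ∉ modes M) →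
      sob a b 1 s (fourierHat a b ψ₁) ≤ C * meshSize a b M ^ (m - 2)) :
    errNorm α ε a b S τ M ψ₀ ψ₁ ψ 0 ≤ 2 * (aliasC * (C + 5 * K)) * meshSize a b M ^ (m - 1) := by
  have hh0 := meshSize_pos hab hM
  have h0 : (0 : ℝ) ∈ Set.Icc 0 S := ⟨le_rfl, hS.le⟩
  have hψ0 : ψ 0 = ψ₀ := funext hψ.initial
  have hψ1 : timeDeriv S ψ 0 = ψ₁ := funext hψ.initial_t
  set u : ℤ → ℂ := fun l => fourierTilde a b (sample a b M ψ₀) l - fourierHat a b ψ₀ l with hu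
  set w : ℤ → ℂ := fun l => fourierTilde a b (sample a b M ψ₁) l - fourierHat a b ψ₁ l with hw
  have hul : l2 (modes M) u ≤ aliasC * meshSize a b M * (meshSize a b M ^ (m - 1) * K) := by
    have := l2_alias_solution_le hab hM he (by omega) hψ hr hK h0
    rwa [hψ0] at this
  -- The velocity tail is only of order `h^{m-2}` in `H¹`; aliasing supplies the missing factor `h`.
  have hwl : l2 (modes M) w ≤ aliasC * meshSize a b M * (C * meshSize a b M ^ (m - 2)) := by
    have hc := continuous_of_continuousOn_prod hψ.continuous_t h0
    have hp := timeDeriv_periodic hψ.periodic h0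
    have hb := hr.sob_t_le 0 h0
    rw [hψ1] at hc hp hb
    exact l2_fourierTilde_sample_sub_le hab hM he hc hp (by positivity) hb htail
  -- The aliasing error of `ψ₀` is `O(h^m)` in `L²`, so the factor `5/h` of the inverse inequality
  -- still leaves `h^{m-1}`.
  have key : ∀ v : ℤ → ℂ, (∀ l, wt a b l * ‖v l‖ ≤ ‖w l‖ + wt a b l * ‖u l‖) →
      sob a b 1 (modes M) v ≤ aliasC * (C + 5 * K) * meshSize a b M ^ (m - 1) := by
    intro v hv
    have h1 : sob a b 1 (modes M) v ≤ l2 (modes M) (fun l => ((‖w l‖ : ℝ) : ℂ)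
        + ((5 / meshSize a b M : ℝ) : ℂ) * ((‖u l‖ : ℝ) : ℂ)) := by
      refine l2_mono fun l hl => ?_
      rw [norm_wt_pow_mul, pow_one, ← Complex.ofReal_mul, ← Complex.ofReal_add, Complex.norm_real]
      refine ((hv l).trans ?_).trans (le_abs_self _)
      have := wt_le_of_mem_modes hab hM he hh hl
      gcongr
    have h2 := l2_add_le (modes M) (fun l => ((‖w l‖ : ℝ) : ℂ))
      (fun l => ((5 / meshSize a b M : ℝ) : ℂ) * ((‖u l‖ : ℝ) : ℂ))
    have h3 : l2 (modes M) (fun l => ((‖w l‖ : ℝ) : ℂ)) = l2 (modes M) w :=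
      l2_congr fun l _ => by rw [Complex.norm_real, norm_norm]
    have h4 : l2 (modes M) (fun l => ((‖u l‖ : ℝ) : ℂ)) = l2 (modes M) u :=
      l2_congr fun l _ => by rw [Complex.norm_real, norm_norm]
    rw [l2_const_mul, h3, h4, Complex.norm_real, Real.norm_of_nonneg (by positivity)] at h2
    have h5 : 5 / meshSize a b M * l2 (modes M) u
        ≤ 5 / meshSize a b M * (aliasC * meshSize a b M * (meshSize a b M ^ (m - 1) * K)) :=
      mul_le_mul_of_nonneg_left hul (by positivity)
    have h6 : 5 / meshSize a b M * (aliasC * meshSize a b M * (meshSize a b M ^ (m - 1) * K))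
        = aliasC * (5 * K) * meshSize a b M ^ (m - 1) := by field_simp
    have h7 : meshSize a b M ^ (m - 1) = meshSize a b M * meshSize a b M ^ (m - 2) := by
      rw [← pow_succ']; congr 1; omega
    have h8 : aliasC * meshSize a b M * (C * meshSize a b M ^ (m - 2))
        = aliasC * C * meshSize a b M ^ (m - 1) := by rw [h7]; ring
    linarith
  have h1 := key (errPlus α ε a b S τ M ψ₀ ψ₁ ψ 0) fun l => by
    have e1 : errPlus α ε a b S τ M ψ₀ ψ₁ ψ 0 l = -charPlus α a b l (u l) (w l) := by
      simp only [errPlus, numPlus, duhamelSeq, exPlus, Nat.cast_zero, zero_mul, hψ0, hψ1, charPlus,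
        hu, hw]
      ring
    rw [e1, norm_neg]
    exact wt_mul_norm_charPlus_le hα hα₁ l _ _
  have h2 := key (errMinus α ε a b S τ M ψ₀ ψ₁ ψ 0) fun l => by
    have e1 : errMinus α ε a b S τ M ψ₀ ψ₁ ψ 0 l = -charMinus α a b l (u l) (w l) := by
      simp only [errMinus, numMinus, duhamelSeq, exMinus, Nat.cast_zero, zero_mul, hψ0, hψ1, charMinus,
        hu, hw]
      ring
    rw [e1, norm_neg]
    exact wt_mul_norm_charMinus_le hα hα₁ l _ _
  rw [errNorm]
  linarith

@[fun_prop]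
theorem continuous_interp (u : Grid M) : Continuous (interp a b u) := by
  unfold interp; fun_prop

theorem interp_periodic (hab : a < b) (u : Grid M) : Function.Periodic (interp a b u) (b - a) :=
  trig_periodic hab (modes M) (fourierTilde a b u)

/-- The error of the trigonometric interpolant of the numerical solution. -/
theorem sob_sub_interp_le (hα : 0 < α) (hab : a < b) (hτ : 0 < τ) (hM : 0 < M) (he : Even M)
    (hm : 1 ≤ m) (hψ : IsSolution α ε a b S ψ₀ ψ₁ ψ) (hr : RegBound a b S m K ψ) {n : ℕ}
    (hn : n * τ ≤ S) (s : Finset ℤ) :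
    sob a b 1 s (fourierHat a b fun x => ψ (n * τ) x - interp a b (ewiFP α ε a b τ M ψ₀ ψ₁ n) x)
      ≤ errNorm α ε a b S τ M ψ₀ ψ₁ ψ n + meshSize a b M ^ (m - 1) * K := by
  have ht : (n : ℝ) * τ ∈ Set.Icc 0 S := ⟨by positivity, hn⟩
  have hh0 := meshSize_pos hab hM
  have hc := continuous_of_continuousOn_prod hψ.continuous ht
  set v := ewiFP α ε a b τ M ψ₀ ψ₁ n with hv
  -- Inside the band the difference is the sum of the two component errors; outside, the interpolant
  -- vanishes and the tail of `ψ` remains.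
  have hhat : ∀ l, fourierHat a b (fun x => ψ (n * τ) x - interp a b v x) l
      = (if l ∈ modes M then fourierHat a b (ψ (n * τ)) l - fourierTilde a b v l else 0)
        + if l ∈ modes M then 0 else fourierHat a b (ψ (n * τ)) l := by
    intro l
    rw [fourierHat_sub hc (by fun_prop), show fourierHat a b (interp a b v) l = _ from
      fourierHat_trig hab (modes M) (fourierTilde a b v) l]
    split_ifs <;> simp
  rw [funext hhat]
  refine (sob_add_le _ _ _ _).trans (add_le_add ?_ ?_)
  · have h1 : sob a b 1 s (fun l => if l ∈ modes M then
        fourierHat a b (ψ (n * τ)) l - fourierTilde a b v l else 0)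
        = sob a b 1 (s.filter fun l => l ∈ modes M) (fun l =>
          fourierHat a b (ψ (n * τ)) l - fourierTilde a b v l) := by
      rw [sob, sob, l2, l2, Finset.sum_filter]
      congr 1
      refine Finset.sum_congr rfl fun l _ => ?_
      split_ifs <;> simp
    rw [h1]
    exact sob_hat_sub_tilde_le hα hab hτ hM he n fun l hl => (Finset.mem_filter.1 hl).2
  · have h1 : sob a b 1 s (fun l => if l ∈ modes M then 0 else fourierHat a b (ψ (n * τ)) l)
        = sob a b 1 (s.filter fun l => l ∉ modes M) (fourierHat a b (ψ (n * τ))) := by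
      rw [sob, sob, l2, l2, Finset.sum_filter]
      congr 1
      refine Finset.sum_congr rfl fun l _ => ?_
      by_cases hl : l ∈ modes M <;> simp [hl]
    rw [h1]
    exact (sob_tail_le hab hM he hm fun p hp => (Finset.mem_filter.1 hp).2).trans
      (mul_le_mul_of_nonneg_left (hr.sob_le _ ht _) (by positivity))

/-- The interpolant reproduces the grid values, so the `H¹` embedding applied to the interpolated
error bounds the error at every grid point. -/
theorem norm_sub_ewiFP_le (hα : 0 < α) (hab : a < b) (hτ : 0 < τ) (hM : 0 < M) (he : Even M)
    (hm : 1 ≤ m) (hψ : IsSolution α ε a b S ψ₀ ψ₁ ψ) (hr : RegBound a b S m K ψ) {n : ℕ}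
    (hn : n * τ ≤ S) (j : Fin M) :
    ‖ψ (n * τ) (gridPoint a b M j) - ewiFP α ε a b τ M ψ₀ ψ₁ n j.castSucc‖
      ≤ embC a b * (errNorm α ε a b S τ M ψ₀ ψ₁ ψ n + meshSize a b M ^ (m - 1) * K) := by
  have ht : (n : ℝ) * τ ∈ Set.Icc 0 S := ⟨by positivity, hn⟩
  have hc := continuous_of_continuousOn_prod hψ.continuous ht
  have := norm_le_embC_mul hab (hc.sub (continuous_interp (ewiFP α ε a b τ M ψ₀ ψ₁ n)))
    ((hψ.periodic _ ht).sub (interp_periodic hab (ewiFP α ε a b τ M ψ₀ ψ₁ n)))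
    (sob_sub_interp_le hα hab hτ hM he hm hψ hr hn) (gridPoint a b M j)
  rwa [Pi.sub_apply, interp_gridPoint hab hM he] at this

/-- A discrete Gronwall inequality for a two-step recursion, with a step that may use the bounds
already proved. -/
theorem discrete_gronwall {Y : ℕ → ℝ} {A δ θ : ℝ} {N : ℕ} (hA : 0 ≤ A) (hδ : 0 ≤ δ) (hθ : 0 ≤ θ)
    (h0 : Y 0 ≤ A) (h1 : 1 ≤ N → Y 1 ≤ A)
    (hstep : ∀ k, k + 2 ≤ N → Y k ≤ (1 + 2 * θ) ^ k * (A + k * δ) →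
      Y (k + 1) ≤ (1 + 2 * θ) ^ (k + 1) * (A + (k + 1 : ℕ) * δ) →
      Y (k + 2) ≤ Y (k + 1) + (θ * (Y (k + 1) + Y k) + δ)) :
    ∀ n ≤ N, Y n ≤ (1 + 2 * θ) ^ n * (A + n * δ) := by
  intro n
  induction n using Nat.twoStepInduction with
  | zero => intro _; simpa using h0
  | one =>
    intro hn
    have := h1 hn
    have h2 : 0 ≤ θ * A := mul_nonneg hθ hA
    have h3 : 0 ≤ θ * δ := mul_nonneg hθ hδ
    push_cast
    linarith
  | more k ih0 ih1 =>
    intro hn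
    have e0 := ih0 (by omega)
    have e1 := ih1 (by omega)
    have e2 := hstep k hn e0 e1
    have hq : 1 ≤ 1 + 2 * θ := by linarith
    have hk : (0 : ℝ) ≤ k := Nat.cast_nonneg k
    have hB : 0 ≤ A + k * δ := by positivity
    have e3 : (1 + 2 * θ) ^ k * (A + k * δ) ≤ (1 + 2 * θ) ^ (k + 1) * (A + (k + 1 : ℕ) * δ) := by
      refine mul_le_mul (pow_le_pow_right₀ hq (by omega)) ?_ hB (by positivity)
      push_cast; linarith
    -- The majorant increases with the index, so `E` bounds both earlier values and the two-step
    -- recursion collapses to the one-step factor `1 + 2θ`.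
    set E := (1 + 2 * θ) ^ (k + 1) * (A + (k + 1 : ℕ) * δ) with hE
    have e4 : θ * (Y (k + 1) + Y k) ≤ θ * (E + E) := by gcongr; exact e0.trans e3
    have e5 : δ ≤ (1 + 2 * θ) ^ (k + 2) * δ := le_mul_of_one_le_left hδ (one_le_pow₀ hq)
    have e6 : (1 + 2 * θ) ^ (k + 2) * (A + (k + 2 : ℕ) * δ) = (1 + 2 * θ) * E + (1 + 2 * θ) ^ (k + 2) * δ := by
      rw [hE]; push_cast; ring
    rw [e6]
    linarith

/-- The error bound, as long as it implies that the numerical solution is close to the exact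
solution in the maximum norm. -/
theorem errNorm_le (hα : 0 < α) (hα₁ : α ≤ 1) (hab : a < b) (hS : 0 < S) (hM : 0 < M)
    (he : Even M) (hh : meshSize a b M ≤ 1) (hτ : 0 < τ) (hm : 2 ≤ m) (hK : 1 ≤ K)
    (hψ : IsSolution α ε a b S ψ₀ ψ₁ ψ) (hr : RegBound a b S m K ψ) {A θ δ : ℝ} {N : ℕ}
    (hN : N * τ ≤ S) (hA : 0 ≤ A)
    (hθ : θ = 2 * ε ^ 2 / α * τ * defectC a b K) (hδ : δ = θ * (τ ^ 2 + meshSize a b M ^ (m - 1)))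
    (h0 : errNorm α ε a b S τ M ψ₀ ψ₁ ψ 0 + 2 * ε ^ 2 / α * (τ * (6 * supC a b K ^ 3 * τ
      + 24 * aliasC * supC a b K ^ 3 * meshSize a b M ^ (m - 1))) ≤ A)
    (hsmall : ∀ n ≤ N, embC a b * ((1 + 2 * θ) ^ n * (A + n * δ) + meshSize a b M ^ (m - 1) * K) ≤ 1) :
    ∀ n ≤ N, errNorm α ε a b S τ M ψ₀ ψ₁ ψ n ≤ (1 + 2 * θ) ^ n * (A + n * δ) := by
  have hR := supC_pos (a := a) (b := b) hK
  have hD := defectC_pos (a := a) (b := b) hK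
  have hh0 := meshSize_pos hab hM
  have hal := aliasC_nonneg
  have hθ0 : 0 ≤ θ := by rw [hθ]; positivity
  have hδ0 : 0 ≤ δ := by rw [hδ]; positivity
  have hnS : ∀ n ≤ N, (n : ℝ) * τ ≤ S := fun n hn => by
    have : (n : ℝ) ≤ N := by exact_mod_cast hn
    exact (mul_le_mul_of_nonneg_right this hτ.le).trans hN
  have hsucc : ∀ n, n + 1 ≤ N → (n : ℝ) * τ + τ ≤ S := fun n hn => by
    have := hnS (n + 1) hn
    push_cast at this
    linarith
  -- The bootstrap: the error bound at index `n` and `hsmall` put the numerical values within 1 of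
  -- the exact ones. The cubic term is therefore evaluated only in the ball of radius `supC + 1`,
  -- where its Lipschitz constant is known.
  have hgrid : ∀ n ≤ N, errNorm α ε a b S τ M ψ₀ ψ₁ ψ n ≤ (1 + 2 * θ) ^ n * (A + n * δ) →
      ∀ j : Fin M, ‖ewiFP α ε a b τ M ψ₀ ψ₁ n j.castSucc‖ ≤ supC a b K + 1 := by
    intro n hn hY j
    have ht : (n : ℝ) * τ ∈ Set.Icc 0 S := ⟨by positivity, hnS n hn⟩
    have h1 := norm_sub_ewiFP_le hα hab hτ hM he (by omega) hψ hr ht.2 j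
    have h2 : embC a b * (errNorm α ε a b S τ M ψ₀ ψ₁ ψ n + meshSize a b M ^ (m - 1) * K)
        ≤ embC a b * ((1 + 2 * θ) ^ n * (A + n * δ) + meshSize a b M ^ (m - 1) * K) :=
      mul_le_mul_of_nonneg_left (by linarith) embC_nonneg
    have h3 := norm_le_norm_add_norm_sub (ψ (n * τ) (gridPoint a b M j))
      (ewiFP α ε a b τ M ψ₀ ψ₁ n j.castSucc)
    have h4 := norm_le_supC (a := a) (b := b) hK hr ht (gridPoint a b M j)
    linarith [hsmall n hn]
  have hρ0 : 0 ≤ 2 * ε ^ 2 / α * (τ * (6 * supC a b K ^ 3 * τ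
      + 24 * aliasC * supC a b K ^ 3 * meshSize a b M ^ (m - 1))) := by positivity
  refine discrete_gronwall hA hδ0 hθ0 (by linarith) (fun h1 => ?_) fun k hk e0 e1 => ?_
  · have h2 := hsucc 0 h1
    have h3 := errNorm_succ_le hα hα₁ hab hS hψ hτ.le h2 fun s hs =>
      l2_defect_zero_le hab hM he hh (by omega) hK hψ hr (by simpa using h2) hs
    exact h3.trans h0
  · have h2 := hsucc (k + 1) hk
    have h3 := errNorm_succ_le hα hα₁ hab hS hψ hτ.le h2 fun s hs =>
      l2_defect_succ_le hα hab hS hτ hM he hh (by omega) hK hψ hr h2 (hgrid k (by omega) e0)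
        (hgrid (k + 1) (by omega) e1) hs
    refine h3.trans (le_of_eq ?_)
    rw [hδ, hθ]
    ring

/-- The factor in the discrete Gronwall inequality stays bounded on the time interval. -/
theorem gronwall_bound {A δ θ H e P Q : ℝ} {n : ℕ} (hθ : 0 ≤ θ) (hH : 0 ≤ H)
    (he₁ : e ≤ 1) (hQ : 0 ≤ Q) (hδ : δ = θ * (τ ^ 2 + H))
    (hnθ : n * θ ≤ Q * e) (hA : A ≤ P * (H + e * τ ^ 2)) (hA0 : 0 ≤ A) :
    (1 + 2 * θ) ^ n * (A + n * δ) ≤ Real.exp (2 * Q) * (P + Q) * (H + e * τ ^ 2) := by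
  have h1 : (1 + 2 * θ) ^ n ≤ Real.exp (2 * Q) := by
    have : 1 + 2 * θ ≤ Real.exp (2 * θ) := by linarith [Real.add_one_le_exp (2 * θ)]
    refine (pow_le_pow_left₀ (by linarith) this n).trans ?_
    rw [← Real.exp_nat_mul]
    refine Real.exp_le_exp.2 ?_
    have : Q * e ≤ Q := mul_le_of_le_one_right hQ he₁
    linarith
  -- The accumulated error is `Q e (τ² + H)`. The factor `e` is kept on `τ²` and dropped on `H`.
  have h2 : n * δ ≤ Q * (H + e * τ ^ 2) := by
    rw [hδ, ← mul_assoc]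
    refine (mul_le_mul_of_nonneg_right hnθ (by positivity)).trans ?_
    have : e * H ≤ H := mul_le_of_le_one_left hH he₁
    have := mul_le_mul_of_nonneg_left this hQ
    linarith
  have h3 : 0 ≤ n * δ := by rw [hδ]; positivity
  rw [mul_assoc]
  refine mul_le_mul h1 (by linarith) (by linarith) (Real.exp_pos _).le

end convergence

end NLSW

end

/-! ### Choice of constants and conclusion. -/

theorem theorem3p1
    (α : ℝ) (hα₀ : 0 < α) (hα₁ : α ≤ 1)
    (a b : ℝ) (hab : a < b) (T : ℝ) (hT : 0 < T) (m : ℕ) (hm : 2 ≤ m) (K : ℝ) :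
    ∃ h₀ > (0 : ℝ), ∃ τ₀ > (0 : ℝ), ∃ C > (0 : ℝ),
      ∀ ε : ℝ, 0 < ε → ε ≤ 1 → ∀ β : ℝ, 0 ≤ β → β ≤ 2 →
      ∀ (ψ₀ ψ₁ : ℝ → ℂ) (ψ : ℝ → ℝ → ℂ),
        NLSW.IsSolution α ε a b (T / ε ^ β) ψ₀ ψ₁ ψ →
        NLSW.regularityNorm a b (T / ε ^ β) m ψ ≤ ENNReal.ofReal K →
        NLSW.sobolevNorm a b (m + 2) ψ₀ ≤ ENNReal.ofReal K →
      ∀ M₁ : ℝ, (∀ t ∈ Set.Icc 0 (T / ε ^ β), ∀ x : ℝ, ‖ψ t x‖ ≤ M₁) →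
      ∀ M : ℕ, 0 < M → Even M → NLSW.meshSize a b M < h₀ →
      ∀ τ : ℝ, 0 < τ → τ < τ₀ →
      ∀ n : ℕ, (n : ℝ) ≤ T / ε ^ β / τ →
        NLSW.sobolevNorm a b 1
            (fun x => ψ (n * τ) x
              - NLSW.interp a b (NLSW.ewiFP α ε a b τ M ψ₀ ψ₁ n) x)
          ≤ ENNReal.ofReal (C * (NLSW.meshSize a b M ^ (m - 1) + ε ^ (2 - β) * τ ^ 2)) ∧
        NLSW.linftyNorm (NLSW.ewiFP α ε a b τ M ψ₀ ψ₁ n) ≤ 1 + M₁ := by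
  -- Enlarging `K` to at least 1 makes the powers of the bound comparable and also covers
  -- nonpositive `K`.
  obtain ⟨K', hK'⟩ : ∃ x, x = max K 1 := ⟨_, rfl⟩
  have hK : 1 ≤ K' := hK' ▸ le_max_right _ _
  have hKK : K ≤ K' := hK' ▸ le_max_left _ _
  obtain ⟨Cv, hCv, hvel⟩ :=
    NLSW.exists_sob_velocity_tail_le (m := m) (K := K') hα₀ hα₁ hab hT hm hK
  have hR := NLSW.supC_pos (a := a) (b := b) hK
  have hD := NLSW.defectC_pos (a := a) (b := b) hK
  have hal := NLSW.aliasC_nonneg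
  have hemb := NLSW.embC_nonneg (a := a) (b := b)
  -- `CY` comes from the discretized initial data, `C₀` from the defect of the first step, and `P`
  -- combines them. `Q` bounds `nθ / ε^{2-β}` over the whole time interval.
  obtain ⟨CY, hCY⟩ : ∃ x, x = 2 * (NLSW.aliasC * (Cv + 5 * K')) := ⟨_, rfl⟩
  obtain ⟨C₀, hC₀⟩ : ∃ x, x =
      6 * NLSW.supC a b K' ^ 3 + 24 * NLSW.aliasC * NLSW.supC a b K' ^ 3 := ⟨_, rfl⟩
  obtain ⟨P, hP⟩ : ∃ x, x = CY + 2 / α * C₀ := ⟨_, rfl⟩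
  obtain ⟨Q, hQ⟩ : ∃ x, x = 2 / α * NLSW.defectC a b K' * T := ⟨_, rfl⟩
  have hCY0 : 0 ≤ CY := by rw [hCY]; positivity
  have hC₀0 : 0 ≤ C₀ := by rw [hC₀]; positivity
  have hP0 : 0 ≤ P := by rw [hP]; positivity
  have hQ0 : 0 ≤ Q := by rw [hQ]; positivity
  obtain ⟨C, hC⟩ : ∃ x, x = Real.exp (2 * Q) * (P + Q) + K' := ⟨_, rfl⟩
  have hC0 : 0 < C := by rw [hC]; positivity
  -- One threshold serves for both `h` and `τ`. The factor 2 covers `h^{m-1} + ε^{2-β} τ² ≤ h + τ ≤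
  -- 2r`, and the rest makes the resulting pointwise error at most 1.
  obtain ⟨r, hr_def⟩ : ∃ x, x = min 1 (1 / (2 * (NLSW.embC a b + 1) * C)) := ⟨_, rfl⟩
  have hr0 : 0 < r := hr_def ▸ lt_min one_pos (by positivity)
  have hr1 : r ≤ 1 := hr_def ▸ min_le_left _ _
  refine ⟨r, hr0, r, hr0, C, hC0, ?_⟩
  intro ε hε hε₁ β hβ hβ₂ ψ₀ ψ₁ ψ hψ hreg _ M₁ hM₁ M hM he hh τ hτ hττ n hn
  generalize hS_def : T / ε ^ β = S at *
  have hh0 : 0 < NLSW.meshSize a b M := NLSW.meshSize_pos hab hM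
  obtain ⟨H, hH⟩ : ∃ x, x = NLSW.meshSize a b M ^ (m - 1) := ⟨_, rfl⟩
  obtain ⟨e, he_def⟩ : ∃ x, x = ε ^ (2 - β) := ⟨_, rfl⟩
  rw [← hH, ← he_def]
  have hεβ : 0 < ε ^ β := Real.rpow_pos_of_pos hε β
  have hεβ₁ : ε ^ β ≤ 1 := Real.rpow_le_one hε.le hε₁ hβ
  have hTS : T ≤ S := by rw [← hS_def, le_div_iff₀ hεβ]; nlinarith
  have hS : 0 < S := hT.trans_le hTS
  have he0 : 0 < e := he_def ▸ Real.rpow_pos_of_pos hε _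
  have he1 : e ≤ 1 := he_def ▸ Real.rpow_le_one hε.le hε₁ (by linarith)
  -- The long-time mechanism: a nonlinearity of strength `ε²` acting over a time `T/ε^β` has total
  -- effect `T ε^{2-β} ≤ T`.
  have hεS : ε ^ 2 * S = T * e := by
    rw [← hS_def, he_def, Real.rpow_sub hε, Real.rpow_two]; ring
  have hε2 : ε ^ 2 ≤ e := by
    rw [he_def, ← Real.rpow_two]
    exact Real.rpow_le_rpow_of_exponent_ge hε hε₁ (by linarith)
  have hh1 : NLSW.meshSize a b M ≤ 1 := hh.le.trans hr1
  have hτ1 : τ ≤ 1 := hττ.le.trans hr1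
  have hH0 : 0 ≤ H := hH ▸ pow_nonneg hh0.le _
  have hHh : H ≤ NLSW.meshSize a b M := by
    have := pow_le_pow_of_le_one hh0.le hh1 (show 1 ≤ m - 1 by omega)
    rwa [pow_one, ← hH] at this
  have hnS : n * τ ≤ S := (le_div_iff₀ hτ).1 hn
  have hreg' : NLSW.RegBound a b S m K' ψ := NLSW.regBound_of_regularityNorm_le (by linarith)
    (hreg.trans (ENNReal.ofReal_le_ofReal hKK))
  obtain ⟨Φ, hΦ⟩ : ∃ x, x = H + e * τ ^ 2 := ⟨_, rfl⟩
  rw [← hΦ]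
  have hΦ0 : 0 ≤ Φ := by rw [hΦ]; positivity
  have hHΦ : H ≤ Φ := hΦ ▸ le_add_of_nonneg_right (by positivity)
  have hsmall : NLSW.embC a b * (C * Φ) ≤ 1 := by
    have h1 : Φ ≤ 2 * r := by
      have : e * τ ^ 2 ≤ 1 * τ ^ 2 := mul_le_mul_of_nonneg_right he1 (sq_nonneg _)
      have : τ ^ 2 ≤ τ := by nlinarith
      linarith
    have h2 : r ≤ 1 / (2 * (NLSW.embC a b + 1) * C) := hr_def ▸ min_le_right _ _
    rw [le_div_iff₀ (by positivity)] at h2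
    calc NLSW.embC a b * (C * Φ) ≤ (NLSW.embC a b + 1) * (C * (2 * r)) := by
          gcongr; linarith
      _ = r * (2 * (NLSW.embC a b + 1) * C) := by ring
      _ ≤ 1 := h2
  obtain ⟨θ, hθ⟩ : ∃ x, x = 2 * ε ^ 2 / α * τ * NLSW.defectC a b K' := ⟨_, rfl⟩
  have hθ0 : 0 ≤ θ := by rw [hθ]; positivity
  obtain ⟨δ, hδ⟩ : ∃ x, x = θ * (τ ^ 2 + H) := ⟨_, rfl⟩
  -- `A` contains the error after the first step as well, because the recursion with extrapolation
  -- starts only from the second.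
  obtain ⟨A, hA⟩ : ∃ x, x = CY * H + 2 * ε ^ 2 / α * (τ * (6 * NLSW.supC a b K' ^ 3 * τ
      + 24 * NLSW.aliasC * NLSW.supC a b K' ^ 3 * H)) := ⟨_, rfl⟩
  have hA0 : 0 ≤ A := by rw [hA]; positivity
  have hAle : A ≤ P * Φ := by
    have h1 : τ * (6 * NLSW.supC a b K' ^ 3 * τ + 24 * NLSW.aliasC * NLSW.supC a b K' ^ 3 * H)
        ≤ C₀ * (τ ^ 2 + H) := by
      have e1 : τ * H ≤ H := mul_le_of_le_one_left hH0 hτ1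
      have e2 : 24 * NLSW.aliasC * NLSW.supC a b K' ^ 3 * (τ * H)
          ≤ 24 * NLSW.aliasC * NLSW.supC a b K' ^ 3 * H := by gcongr
      have e3 : 0 ≤ 24 * NLSW.aliasC * NLSW.supC a b K' ^ 3 * τ ^ 2 := by positivity
      have e4 : 0 ≤ 6 * NLSW.supC a b K' ^ 3 * H := by positivity
      rw [hC₀]
      linarith
    -- The first step contributes `ε² τ²`, which fits into `ε^{2-β} τ²` because `ε ≤ 1` and `β ≥ 0`.
    have h2 : ε ^ 2 * (τ ^ 2 + H) ≤ Φ := by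
      have e1 : ε ^ 2 * τ ^ 2 ≤ e * τ ^ 2 := mul_le_mul_of_nonneg_right hε2 (sq_nonneg _)
      have e2 : ε ^ 2 * H ≤ H := mul_le_of_le_one_left hH0 (hε2.trans he1)
      linarith
    have h3 : CY * H ≤ CY * Φ := mul_le_mul_of_nonneg_left hHΦ hCY0
    have h4 : 2 * ε ^ 2 / α * (C₀ * (τ ^ 2 + H)) ≤ 2 / α * C₀ * Φ := by
      calc 2 * ε ^ 2 / α * (C₀ * (τ ^ 2 + H)) = 2 / α * C₀ * (ε ^ 2 * (τ ^ 2 + H)) := by ring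
        _ ≤ _ := mul_le_mul_of_nonneg_left h2 (by positivity)
    have h5 := mul_le_mul_of_nonneg_left h1 (show 0 ≤ 2 * ε ^ 2 / α by positivity)
    rw [hA, hP, add_mul]
    linarith
  have hbound : ∀ k : ℕ, k ≤ n → (1 + 2 * θ) ^ k * (A + k * δ) ≤ Real.exp (2 * Q) * (P + Q) * Φ := by
    intro k hk
    rw [hΦ] at hAle ⊢
    refine NLSW.gronwall_bound hθ0 hH0 he1 hQ0 hδ ?_ hAle hA0
    have hkn : (k : ℝ) ≤ n := by exact_mod_cast hk
    have h1 : ε ^ 2 * (k * τ) ≤ T * e := by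
      rw [← hεS]
      refine mul_le_mul_of_nonneg_left ?_ (sq_nonneg _)
      exact (mul_le_mul_of_nonneg_right hkn hτ.le).trans hnS
    calc k * θ = 2 / α * NLSW.defectC a b K' * (ε ^ 2 * (k * τ)) := by rw [hθ]; ring
      _ ≤ 2 / α * NLSW.defectC a b K' * (T * e) := mul_le_mul_of_nonneg_left h1 (by positivity)
      _ = Q * e := by rw [hQ]; ring
  have hfinal : ∀ k : ℕ, k ≤ n → (1 + 2 * θ) ^ k * (A + k * δ) + H * K' ≤ C * Φ := by
    intro k hk
    have h1 := hbound k hk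
    have h2 : H * K' ≤ K' * Φ := by rw [mul_comm]; gcongr
    rw [hC, add_mul]
    linarith
  have herr := NLSW.errNorm_le hα₀ hα₁ hab hS hM he hh1 hτ hm hK hψ hreg' hnS hA0 hθ (hH ▸ hδ)
    (by
      have := NLSW.errNorm_zero_le (τ := τ) hα₀ hα₁ hab hS hM he hh1 hm hK hψ hreg' hCv
        (hvel ε S ψ₀ ψ₁ ψ M hε hε₁ hTS hψ hreg' hM he hh1)
      rw [← hH] at this ⊢
      rw [hA, hCY]
      linarith)
    (fun k hk => hH ▸ (mul_le_mul_of_nonneg_left (hfinal k hk) hemb).trans hsmall) n le_rfl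
  have hsum : NLSW.errNorm α ε a b S τ M ψ₀ ψ₁ ψ n + H * K' ≤ C * Φ := by
    linarith [hfinal n le_rfl]
  constructor
  · rw [NLSW.sobolevNorm_le_iff (by positivity)]
    intro s
    refine (NLSW.sob_sub_interp_le hα₀ hab hτ hM he (by omega) hψ hreg' hnS s).trans ?_
    rw [← hH]
    exact hsum
  · have ht : (n : ℝ) * τ ∈ Set.Icc 0 S := ⟨by positivity, hnS⟩
    have hM₁0 : 0 ≤ M₁ := (norm_nonneg _).trans (hM₁ _ ht 0)
    rw [NLSW.linftyNorm, pi_norm_le_iff_of_nonneg (by linarith)]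
    intro j
    have h1 := NLSW.norm_sub_ewiFP_le hα₀ hab hτ hM he (by omega) hψ hreg' hnS j
    rw [← hH] at h1
    have h2 := mul_le_mul_of_nonneg_left hsum hemb
    have h3 := norm_le_norm_add_norm_sub (ψ (n * τ) (NLSW.gridPoint a b M j))
      (NLSW.ewiFP α ε a b τ M ψ₀ ψ₁ n j.castSucc)
    -- The pointwise error is at most `embC · C Φ ≤ 1`, independently of `M₁`, so any bound for the
    -- exact solution may be inserted here.
    linarith [hM₁ _ ht (NLSW.gridPoint a b M j)]
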